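/- Let $n\in\{2,3\}$, $k\ge 1$, and let $\Omega\subset\mathbb R^n$ be a connected polyhedral domain, in the sense that $\Omega$ is nonempty, open and connected, $\Omega=\operatorname{int}\overline\Omega$, and $\overline\Omega$ is the union of the simplices of a finite conforming simplicial mesh $\mathcal T_h$ (this covers every bounded connected Lipschitz polyhedral domain). Assume that $\mathcal T_h$ arises from a conforming simplicial mesh of $\overline\Omega$ by splitting each simplex into $n+1$ simplices, connecting its vertices to its barycentre. Let $\partial\Omega=\Gamma_0\cup\Gamma_1$ be a disjoint partition such that $\Gamma_0$ has positive surface measure and each boundary face of the mesh is contained, up to a surface null set, in $\Gamma_0$ or in $\Gamma_1$. Let $\rho_S>0$ be a constant, $f\in L^2(\Omega;\mathbb R^n)$, and let $$\mathcal A\tau=\frac1{2\mu_S}\Big(\tau-\frac1n(\operatorname{tr}\tau)I\Big)+\frac1{n(n\lambda_S+2\mu_S)}(\operatorname{tr}\tau)I ,$$ where $\lambda_S,\mu_S$ are constant on each element, with $\mu_S>0$ and $n\lambda_S+2\mu_S>0$. Let $P^r$ denote polynomials of degree at most $r$, and put $$\widetilde V^h=\{v\in L^2(\Omega;\mathbb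 R^{n\times n}): v|_K\in P^{k+1}(K)^{n\times n}\ \forall K\in\mathcal T_h\},\qquad W^h=\{w\in L^2(\Omega;\mathbb R^n): w|_K\in P^k(K)^n\ \forall K\in\mathcal T_h\},$$ $$A^h=\{\eta\in\widetilde V^h:\eta+\eta^t=0\},\qquad M^h=\{\mu:\mu|_F\in P^{k+1}(F)^n\text{ for all mesh faces }F,\ \mu|_F=0\text{ for all faces }F\subset\Gamma_0\}.$$ Write $(\cdot,\cdot)_{\mathcal T_h}=\sum_K\int_K$ and $\langle\mu,vn\rangle_{\partial\mathcal T_h}=\sum_K\int_{\partial K}\mu\cdot (v|_K n_K)\,ds$ with $n_K$ the outward unit normal of $K$; $\operatorname{div}$ acts row-wise and element by element. The *hybridized mixed source system* for $(\sigma_h,u_h,\rho_h,\gamma_h)\in\widetilde V^h\times W^h\times A^h\times M^h$ is: for all $(v,w,\eta,\mu)\in\widetilde V^h\times W^h\times A^h\times M^h$, $$(\mathcal A\sigma_h,v)_{\mathcal T_h}+(u_h,\operatorname{div}v)_{\mathcal T_h}+(\rho_h,v)_{\mathcal T_h}+\langle\gamma_h,vn\rangle_{\partial\mathcal T_h}=0,\quad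 -(\rho_S^{-1}\operatorname{div}\sigma_h,w)_{\mathcal T_h}=(f,w)_{\mathcal T_h},\quad(\sigma_h,\eta)_{\mathcal T_h}=0,\quad\langle\mu,\sigma_hn\rangle_{\partial\mathcal T_h}=0.$$ For $\mu\in M^h$ let $(Q_1\mu,Q_2\mu,Q_3\mu)\in\widetilde V^h\times W^h\times A^h$ be the solution of $$(\mathcal AQ_1\mu,v)_{\mathcal T_h}+(Q_2\mu,\operatorname{div}v)_{\mathcal T_h}+(Q_3\mu,v)_{\mathcal T_h}=-\langle\mu,vn\rangle_{\partial\mathcal T_h},\quad(\rho_S^{-1}\operatorname{div}Q_1\mu,w)_{\mathcal T_h}=0,\quad(Q_1\mu,\eta)_{\mathcal T_h}=0,$$ and let $(Q_1^Lf,Q_2^Lf,Q_3^Lf)\in\widetilde V^h\times W^h\times A^h$ be the solution of the same system with right-hand sides $0$, $-(f,w)_{\mathcal T_h}$, $0$, in both cases for all $(v,w,\eta)\in\widetilde V^h\times W^h\times A^h$. Put $$a_h(\mu_1,\mu_2)=(\mathcal AQ_1\mu_1,Q_1\mu_2)_{\mathcal T_h},\qquad b_h(\mu)=(\rho_Sf,Q_2\mu)_{\mathcal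 T_h}.$$ **Theorem.** These local systems are uniquely solvable, and the condensed problem of finding $\gamma\in M^h$ with $a_h(\gamma,\mu)=b_h(\mu)$ for all $\mu\in M^h$ has exactly one solution. Moreover $(\sigma_h,u_h,\rho_h,\gamma_h)\in\widetilde V^h\times W^h\times A^h\times M^h$ satisfies the hybridized mixed source system if and only if $\gamma_h$ is the unique solution of the condensed problem and $$\sigma_h=Q_1\gamma_h+Q_1^Lf,\qquad u_h=Q_2\gamma_h+Q_2^Lf,\qquad\rho_h=Q_3\gamma_h+Q_3^Lf .$$ -/

import Mathlib

open MeasureTheory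

noncomputable section

namespace HybridElasticity

/-- Points of Euclidean `n`-space. -/
abbrev Pt (n : ℕ) := EuclideanSpace ℝ (Fin n)

/-- Polynomials in the `n` coordinates. -/
abbrev Poly (n : ℕ) := MvPolynomial (Fin n) ℝ

/-- The value of a polynomial at a point. -/
def ev {n : ℕ} (p : Poly n) (x : Pt n) : ℝ := MvPolynomial.eval (fun i => x i) p

/-- The closed simplex spanned by a set of vertices. -/
def hull {n : ℕ} (s : Finset (Pt n)) : Set (Pt n) := convexHull ℝ (s : Set (Pt n))

/-- The barycentre of a set of vertices. -/
def barycentre {n : ℕ} (s : Finset (Pt n)) : Pt n := (s.card : ℝ)⁻¹ • ∑ x ∈ s, x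

/-- A conforming mesh of (the closure of) `Ω` by finitely many nondegenerate `n`-simplices.
A simplex is given by its set of vertices. -/
structure Mesh (n : ℕ) (Ω : Set (Pt n)) where
  cells : Finset (Finset (Pt n))
  card_cell : ∀ K ∈ cells, K.card = n + 1
  indep : ∀ K ∈ cells, AffineIndependent ℝ ((↑) : K → Pt n)
  conforming : ∀ K ∈ cells, ∀ L ∈ cells,
    hull K ∩ hull L = convexHull ℝ ((K : Set (Pt n)) ∩ (L : Set (Pt n)))
  covers : (⋃ K ∈ cells, hull K) = closure Ω

open scoped Classical in
/-- The mesh `T` is obtained from some conforming mesh of the same domain by splitting each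
simplex into `n + 1` simplices, connecting its vertices to its barycentre. -/
def Mesh.IsBarycentricSplit {n : ℕ} {Ω : Set (Pt n)} (T : Mesh n Ω) : Prop :=
  ∃ T₀ : Mesh n Ω, ∀ s : Finset (Pt n),
    s ∈ T.cells ↔ ∃ K ∈ T₀.cells, ∃ a ∈ K, s = insert (barycentre K) (K.erase a)

open scoped Classical in
/-- The `(n-1)`-dimensional faces of the mesh. -/
def Mesh.facets {n : ℕ} {Ω : Set (Pt n)} (T : Mesh n Ω) : Finset (Finset (Pt n)) :=
  T.cells.biUnion fun K => K.powersetCard n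

abbrev Mesh.Cell {n : ℕ} {Ω : Set (Pt n)} (T : Mesh n Ω) := {K // K ∈ T.cells}

abbrev Mesh.Facet {n : ℕ} {Ω : Set (Pt n)} (T : Mesh n Ω) := {F // F ∈ T.facets}

/-- Surface measure: the `(n-1)`-dimensional Hausdorff measure, normalised to be Lebesgue measure
on hyperplanes. -/
def surf (n : ℕ) : Measure (Pt n) := Measure.euclideanHausdorffMeasure (n - 1)

/-- `F` is contained in `Γ`, up to a set of surface measure zero. -/
def LiesIn {n : ℕ} (F : Finset (Pt n)) (Γ : Set (Pt n)) : Prop := surf n (hull F \ Γ) = 0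

/-- The outward unit normal to the simplex `K` on its facet `F`: the normalised component,
orthogonal to `F`, of the vector from the barycentre of `K` to the barycentre of `F`. -/
def outwardNormal {n : ℕ} (K F : Finset (Pt n)) : Pt n :=
  let w := (vectorSpan ℝ (F : Set (Pt n)))ᗮ.starProjection (barycentre F - barycentre K)
  ‖w‖⁻¹ • w

/-! ### Spaces

An element of `L²` whose restriction to each cell is a polynomial is the same thing as a family of
polynomials indexed by the cells, because the cells are nondegenerate and do not overlap. -/

section Spaces

variable {n : ℕ} {Ω : Set (Pt n)} (T : Mesh n Ω) (k : ℕ)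

/-- Broken stresses: matrix-valued, of degree at most `k + 1` on each cell, with no continuity
across faces. -/
def Vh : Submodule ℝ (T.Cell → Matrix (Fin n) (Fin n) (Poly n)) where
  carrier := {σ | ∀ K i j, σ K i j ∈ MvPolynomial.restrictTotalDegree (Fin n) ℝ (k + 1)}
  add_mem' h₁ h₂ K i j := Submodule.add_mem _ (h₁ K i j) (h₂ K i j)
  zero_mem' _ _ _ := Submodule.zero_mem _
  smul_mem' c _ h K i j := Submodule.smul_mem _ c (h K i j)

/-- Displacements: vector-valued, of degree at most `k` on each cell. -/
def Wh : Submodule ℝ (T.Cell → Fin n → Poly n) where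
  carrier := {u | ∀ K i, u K i ∈ MvPolynomial.restrictTotalDegree (Fin n) ℝ k}
  add_mem' h₁ h₂ K i := Submodule.add_mem _ (h₁ K i) (h₂ K i)
  zero_mem' _ _ := Submodule.zero_mem _
  smul_mem' c _ h K i := Submodule.smul_mem _ c (h K i)

/-- Rotations: skew-symmetric, of degree at most `k + 1` on each cell. -/
def Ah : Submodule ℝ (T.Cell → Matrix (Fin n) (Fin n) (Poly n)) where
  carrier := {η | (∀ K i j, η K i j ∈ MvPolynomial.restrictTotalDegree (Fin n) ℝ (k + 1)) ∧
    ∀ K i j, η K i j + η K j i = 0}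
  add_mem' {a b} h₁ h₂ := ⟨fun K i j => Submodule.add_mem _ (h₁.1 K i j) (h₂.1 K i j),
    fun K i j => by
      have e₁ := h₁.2 K i j
      have e₂ := h₂.2 K i j
      simp only [Pi.add_apply, Matrix.add_apply]
      linear_combination e₁ + e₂⟩
  zero_mem' := ⟨fun _ _ _ => Submodule.zero_mem _, fun _ _ _ => add_zero _⟩
  smul_mem' c a h := ⟨fun K i j => Submodule.smul_mem _ c (h.1 K i j), fun K i j => by
    have e := h.2 K i j
    simp only [Pi.smul_apply, Matrix.smul_apply, ← smul_add, e, smul_zero]⟩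

/-- Multipliers: on each face `F` a vector-valued function on `F` (extended by zero outside of `F`)
that is the restriction of polynomials of degree at most `k + 1`, and that vanishes if `F` is a
boundary face in `Γ₀`. -/
def Mh (Γ₀ : Set (Pt n)) : Submodule ℝ (T.Facet → Pt n → Fin n → ℝ) where
  carrier := {μ | (∀ F : T.Facet, ∃ p : Fin n → Poly n,
      (∀ i, p i ∈ MvPolynomial.restrictTotalDegree (Fin n) ℝ (k + 1)) ∧
      μ F = (hull F.1).indicator fun x i => ev (p i) x) ∧
    ∀ F : T.Facet, LiesIn F.1 Γ₀ → μ F = 0}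
  add_mem' {a b} h₁ h₂ := by
    refine ⟨fun F => ?_, fun F hF => by simp [h₁.2 F hF, h₂.2 F hF]⟩
    obtain ⟨p, hp, ep⟩ := h₁.1 F
    obtain ⟨q, hq, eq⟩ := h₂.1 F
    refine ⟨p + q, fun i => Submodule.add_mem _ (hp i) (hq i), ?_⟩
    rw [Pi.add_apply, ep, eq]
    funext x
    by_cases hx : x ∈ hull F.1
    · funext i
      simp [hx, ev]
    · simp [hx]
  zero_mem' := ⟨fun F => ⟨0, fun i => Submodule.zero_mem _, by
    funext x
    by_cases hx : x ∈ hull F.1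
    · funext i
      simp [hx, ev]
    · simp [hx]⟩, fun _ _ => rfl⟩
  smul_mem' c a h := by
    refine ⟨fun F => ?_, fun F hF => by simp [h.2 F hF]⟩
    obtain ⟨p, hp, ep⟩ := h.1 F
    refine ⟨c • p, fun i => Submodule.smul_mem _ c (hp i), ?_⟩
    rw [Pi.smul_apply, ep]
    funext x
    by_cases hx : x ∈ hull F.1
    · funext i
      simp [hx, ev, MvPolynomial.smul_eval]
    · simp [hx]

end Spaces

section Forms

variable {n : ℕ} {Ω : Set (Pt n)} (T : Mesh n Ω)

/-- Row-wise divergence of a matrix of polynomials. -/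
def divRow (τ : Matrix (Fin n) (Fin n) (Poly n)) : Fin n → Poly n :=
  fun i => ∑ j, MvPolynomial.pderiv j (τ i j)

/-- The deviator of a matrix of polynomials. -/
def dev (τ : Matrix (Fin n) (Fin n) (Poly n)) : Matrix (Fin n) (Fin n) (Poly n) :=
  τ - (1 / (n : ℝ)) • (τ.trace • (1 : Matrix (Fin n) (Fin n) (Poly n)))

/-- The isotropic compliance tensor (inverse of the elasticity operator) with Lamé coefficients
`lam`, `mu`. -/
def compliance (lam mu : ℝ) (τ : Matrix (Fin n) (Fin n) (Poly n)) :
    Matrix (Fin n) (Fin n) (Poly n) :=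
  (1 / (2 * mu)) • dev τ +
    (1 / (n * (n * lam + 2 * mu))) • (τ.trace • (1 : Matrix (Fin n) (Fin n) (Poly n)))

/-- `(σ, τ)` over the mesh, for matrix fields, with the Frobenius product. -/
def matInner (σ τ : T.Cell → Matrix (Fin n) (Fin n) (Poly n)) : ℝ :=
  ∑ K : T.Cell, ∫ x in hull K.1, ∑ i, ∑ j, ev (σ K i j) x * ev (τ K i j) x

/-- `(u, w)` over the mesh, for vector fields. -/
def vecInner (u w : T.Cell → Fin n → Poly n) : ℝ :=
  ∑ K : T.Cell, ∫ x in hull K.1, ∑ i, ev (u K i) x * ev (w K i) x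

/-- `(f, w)` over the mesh, for a function `f` and a piecewise polynomial `w`. -/
def loadInner (f : Pt n → Pt n) (w : T.Cell → Fin n → Poly n) : ℝ :=
  ∑ K : T.Cell, ∫ x in hull K.1, ∑ i, f x i * ev (w K i) x

open scoped Classical in
/-- `⟨μ, v n⟩` over the boundaries of all cells: each cell contributes the integrals over its
facets, with its own values of `v` and its own outward normal. -/
def bdryInner (μ : T.Facet → Pt n → Fin n → ℝ)
    (v : T.Cell → Matrix (Fin n) (Fin n) (Poly n)) : ℝ :=
  ∑ K : T.Cell, ∑ F : T.Facet with F.1 ⊆ K.1,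
    ∫ x in hull F.1, ∑ i, μ F x i * ∑ j, ev (v K i j) x * outwardNormal K.1 F.1 j ∂(surf n)

/-- The piecewise constant compliance tensor applied to a piecewise polynomial matrix field. -/
def cplFun (lam mu : T.Cell → ℝ) (σ : T.Cell → Matrix (Fin n) (Fin n) (Poly n)) :
    T.Cell → Matrix (Fin n) (Fin n) (Poly n) := fun K => compliance (lam K) (mu K) (σ K)

/-- Cellwise divergence. -/
def divh (σ : T.Cell → Matrix (Fin n) (Fin n) (Poly n)) : T.Cell → Fin n → Poly n :=
  fun K => divRow (σ K)

end Forms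

section Systems

variable {n : ℕ} {Ω : Set (Pt n)} (T : Mesh n Ω) (k : ℕ) (Γ₀ : Set (Pt n))
  (lam mu : T.Cell → ℝ) (ρS : ℝ)

/-- The hybridized mixed source system with load `f`. -/
def IsHybridSolution (f : Pt n → Pt n) (σ : Vh T k) (u : Wh T k) (ρ : Ah T k)
    (γ : Mh T k Γ₀) : Prop :=
  (∀ v : Vh T k, matInner T (cplFun T lam mu σ) v + vecInner T u (divh T v) + matInner T ρ v
      + bdryInner T γ v = 0) ∧
  (∀ w : Wh T k, -(ρS⁻¹ * vecInner T (divh T σ) w) = loadInner T f w) ∧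
  (∀ η : Ah T k, matInner T σ η = 0) ∧
  (∀ μ : Mh T k Γ₀, bdryInner T μ σ = 0)

/-- The system behind the local solution operators, in weak form, with right-hand sides `ℓ` and
`g` in the first two rows. It decouples into one system on each cell. -/
def IsLocalSolution (ℓ : Vh T k → ℝ) (g : Wh T k → ℝ) (s : Vh T k × Wh T k × Ah T k) : Prop :=
  (∀ v : Vh T k, matInner T (cplFun T lam mu s.1) v + vecInner T s.2.1 (divh T v)
      + matInner T s.2.2 v = ℓ v) ∧
  (∀ w : Wh T k, ρS⁻¹ * vecInner T (divh T s.1) w = g w) ∧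
  (∀ η : Ah T k, matInner T s.1 η = 0)

/-- The solution of the local system (an arbitrary triple should there be none; the theorem
asserts that the systems used below are uniquely solvable). -/
def localSolve (ℓ : Vh T k → ℝ) (g : Wh T k → ℝ) : Vh T k × Wh T k × Ah T k :=
  Classical.epsilon (IsLocalSolution T k lam mu ρS ℓ g)

/-- The triple `(Q₁ μ, Q₂ μ, Q₃ μ)`. -/
def Q (μ : Mh T k Γ₀) : Vh T k × Wh T k × Ah T k :=
  localSolve T k lam mu ρS (fun v => -bdryInner T μ v) (fun _ => 0)

/-- The triple `(Q₁ᴸ f, Q₂ᴸ f, Q₃ᴸ f)`. -/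
def QL (f : Pt n → Pt n) : Vh T k × Wh T k × Ah T k :=
  localSolve T k lam mu ρS (fun _ => 0) (fun w => -loadInner T f w)

def Q₁ (μ : Mh T k Γ₀) : Vh T k := (Q T k Γ₀ lam mu ρS μ).1
def Q₂ (μ : Mh T k Γ₀) : Wh T k := (Q T k Γ₀ lam mu ρS μ).2.1
def Q₃ (μ : Mh T k Γ₀) : Ah T k := (Q T k Γ₀ lam mu ρS μ).2.2
def QL₁ (f : Pt n → Pt n) : Vh T k := (QL T k lam mu ρS f).1
def QL₂ (f : Pt n → Pt n) : Wh T k := (QL T k lam mu ρS f).2.1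
def QL₃ (f : Pt n → Pt n) : Ah T k := (QL T k lam mu ρS f).2.2

/-- The condensed bilinear form. -/
def ah (μ₁ μ₂ : Mh T k Γ₀) : ℝ :=
  matInner T (cplFun T lam mu (Q₁ T k Γ₀ lam mu ρS μ₁)) (Q₁ T k Γ₀ lam mu ρS μ₂)

/-- The condensed right-hand side. -/
def bh (f : Pt n → Pt n) (μ : Mh T k Γ₀) : ℝ :=
  ρS * loadInner T f (Q₂ T k Γ₀ lam mu ρS μ)

/-- `γ` solves the condensed problem. -/
def SolvesCondensed (f : Pt n → Pt n) (γ : Mh T k Γ₀) : Prop :=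
  ∀ μ : Mh T k Γ₀, ah T k Γ₀ lam mu ρS γ μ = bh T k Γ₀ lam mu ρS f μ

end Systems

end HybridElasticity

end

open HybridElasticity

/-! All spaces are finite-dimensional, so unique solvability reduces to injectivity, once for the
local systems and once for the condensed operator. Locally, testing with the stress itself and using
the positive definite compliance removes the stress. A broken stress with prescribed divergence and
prescribed pairing with the rotation (`exists_div_eq`) then removes the other two unknowns; see
`localOp_injective`. No property of the barycentric split is needed for this.

Symmetry of the local systems turns the condensed form into minus the pairing of the second
multiplier with the normal trace of the first local stress (`ah_eq`), and the load into the pairing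
with the normal trace of the stress lifted from `f` (`bh_eq`). The condensed equation therefore says
exactly that the superposed stress satisfies the last equation of the hybridized system, which gives
the equivalence (`isHybridSolution_iff`).

The substance is injectivity of the condensed operator. If the form vanishes at (γ, γ), the local
stress of γ vanishes, and the displacement, rotation and multiplier together annihilate every broken
stress (`InKernel`). It must follow that all three are zero (`InKernel.eq_zero`).

For the rotation ρ, the test stresses are generalized curls of continuous piecewise polynomials φ of
degree k + 2. They are divergence free, and their normal traces are tangential derivatives of φ, so
displacement and multiplier drop out when φ vanishes on the boundary facets outside Γ₀
(`bdryInner_curlField`). What remains is that every entry of ρ is orthogonal to all derivatives of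
such φ. With φ a product of hat functions containing the barycentre z of a macro simplex, these
relations form a recursion whose coefficients have favourable signs: all moments of the entry
against products of barycentric coordinates are positive multiples of a single number κ
(`bern_pos_multiple`). One further relation, from a φ built on the vertices of one macro facet,
gives κ = 0 (`vanishes_of_facet`). It is available at a facet in Γ₀, and at any facet whose other
side is already settled. As the cells of a connected domain are linked through facets
(`Mesh.facet_induction`), ρ vanishes everywhere.

Once ρ = 0, stresses with a single row directed along an edge show that a vanishing multiplier on
one facet of a cell forces the displacement there to vanish (`InKernel.displacement_eq_zero`), and
that then the multiplier vanishes on all facets of the cell (`InKernel.multiplier_eq_zero`). This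
again spreads from Γ₀ through the mesh. -/

noncomputable section

namespace HybridElasticity

open scoped Classical

/-! ### Barycentric coordinates and outward normals of a simplex -/

section Simplex

variable {n : ℕ} {K L F : Finset (Pt n)} {a b c : Pt n}

/-- `K` is the vertex set of a nondegenerate `n`-simplex. -/
def IsSimplex (K : Finset (Pt n)) : Prop :=
  K.card = n + 1 ∧ AffineIndependent ℝ ((↑) : K → Pt n)

/-- The vertices of a nondegenerate simplex as an affine basis. -/
def IsSimplex.basis (h : IsSimplex K) : AffineBasis K ℝ (Pt n) where
  toFun := (↑)
  ind' := h.2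
  tot' := by
    rw [h.2.affineSpan_eq_top_iff_card_eq_finrank_add_one]
    simp [h.1]

/-- The barycentric coordinate of the simplex `K` at the vertex `c`; zero if `c` is not a vertex. -/
def baryCoord (K : Finset (Pt n)) (c : Pt n) : Pt n →ᵃ[ℝ] ℝ :=
  if h : IsSimplex K ∧ c ∈ K then h.1.basis.coord ⟨c, h.2⟩ else 0

lemma baryCoord_eq_coord (hK : IsSimplex K) (c : K) : baryCoord K c = hK.basis.coord c := by
  rw [baryCoord, dif_pos ⟨hK, c.2⟩]

lemma baryCoord_of_notMem (hc : c ∉ K) : baryCoord K c = 0 := by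
  rw [baryCoord, dif_neg fun h => hc h.2]

lemma baryCoord_vertex (hK : IsSimplex K) (hb : b ∈ K) :
    baryCoord K c b = if c = b then 1 else 0 := by
  by_cases hc : c ∈ K
  · rw [baryCoord_eq_coord hK ⟨c, hc⟩]
    exact (hK.basis.coord_apply ⟨c, hc⟩ ⟨b, hb⟩).trans (by simp)
  · rw [baryCoord_of_notMem hc, if_neg (by rintro rfl; exact hc hb)]
    rfl

lemma sum_baryCoord (hK : IsSimplex K) (x : Pt n) : ∑ c ∈ K, baryCoord K c x = 1 := by
  rw [← Finset.sum_coe_sort, ← hK.basis.sum_coord_apply_eq_one x]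
  exact Finset.sum_congr rfl fun c _ => by rw [baryCoord_eq_coord hK]

lemma sum_baryCoord_smul (hK : IsSimplex K) (x : Pt n) :
    ∑ c ∈ K, baryCoord K c x • c = x := by
  conv_rhs => rw [← hK.basis.linear_combination_coord_eq_self x]
  rw [← Finset.sum_coe_sort]
  exact Finset.sum_congr rfl fun c _ => by rw [baryCoord_eq_coord hK]; rfl

lemma affineMap_eq_sum (hK : IsSimplex K) (f : Pt n →ᵃ[ℝ] ℝ) (x : Pt n) :
    f x = ∑ c ∈ K, baryCoord K c x * f c := by
  have hf : ∀ y, f y = f.linear y + f 0 := fun y => congrFun (AffineMap.decomp f) y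
  conv_lhs => rw [hf, ← sum_baryCoord_smul hK x]
  rw [map_sum]
  simp_rw [map_smul, smul_eq_mul]
  rw [← one_mul (f 0), ← sum_baryCoord hK x, Finset.sum_mul, ← Finset.sum_add_distrib]
  exact Finset.sum_congr rfl fun c _ => by rw [hf c]; ring

lemma affineMap_ext (hK : IsSimplex K) {f g : Pt n →ᵃ[ℝ] ℝ} (h : ∀ c ∈ K, f c = g c) : f = g := by
  ext x
  rw [affineMap_eq_sum hK f, affineMap_eq_sum hK g]
  exact Finset.sum_congr rfl fun c hc => by rw [h c hc]

lemma affineMap_eq_smul_baryCoord (hK : IsSimplex K) {f : Pt n →ᵃ[ℝ] ℝ}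
    (h : ∀ c ∈ K.erase a, f c = 0) : f = f a • baryCoord K a := by
  refine affineMap_ext hK fun c hc => ?_
  rw [AffineMap.coe_smul, Pi.smul_apply, baryCoord_vertex hK hc]
  by_cases e : a = c
  · subst e; simp
  · simp [e, h c (Finset.mem_erase.2 ⟨Ne.symm e, hc⟩)]

lemma baryCoord_linear (hK : IsSimplex K) (ha : a ∈ K) (hb : b ∈ K) :
    (baryCoord K c).linear (b - a) = (if c = b then 1 else 0) - if c = a then 1 else 0 := by
  have := (baryCoord K c).linearMap_vsub b a
  rw [vsub_eq_sub, vsub_eq_sub] at this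
  rw [this, baryCoord_vertex hK ha, baryCoord_vertex hK hb]

lemma hull_eq (hK : IsSimplex K) : hull K = {x | ∀ c ∈ K, 0 ≤ baryCoord K c x} := by
  have := hK.basis.convexHull_eq_nonneg_coord
  have e : Set.range hK.basis = (K : Set (Pt n)) := by
    change Set.range ((↑) : K → Pt n) = _
    simp
  rw [e] at this
  rw [hull, this]
  ext x
  simp only [Set.mem_ofPred_eq, Subtype.forall]
  exact forall₂_congr fun c hc => by rw [← baryCoord_eq_coord hK ⟨c, hc⟩]

lemma interior_hull_eq (hK : IsSimplex K) :
    interior (hull K) = {x | ∀ c ∈ K, 0 < baryCoord K c x} := by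
  have := hK.basis.interior_convexHull
  have e : Set.range hK.basis = (K : Set (Pt n)) := by
    change Set.range ((↑) : K → Pt n) = _
    simp
  rw [e] at this
  rw [hull, this]
  ext x
  simp only [Set.mem_ofPred_eq, Subtype.forall]
  exact forall₂_congr fun c hc => by rw [← baryCoord_eq_coord hK ⟨c, hc⟩]

lemma affineMap_zero_on_hull {f : Pt n →ᵃ[ℝ] ℝ} {A : Set (Pt n)} (h : ∀ c ∈ A, f c = 0)
    {x : Pt n} (hx : x ∈ convexHull ℝ A) : f x = 0 := by
  have : convexHull ℝ A ⊆ f ⁻¹' {0} :=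
    convexHull_min (fun c hc => h c hc) ((convex_singleton (0 : ℝ)).affine_preimage f)
  exact this hx

lemma baryCoord_zero_on_hull (hK : IsSimplex K) {A : Set (Pt n)} (hA : A ⊆ K) (hc : c ∉ A)
    {x : Pt n} (hx : x ∈ convexHull ℝ A) : baryCoord K c x = 0 :=
  affineMap_zero_on_hull (fun b hb => by
    rw [baryCoord_vertex hK (hA hb), if_neg (by rintro rfl; exact hc hb)]) hx

lemma mem_hull_of_baryCoord (hK : IsSimplex K) {A : Finset (Pt n)} (hA : A ⊆ K) {x : Pt n}
    (hx : x ∈ hull K) (h : ∀ c ∈ K, c ∉ A → baryCoord K c x = 0) : x ∈ hull A := by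
  rw [hull_eq hK] at hx
  have h1 : ∑ c ∈ A, baryCoord K c x = 1 := by
    rw [← sum_baryCoord hK x]
    exact Finset.sum_subset hA h
  have h2 : ∑ c ∈ A, baryCoord K c x • c = x := by
    conv_rhs => rw [← sum_baryCoord_smul hK x]
    exact Finset.sum_subset hA fun c hc hc' => by rw [h c hc hc', zero_smul]
  rw [← h2]
  exact (convex_convexHull ℝ _).sum_mem (fun c hc => hx c (hA hc)) h1
    fun c hc => subset_convexHull ℝ _ hc

lemma affineMap_barycentre {s : Finset (Pt n)} (hs : s.Nonempty) (f : Pt n →ᵃ[ℝ] ℝ) :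
    f (barycentre s) = (s.card : ℝ)⁻¹ * ∑ c ∈ s, f c := by
  have hf : ∀ y, f y = f.linear y + f 0 := fun y => congrFun (AffineMap.decomp f) y
  have h0 : (s.card : ℝ) ≠ 0 := by exact_mod_cast hs.card_pos.ne'
  rw [hf, barycentre, map_smul, map_sum, Finset.sum_congr rfl fun c _ => hf c,
    Finset.sum_add_distrib, Finset.sum_const, nsmul_eq_mul, smul_eq_mul, mul_add,
    inv_mul_cancel_left₀ h0]

lemma IsSimplex.nonempty (hK : IsSimplex K) : K.Nonempty := by
  rw [← Finset.card_pos, hK.1]; omega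

lemma baryCoord_barycentre (hK : IsSimplex K) (hc : c ∈ K) :
    baryCoord K c (barycentre K) = ((n : ℝ) + 1)⁻¹ := by
  rw [affineMap_barycentre hK.nonempty, hK.1,
    Finset.sum_congr rfl fun b hb => baryCoord_vertex hK hb, Finset.sum_ite_eq, if_pos hc]
  simp

lemma barycentre_mem_interior (hK : IsSimplex K) : barycentre K ∈ interior (hull K) := by
  rw [interior_hull_eq hK]
  intro c hc
  rw [baryCoord_barycentre hK hc]
  positivity

lemma barycentre_mem_hull {s : Finset (Pt n)} (hs : s.Nonempty) : barycentre s ∈ hull s := by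
  have h0 : (s.card : ℝ) ≠ 0 := by exact_mod_cast hs.card_pos.ne'
  rw [barycentre, Finset.smul_sum]
  refine (convex_convexHull ℝ _).sum_mem (fun _ _ => by positivity) ?_
    fun c hc => subset_convexHull ℝ _ hc
  rw [Finset.sum_const, nsmul_eq_mul, mul_inv_cancel₀ h0]

lemma isCompact_hull (s : Finset (Pt n)) : IsCompact (hull s) :=
  s.finite_toSet.isCompact_convexHull ℝ

lemma exists_eq_erase (hK : IsSimplex K) (hF : F ⊆ K) (hc : F.card = n) :
    ∃ a ∈ K, F = K.erase a := by
  obtain ⟨a, ha⟩ : ∃ a, K \ F = {a} := by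
    rw [← Finset.card_eq_one, Finset.card_sdiff_of_subset hF, hK.1, hc]; omega
  have haK : a ∈ K \ F := by simp [ha]
  refine ⟨a, (Finset.mem_sdiff.1 haK).1, ?_⟩
  rw [← Finset.sdiff_singleton_eq_erase, ← ha, Finset.sdiff_sdiff_eq_self hF]

lemma finrank_vectorSpan_facet (hn : 1 ≤ n) (hK : IsSimplex K) (hF : F ⊆ K) (hc : F.card = n) :
    Module.finrank ℝ (vectorSpan ℝ (F : Set (Pt n))) = n - 1 := by
  have hi : AffineIndependent ℝ ((↑) : F → Pt n) :=
    hK.2.comp_embedding ⟨fun x : F => (⟨x, hF x.2⟩ : K),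
      fun x y h => Subtype.ext (congrArg (fun z : K => (z : Pt n)) h)⟩
  have := hi.finrank_vectorSpan (n := n - 1) (by rw [Fintype.card_coe, hc]; omega)
  rw [← this, show Set.range ((↑) : F → Pt n) = (F : Set (Pt n)) from Subtype.range_coe]

/-- The barycentric coordinate at `a` is constant along the opposite facet, so its gradient spans
the one-dimensional orthogonal complement, as does the normal. The coordinate decreases from 1/(n+1)
at the barycentre of `K` to 0 on the facet, whence the negative factor. All later normal components
are read off from barycentric coordinates in this way. -/
lemma outwardNormal_spec (hn : 1 ≤ n) (hK : IsSimplex K) (ha : a ∈ K) :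
    ‖outwardNormal K (K.erase a)‖ = 1 ∧ ∃ s < 0, ∀ v,
      inner ℝ (outwardNormal K (K.erase a)) v = s * (baryCoord K a).linear v := by
  set F := K.erase a with hF
  have hFc : F.card = n := by rw [hF, Finset.card_erase_of_mem ha, hK.1]; rfl
  have hFn : F.Nonempty := Finset.card_pos.1 (by omega)
  set V := vectorSpan ℝ (F : Set (Pt n)) with hV
  have hVd : Module.finrank ℝ V = n - 1 := by
    exact finrank_vectorSpan_facet hn hK (Finset.erase_subset _ _) hFc
  have hVo : Module.finrank ℝ Vᗮ = 1 := by
    have := V.finrank_add_finrank_orthogonal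
    rw [hVd, finrank_euclideanSpace_fin] at this
    omega
  set w0 := barycentre F - barycentre K
  set w := Vᗮ.starProjection w0 with hw
  set lin := (baryCoord K a).linear
  have hlinV : ∀ v ∈ V, lin v = 0 := by
    intro v hv
    have : V ≤ LinearMap.ker lin := by
      rw [hV, vectorSpan, Submodule.span_le]
      rintro _ ⟨x, hx, y, hy, rfl⟩
      rw [Finset.mem_coe, hF, Finset.mem_erase] at hx hy
      simp only [SetLike.mem_coe, LinearMap.mem_ker, vsub_eq_sub]
      rw [baryCoord_linear hK hy.2 hx.2, if_neg (Ne.symm hx.1), if_neg (Ne.symm hy.1), sub_zero]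
    exact this hv
  have hproj : ∀ v, lin (Vᗮ.starProjection v) = lin v := by
    intro v
    have h1 : v - Vᗮ.starProjection v ∈ V := by
      have := Vᗮ.sub_starProjection_mem_orthogonal v
      rwa [Submodule.orthogonal_orthogonal] at this
    have h2 := hlinV _ h1
    rw [map_sub] at h2
    linarith
  have hlw : lin w = -((n : ℝ) + 1)⁻¹ := by
    rw [hw, hproj]
    have := (baryCoord K a).linearMap_vsub (barycentre F) (barycentre K)
    rw [vsub_eq_sub, vsub_eq_sub] at this
    rw [show lin w0 = _ from this, baryCoord_barycentre hK ha, baryCoord_zero_on_hull hK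
      (A := F) (by rw [hF]; exact_mod_cast Finset.erase_subset a K) (by simp [hF])
      (barycentre_mem_hull hFn), zero_sub]
  have hn1 : (0 : ℝ) < (n : ℝ) + 1 := by positivity
  have hw0 : w ≠ 0 := by
    intro h
    rw [h, map_zero] at hlw
    have : (0 : ℝ) < ((n : ℝ) + 1)⁻¹ := by positivity
    linarith
  have hwV : w ∈ Vᗮ := Submodule.starProjection_apply_mem _ _
  have hN : outwardNormal K F = ‖w‖⁻¹ • w := rfl
  have hw' : ‖w‖ ≠ 0 := norm_ne_zero_iff.2 hw0
  refine ⟨?_, -(((n : ℝ) + 1) * ‖w‖), ?_, fun v => ?_⟩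
  · rw [hN, norm_smul, norm_inv, norm_norm, inv_mul_cancel₀ hw']
  · have : 0 < ‖w‖ := norm_pos_iff.2 hw0
    nlinarith [mul_pos hn1 this]
  · obtain ⟨c, hc⟩ := exists_smul_eq_of_finrank_eq_one hVo (x := (⟨w, hwV⟩ : Vᗮ))
      (by simpa [Subtype.ext_iff] using hw0) ⟨Vᗮ.starProjection v, Submodule.starProjection_apply_mem _ _⟩
    have hc' : c • w = Vᗮ.starProjection v := congrArg Subtype.val hc
    have h1 : inner ℝ w v = c * ‖w‖ ^ 2 := by
      have : inner ℝ w v = inner ℝ w (Vᗮ.starProjection v) := by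
        have h1 : v - Vᗮ.starProjection v ∈ Vᗮᗮ := Vᗮ.sub_starProjection_mem_orthogonal v
        have h2 := (Submodule.mem_orthogonal Vᗮ _).1 h1 w hwV
        rw [inner_sub_right] at h2
        linarith
      rw [this, ← hc', inner_smul_right, real_inner_self_eq_norm_sq]
    have h2 : lin v = c * -((n : ℝ) + 1)⁻¹ := by
      rw [← hproj, ← hc', map_smul, hlw, smul_eq_mul]
    rw [hN, real_inner_smul_left, h1, h2]
    field_simp

end Simplex

/-! ### Polynomials, directional derivatives and products of barycentric coordinates -/

section Polynomials

open MvPolynomial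

variable {n : ℕ} {K : Finset (Pt n)}

/-- Polynomials of total degree at most `m`. -/
abbrev PolyLE (n m : ℕ) : Submodule ℝ (Poly n) := restrictTotalDegree (Fin n) ℝ m

@[simp] lemma ev_add (p q : Poly n) (x : Pt n) : ev (p + q) x = ev p x + ev q x := map_add _ _ _
@[simp] lemma ev_sub (p q : Poly n) (x : Pt n) : ev (p - q) x = ev p x - ev q x := map_sub _ _ _
@[simp] lemma ev_neg (p : Poly n) (x : Pt n) : ev (-p) x = -ev p x := map_neg _ _
@[simp] lemma ev_mul (p q : Poly n) (x : Pt n) : ev (p * q) x = ev p x * ev q x := map_mul _ _ _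
@[simp] lemma ev_zero (x : Pt n) : ev (0 : Poly n) x = 0 := map_zero _
@[simp] lemma ev_one (x : Pt n) : ev (1 : Poly n) x = 1 := map_one _
@[simp] lemma ev_C (r : ℝ) (x : Pt n) : ev (C r : Poly n) x = r := eval_C _
@[simp] lemma ev_smul (r : ℝ) (p : Poly n) (x : Pt n) : ev (r • p) x = r * ev p x := smul_eval _ _ _
@[simp] lemma ev_sum {ι : Type*} (s : Finset ι) (f : ι → Poly n) (x : Pt n) :
    ev (∑ i ∈ s, f i) x = ∑ i ∈ s, ev (f i) x := map_sum _ _ _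

@[fun_prop]
lemma continuous_ev (p : Poly n) : Continuous (ev p) := by
  unfold ev
  exact (MvPolynomial.continuous_eval p).comp (by fun_prop)

/-- A real affine function as a polynomial. -/
def affinePoly (f : Pt n →ᵃ[ℝ] ℝ) : Poly n :=
  C (f 0) + ∑ i, C (f.linear (EuclideanSpace.single i 1)) * X i

lemma sum_coord_single (x : Pt n) : ∑ i, x i • EuclideanSpace.single i (1 : ℝ) = x := by
  ext j
  simp [Pi.single_apply]

@[simp] lemma ev_affinePoly (f : Pt n →ᵃ[ℝ] ℝ) (x : Pt n) : ev (affinePoly f) x = f x := by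
  have hf : f x = f.linear x + f 0 := congrFun (AffineMap.decomp f) x
  rw [hf]
  conv_rhs => rw [← sum_coord_single x, map_sum]
  simp only [affinePoly, ev_add, ev_C, ev_sum, ev_mul, map_smul, smul_eq_mul]
  rw [add_comm]
  congr 1
  exact Finset.sum_congr rfl fun i _ => by simp [ev, mul_comm]

lemma affinePoly_mem (f : Pt n →ᵃ[ℝ] ℝ) : affinePoly f ∈ PolyLE n 1 := by
  refine Submodule.add_mem _ ?_ (Submodule.sum_mem _ fun i _ => ?_)
  · rw [mem_restrictTotalDegree, totalDegree_C]; exact zero_le_one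
  · rw [mem_restrictTotalDegree, ← smul_eq_C_mul]
    exact (totalDegree_smul_le _ _).trans (totalDegree_X _).le

/-- Differentiation in the direction `t`. -/
def dirD (t : Pt n) : Derivation ℝ (Poly n) (Poly n) := ∑ l, t l • pderiv l

lemma dirD_apply (t : Pt n) (p : Poly n) : dirD t p = ∑ l, t l • pderiv l p := by
  have := congrFun (map_sum (Derivation.coeFnAddMonoidHom (R := ℝ) (A := Poly n) (M := Poly n))
    (fun l => t l • pderiv l) Finset.univ) p
  rw [Finset.sum_apply] at this
  exact this

lemma dirD_affinePoly (t : Pt n) (f : Pt n →ᵃ[ℝ] ℝ) : dirD t (affinePoly f) = C (f.linear t) := by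
  conv_rhs => rw [← sum_coord_single t, map_sum]
  simp [dirD_apply, affinePoly, pderiv_X, Pi.single_apply, smul_eq_C_mul]

lemma mul_mem_polyLE {p q : Poly n} {a b : ℕ} (hp : p ∈ PolyLE n a) (hq : q ∈ PolyLE n b) :
    p * q ∈ PolyLE n (a + b) := by
  rw [mem_restrictTotalDegree] at *
  exact (totalDegree_mul _ _).trans (add_le_add hp hq)

lemma pderiv_mem_polyLE {p : Poly n} {m : ℕ} (i : Fin n) (hp : p ∈ PolyLE n (m + 1)) :
    pderiv i p ∈ PolyLE n m := by
  rw [mem_restrictTotalDegree] at *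
  rw [p.as_sum, map_sum]
  refine totalDegree_finsetSum_le fun s hs => ?_
  rw [pderiv_monomial]
  by_cases h : s i = 0
  · simp [h]
  · refine (totalDegree_monomial_le _ _).trans ?_
    have h1 : s.degree ≤ m + 1 := (le_totalDegree hs).trans hp
    have h2 : s = (s - Finsupp.single i 1) + Finsupp.single i 1 := by
      ext j
      by_cases e : i = j
      · subst e; simp; omega
      · simp [e]
    have h3 := congrArg Finsupp.degree h2
    rw [map_add, Finsupp.degree_single] at h3
    change (s - Finsupp.single i 1).degree ≤ m
    omega

lemma dirD_mem_polyLE {p : Poly n} {m : ℕ} (t : Pt n) (hp : p ∈ PolyLE n (m + 1)) :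
    dirD t p ∈ PolyLE n m := by
  rw [dirD_apply]
  exact Submodule.sum_mem _ fun i _ => Submodule.smul_mem _ _ (pderiv_mem_polyLE i hp)

/-- A polynomial that vanishes on a set with nonempty interior is zero. -/
lemma eq_zero_of_ev_eq_zero {p : Poly n} {U : Set (Pt n)} (hU : (interior U).Nonempty)
    (h : ∀ x ∈ U, ev p x = 0) : p = 0 := by
  obtain ⟨x, hx⟩ := hU
  let e := EuclideanSpace.equiv (Fin n) ℝ
  have hV : IsOpen (e.symm ⁻¹' interior U) := isOpen_interior.preimage e.symm.continuous
  obtain ⟨ε, hε, hb⟩ := Metric.isOpen_iff.1 hV (e x) (by simpa using hx)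
  -- In the sup norm a ball is a product of infinite sets, and a polynomial vanishing on such a grid
  -- is zero.
  refine funext_set (fun i => Metric.ball (e x i) ε) (fun i => ?_) fun y hy => ?_
  · rw [Real.ball_eq_Ioo]
    exact Set.Ioo_infinite (by linarith)
  · have : y ∈ Metric.ball (e x) ε := by
      rw [ball_pi _ hε]
      exact hy
    rw [map_zero]
    exact h _ (interior_subset (hb this))

/-- The barycentric coordinate of `K` at `c` as a polynomial. -/
def hat (K : Finset (Pt n)) (c : Pt n) : Poly n := affinePoly (baryCoord K c)

@[simp] lemma ev_hat (K : Finset (Pt n)) (c x : Pt n) : ev (hat K c) x = baryCoord K c x :=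
  ev_affinePoly _ _

lemma hat_of_notMem {c : Pt n} (hc : c ∉ K) : hat K c = 0 := by
  simp [hat, baryCoord_of_notMem hc, affinePoly]

/-- The product of the barycentric coordinates of `K` at the members of `B`. -/
def bern (K : Finset (Pt n)) (B : Multiset (Pt n)) : Poly n := (B.map (hat K)).prod

@[simp] lemma bern_zero (K : Finset (Pt n)) : bern K 0 = 1 := by simp [bern]

@[simp] lemma bern_cons (K : Finset (Pt n)) (c : Pt n) (B : Multiset (Pt n)) :
    bern K (c ::ₘ B) = hat K c * bern K B := by simp [bern]

lemma bern_eq_hat_mul {c : Pt n} {B : Multiset (Pt n)} (hc : c ∈ B) :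
    bern K B = hat K c * bern K (B.erase c) := by
  rw [← bern_cons, Multiset.cons_erase hc]

lemma bern_of_notMem {c : Pt n} {B : Multiset (Pt n)} (hc : c ∈ B) (hcK : c ∉ K) :
    bern K B = 0 := by
  rw [bern_eq_hat_mul hc, hat_of_notMem hcK, zero_mul]

lemma bern_mem (K : Finset (Pt n)) (B : Multiset (Pt n)) : bern K B ∈ PolyLE n B.card := by
  induction B using Multiset.induction with
  | empty => rw [mem_restrictTotalDegree, bern_zero]; simp
  | cons c B ih =>
    rw [bern_cons, Multiset.card_cons, add_comm]
    exact mul_mem_polyLE (affinePoly_mem _) ih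

/-- Leibniz rule; the factors are affine, so each differentiates to a constant. The sum runs over
the multiset, hence repeated factors are counted with multiplicity. -/
lemma dirD_bern (t : Pt n) (K : Finset (Pt n)) (B : Multiset (Pt n)) :
    dirD t (bern K B) =
      (B.map fun c => (baryCoord K c).linear t • bern K (B.erase c)).sum := by
  induction B using Multiset.induction with
  | empty => simp
  | cons c B ih =>
    rw [bern_cons, Derivation.leibniz, ih, hat, dirD_affinePoly, Multiset.map_cons,
      Multiset.sum_cons, Multiset.erase_cons_head, smul_eq_mul, smul_eq_mul, mul_comm (bern K B),
      ← smul_eq_C_mul, add_comm, ← Multiset.sum_map_mul_left]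
    congr 2
    refine Multiset.map_congr rfl fun d hd => ?_
    by_cases e : c = d
    · subst e
      rw [Multiset.erase_cons_head, bern_eq_hat_mul hd, mul_smul_comm]; rfl
    · rw [Multiset.erase_cons_tail _ e, bern_cons, mul_smul_comm]; rfl

lemma one_mem_span_hat (hK : IsSimplex K) :
    (1 : Poly n) ∈ Submodule.span ℝ (hat K '' (K : Set (Pt n))) := by
  have : (1 : Poly n) = ∑ c ∈ K, hat K c := by
    rw [← sub_eq_zero]
    refine eq_zero_of_ev_eq_zero (U := Set.univ) (by simp) fun x _ => ?_
    simp [sum_baryCoord hK]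
  rw [this]
  exact Submodule.sum_mem _ fun c hc => Submodule.subset_span ⟨c, hc, rfl⟩

lemma X_mem_span_hat (hK : IsSimplex K) (i : Fin n) :
    (X i : Poly n) ∈ Submodule.span ℝ (hat K '' (K : Set (Pt n))) := by
  have : (X i : Poly n) = ∑ c ∈ K, c i • hat K c := by
    rw [← sub_eq_zero]
    refine eq_zero_of_ev_eq_zero (U := Set.univ) (by simp) fun x _ => ?_
    have h := congrArg (fun y : Pt n => y i) (sum_baryCoord_smul hK x)
    simp only [ev_sub, ev_sum, ev_smul, ev_hat]
    rw [show ev (X i : Poly n) x = x i from eval_X _, ← h]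
    simp [mul_comm]
  rw [this]
  exact Submodule.sum_mem _ fun c hc =>
    Submodule.smul_mem _ _ (Submodule.subset_span ⟨c, hc, rfl⟩)

/-- Each variable is a combination of barycentric coordinates, and so is 1. A monomial of lower
degree is padded with factors 1 to have exactly `m` factors. -/
lemma polyLE_le_span_hat_pow (hK : IsSimplex K) (m : ℕ) :
    PolyLE n m ≤ Submodule.span ℝ (hat K '' (K : Set (Pt n))) ^ m := by
  set V := Submodule.span ℝ (hat K '' (K : Set (Pt n)))
  have h1 : (1 : Submodule ℝ (Poly n)) ≤ V := Submodule.one_le.2 (one_mem_span_hat hK)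
  intro p hp
  rw [mem_restrictTotalDegree] at hp
  rw [p.as_sum]
  refine Submodule.sum_mem _ fun s hs => ?_
  have hs' : s.degree ≤ m := (le_totalDegree hs).trans hp
  refine pow_le_pow_right₀ h1 hs' ?_
  rw [monomial_eq, ← smul_eq_C_mul]
  refine Submodule.smul_mem _ _ ?_
  rw [Finsupp.prod, Finsupp.degree_apply, ← Finset.prod_pow_eq_pow_sum]
  induction s.support using Finset.induction_on with
  | empty => exact Submodule.one_le.1 le_rfl
  | insert i t hi ih =>
    rw [Finset.prod_insert hi, Finset.prod_insert hi]
    exact Submodule.mul_mem_mul (Submodule.pow_mem_pow _ (X_mem_span_hat hK i) _) ih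

/-- The products of `m` barycentric coordinates span the polynomials of degree at most `m`. -/
lemma linearMap_eq_zero_of_bern (hK : IsSimplex K) {m : ℕ} (ℓ : Poly n →ₗ[ℝ] ℝ)
    (h : ∀ B : Multiset (Pt n), B.card = m → (∀ c ∈ B, c ∈ K) → ℓ (bern K B) = 0)
    {p : Poly n} (hp : p ∈ PolyLE n m) : ℓ p = 0 := by
  have key : Submodule.span ℝ (hat K '' (K : Set (Pt n))) ^ m ≤ Submodule.span ℝ
      {q | ∃ B : Multiset (Pt n), B.card = m ∧ (∀ c ∈ B, c ∈ K) ∧ bern K B = q} := by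
    clear h hp
    induction m with
    | zero =>
      rw [pow_zero, Submodule.one_le]
      exact Submodule.subset_span ⟨0, by simp⟩
    | succ m ih =>
      rw [pow_succ']
      refine (mul_le_mul' le_rfl ih).trans ?_
      rw [Submodule.span_mul_span, Submodule.span_le]
      rintro _ ⟨_, ⟨c, hc, rfl⟩, _, ⟨B, hB, hBK, rfl⟩, rfl⟩
      refine Submodule.subset_span ⟨c ::ₘ B, by simp [hB], ?_, by simp⟩
      intro d hd
      rcases Multiset.mem_cons.1 hd with rfl | hd
      exacts [hc, hBK d hd]
  have := key (polyLE_le_span_hat_pow hK m hp)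
  have h2 : Submodule.span ℝ
      {q | ∃ B : Multiset (Pt n), B.card = m ∧ (∀ c ∈ B, c ∈ K) ∧ bern K B = q} ≤
      LinearMap.ker ℓ := by
    rw [Submodule.span_le]
    rintro _ ⟨B, hB, hBK, rfl⟩
    exact h B hB hBK
  exact h2 this

end Polynomials

/-! ### Integration over cells and facets: supports and null sets -/

section Integration

variable {n : ℕ} {K : Finset (Pt n)}

/-- The compact set `S` has finite `ν`-measure, and its nonempty relatively open subsets have
positive `ν`-measure. -/
structure FullSupport (ν : Measure (Pt n)) (S : Set (Pt n)) : Prop where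
  isCompact : IsCompact S
  lt_top : ν S < ⊤
  pos : ∀ x ∈ S, ∀ U, IsOpen U → x ∈ U → 0 < ν (S ∩ U)

lemma FullSupport.integrableOn {ν : Measure (Pt n)} {S : Set (Pt n)} (h : FullSupport ν S)
    {g : Pt n → ℝ} (hg : Continuous g) : IntegrableOn g S ν := by
  obtain ⟨C, hC⟩ := h.isCompact.exists_bound_of_continuousOn hg.continuousOn
  exact Measure.integrableOn_of_bounded h.lt_top.ne hg.aestronglyMeasurable
    ((ae_restrict_iff' h.isCompact.measurableSet).2 (Filter.Eventually.of_forall hC))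

lemma FullSupport.eq_zero {ν : Measure (Pt n)} {S : Set (Pt n)} (h : FullSupport ν S)
    {g : Pt n → ℝ} (hg : Continuous g) (h0 : ∀ x ∈ S, 0 ≤ g x) (hi : ∫ x in S, g x ∂ν = 0) :
    ∀ x ∈ S, g x = 0 := by
  rw [setIntegral_eq_zero_iff_of_nonneg_ae
    ((ae_restrict_iff' h.isCompact.measurableSet).2 (Filter.Eventually.of_forall h0))
    (h.integrableOn hg)] at hi
  intro x hx
  by_contra hne
  have h1 := h.pos x hx {y | g y ≠ 0} (isOpen_ne_fun hg continuous_const) hne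
  have h2 : ν (S ∩ {y | g y ≠ 0}) = 0 := by
    rw [Filter.EventuallyEq, ae_restrict_iff' h.isCompact.measurableSet, ae_iff] at hi
    convert hi using 2
    ext y
    simp
  exact h1.ne' h2

lemma fullSupport_volume (hK : IsSimplex K) : FullSupport volume (hull K) where
  isCompact := isCompact_hull K
  lt_top := (isCompact_hull K).measure_lt_top
  pos x hx U hU hxU := by
    have hc : Convex ℝ (hull K) := convex_convexHull ℝ _
    have h1 : x ∈ closure (interior (hull K)) := by
      rw [hc.closure_interior_eq_closure_of_nonempty_interior ⟨_, barycentre_mem_interior hK⟩]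
      exact subset_closure hx
    obtain ⟨y, hyU, hy⟩ := mem_closure_iff.1 h1 U hU hxU
    exact lt_of_lt_of_le ((isOpen_interior.inter hU).measure_pos volume ⟨y, hy, hyU⟩)
      (measure_mono (Set.inter_subset_inter_left _ interior_subset))

lemma isometry_add_coe (V : Submodule ℝ (Pt n)) (p : Pt n) :
    Isometry fun v : V => p + (v : Pt n) :=
  (IsometryEquiv.addLeft p).isometry.comp isometry_subtype_coe

lemma hausdorff_image (V : Submodule ℝ (Pt n)) (p : Pt n) (t : Set V) :
    Measure.euclideanHausdorffMeasure (Module.finrank ℝ V) ((fun v : V => p + (v : Pt n)) '' t) =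
      volume t := by
  rw [(isometry_add_coe V p).euclideanHausdorffMeasure_image,
    InnerProductSpace.euclideanHausdorffMeasure_eq_volume]

/-- Translation by `p` is an isometry from the direction space onto the affine span; it carries a
compact set onto the hull and Lebesgue measure to Hausdorff measure. -/
lemma hausdorff_hull_lt_top {A : Finset (Pt n)} {p : Pt n} (hp : p ∈ A) :
    Measure.euclideanHausdorffMeasure (Module.finrank ℝ (vectorSpan ℝ (A : Set (Pt n))))
      (hull A) < ⊤ := by
  set V := vectorSpan ℝ (A : Set (Pt n))
  set ι : V → Pt n := fun v => p + (v : Pt n)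
  have hι : Isometry ι := isometry_add_coe V p
  have hsub : hull A ⊆ Set.range ι := by
    intro x hx
    have hx' : x ∈ affineSpan ℝ (A : Set (Pt n)) := convexHull_subset_affineSpan _ hx
    have : x - p ∈ V := by
      have := AffineSubspace.vsub_mem_direction hx' (subset_affineSpan ℝ _ (Finset.mem_coe.2 hp))
      rwa [direction_affineSpan] at this
    exact ⟨⟨x - p, this⟩, by simp [ι]⟩
  have hcomp : IsCompact (ι ⁻¹' hull A) :=
    hι.isClosedEmbedding.isCompact_preimage (isCompact_hull A)
  have : hull A = ι '' (ι ⁻¹' hull A) := by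
    rw [Set.image_preimage_eq_inter_range, Set.inter_eq_left.2 hsub]
  rw [this]
  rw [hausdorff_image V p]
  exact hcomp.measure_lt_top

/-- The hull has finite Hausdorff measure in its own dimension, which is below n - 1, so the measure
of dimension n - 1 vanishes. -/
lemma surf_hull_eq_zero {A : Finset (Pt n)} (hA : A.card < n) : surf n (hull A) = 0 := by
  rcases A.eq_empty_or_nonempty with rfl | ⟨p, hp⟩
  · simp [hull]
  · have hd : Module.finrank ℝ (vectorSpan ℝ (A : Set (Pt n))) < n - 1 := by
      have := finrank_vectorSpan_image_finset_le ℝ (id : Pt n → Pt n) A (n := A.card - 1)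
        (by have := Finset.card_pos.2 ⟨p, hp⟩; omega)
      rw [Finset.image_id] at this
      have := Finset.card_pos.2 ⟨p, hp⟩
      omega
    exact (Measure.euclideanHausdorffMeasure_zero_or_top hd (hull A)).resolve_right
      (hausdorff_hull_lt_top hp).ne

lemma continuous_baryCoord (K : Finset (Pt n)) (c : Pt n) : Continuous (baryCoord K c) :=
  AffineMap.continuous_of_finiteDimensional _

/-- A small push towards the barycentre of the facet makes all of its coordinates positive, without
leaving the facet or the neighbourhood. -/
lemma exists_pos_baryCoord_of_mem_facet (hn : 1 ≤ n) (hK : IsSimplex K) {F : Finset (Pt n)}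
    (hFK : F ⊆ K) (hFc : F.card = n) {x : Pt n} (hx : x ∈ hull F) {U : Set (Pt n)}
    (hU : IsOpen U) (hxU : x ∈ U) : ∃ y ∈ hull F ∩ U, ∀ c ∈ F, 0 < baryCoord K c y := by
  have hFne : F.Nonempty := Finset.card_pos.1 (by omega)
  have hmap : ContinuousAt (fun ε : ℝ => AffineMap.lineMap x (barycentre F) ε) 0 :=
    (AffineMap.lineMap_continuous).continuousAt
  have hev : ∀ᶠ ε in nhdsWithin (0 : ℝ) (Set.Ioi 0),
      AffineMap.lineMap x (barycentre F) ε ∈ U :=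
    nhdsWithin_le_nhds (hmap.eventually_mem (hU.mem_nhds (by simpa using hxU)))
  obtain ⟨ε, ⟨hεU, hε1⟩, hε0⟩ := ((hev.and (nhdsWithin_le_nhds
    (Iio_mem_nhds (zero_lt_one (α := ℝ))))).and self_mem_nhdsWithin).exists
  set y : Pt n := AffineMap.lineMap x (barycentre F) ε
  have hb := barycentre_mem_hull hFne
  have hyF : y ∈ hull F := by
    have hc : Convex ℝ (hull F) := convex_convexHull ℝ _
    exact hc.lineMap_mem hx hb ⟨hε0.le, hε1.le⟩
  have hy : ∀ c ∈ F, 0 < baryCoord K c y := by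
    intro c hc
    have hx0 : 0 ≤ baryCoord K c x := by
      have : x ∈ hull K := convexHull_mono (by exact_mod_cast hFK) hx
      rw [hull_eq hK] at this
      exact this c (hFK hc)
    have hb0 : 0 < baryCoord K c (barycentre F) := by
      rw [affineMap_barycentre hFne,
        Finset.sum_congr rfl fun b hb => baryCoord_vertex hK (hFK hb), Finset.sum_ite_eq,
        if_pos hc, hFc]
      have : (0 : ℝ) < n := by exact_mod_cast hn
      positivity
    have : baryCoord K c y = (1 - ε) * baryCoord K c x + ε * baryCoord K c (barycentre F) := by
      rw [show y = AffineMap.lineMap x (barycentre F) ε from rfl, AffineMap.apply_lineMap,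
        AffineMap.lineMap_apply_module, smul_eq_mul, smul_eq_mul]
    rw [this]
    have h1 : 0 ≤ (1 - ε) * baryCoord K c x := mul_nonneg (by linarith [show ε < 1 from hε1]) hx0
    have h2 := mul_pos hε0 hb0
    linarith
  exact ⟨y, ⟨hyF, hεU⟩, hy⟩

/-- Around a relatively interior point close to the given one, the facet contains an isometric copy
of an open subset of its direction space, and such a set has positive Lebesgue measure. -/
lemma fullSupport_surf (hn : 1 ≤ n) (hK : IsSimplex K) {a : Pt n} (ha : a ∈ K) :
    FullSupport (surf n) (hull (K.erase a)) := by
  have hFc : (K.erase a).card = n := by rw [Finset.card_erase_of_mem ha, hK.1]; rfl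
  obtain ⟨p, hp⟩ : (K.erase a).Nonempty := Finset.card_pos.1 (by omega)
  have hfr := finrank_vectorSpan_facet hn hK (Finset.erase_subset a K) hFc
  refine ⟨isCompact_hull _, ?_, fun x hx U hU hxU => ?_⟩
  · have := hausdorff_hull_lt_top hp
    rwa [hfr] at this
  · set F := K.erase a with hF
    set V := vectorSpan ℝ (F : Set (Pt n))
    have hFK : F ⊆ K := Finset.erase_subset _ _
    obtain ⟨y, ⟨hyF, hyU⟩, hy⟩ := exists_pos_baryCoord_of_mem_facet hn hK hFK hFc hx hU hxU
    set O : Set V := {v : V | y + (v : Pt n) ∈ U} ∩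
      ⋂ c ∈ F, {v : V | 0 < baryCoord K c (y + v)}
    have hO : IsOpen O := (hU.preimage (by fun_prop)).inter <|
      isOpen_biInter_finset fun c _ => isOpen_lt continuous_const
        ((continuous_baryCoord K c).comp (by fun_prop))
    have h0 : (0 : V) ∈ O := ⟨by simpa using hyU, by simpa using hy⟩
    refine lt_of_lt_of_le (hO.measure_pos volume ⟨0, h0⟩) ?_
    rw [← hausdorff_image V y, hfr]
    refine measure_mono ?_
    rintro _ ⟨v, hv, rfl⟩
    refine ⟨?_, hv.1⟩
    have hlin : (baryCoord K a).linear v = 0 := by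
      have : V ≤ LinearMap.ker (baryCoord K a).linear := by
        rw [show V = vectorSpan ℝ (F : Set (Pt n)) from rfl, vectorSpan, Submodule.span_le]
        rintro _ ⟨b, hb, c, hc, rfl⟩
        rw [Finset.mem_coe, hF, Finset.mem_erase] at hb hc
        simp only [SetLike.mem_coe, LinearMap.mem_ker, vsub_eq_sub]
        rw [baryCoord_linear hK hc.2 hb.2, if_neg (Ne.symm hb.1), if_neg (Ne.symm hc.1), sub_zero]
      exact this v.2
    have haz : baryCoord K a (y + v) = 0 := by
      have h1 := (baryCoord K a).map_vadd y (v : Pt n)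
      rw [vadd_eq_add, vadd_eq_add, hlin, zero_add, add_comm] at h1
      rw [h1]
      exact baryCoord_zero_on_hull hK (by exact_mod_cast hFK) (by simp [hF]) hyF
    refine mem_hull_of_baryCoord hK hFK ?_ fun c hc hcF => ?_
    · rw [hull_eq hK]
      intro c hc
      by_cases e : c = a
      · rw [e, haz]
      · exact (Set.mem_iInter₂.1 hv.2 c (Finset.mem_erase.2 ⟨e, hc⟩)).le
    · have : c = a := by
        by_contra e
        exact hcF (Finset.mem_erase.2 ⟨e, hc⟩)
      rw [this, haz]

lemma integrableOn_hull (hK : IsSimplex K) {g : Pt n → ℝ} (hg : Continuous g) :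
    IntegrableOn g (hull K) := (fullSupport_volume hK).integrableOn hg

lemma poly_eq_zero_of_hull (hK : IsSimplex K) {p : Poly n} (h : ∀ x ∈ hull K, ev p x = 0) :
    p = 0 :=
  eq_zero_of_ev_eq_zero ⟨_, barycentre_mem_interior hK⟩ h

/-- Integration of polynomials against `g` over `S`, as a linear functional. -/
def polyInt {ν : Measure (Pt n)} {S : Set (Pt n)} (h : FullSupport ν S) {g : Pt n → ℝ}
    (hg : Continuous g) : Poly n →ₗ[ℝ] ℝ where
  toFun q := ∫ x in S, g x * ev q x ∂ν
  map_add' p q := by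
    rw [← integral_add (h.integrableOn (by fun_prop)) (h.integrableOn (by fun_prop))]
    simp only [ev_add, mul_add]
  map_smul' r q := by
    simp only [ev_smul, RingHom.id_apply, smul_eq_mul]
    rw [← integral_const_mul]
    congr 1
    ext x
    ring

end Integration

/-! ### How the cells of a conforming mesh meet, and their connectivity through facets -/

section MeshTopology

variable {n : ℕ} {Ω : Set (Pt n)} {T : Mesh n Ω} {K L M F : Finset (Pt n)}

lemma Mesh.isSimplex (hK : K ∈ T.cells) : IsSimplex K := ⟨T.card_cell K hK, T.indep K hK⟩

lemma Mesh.mem_facets : F ∈ T.facets ↔ ∃ K ∈ T.cells, F ⊆ K ∧ F.card = n := by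
  simp [Mesh.facets, Finset.mem_powersetCard]

lemma Mesh.mem_convexHull_inter (hK : K ∈ T.cells) (hL : L ∈ T.cells) {x : Pt n}
    (hxK : x ∈ hull K) (hxL : x ∈ hull L) :
    x ∈ convexHull ℝ ((K : Set (Pt n)) ∩ (L : Set (Pt n))) := by
  rw [← T.conforming K hK L hL]
  exact ⟨hxK, hxL⟩

lemma Mesh.eq_of_subset (hK : K ∈ T.cells) (hL : L ∈ T.cells) (h : K ⊆ L) : K = L :=
  Finset.eq_of_subset_of_card_le h (by rw [T.card_cell K hK, T.card_cell L hL])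

/-- By conformity a common point lies in the hull of the common vertices, where the coordinates at
all other vertices vanish. -/
lemma Mesh.mem_of_baryCoord_ne_zero (hK : K ∈ T.cells) (hL : L ∈ T.cells) {x c : Pt n}
    (hxK : x ∈ hull K) (hxL : x ∈ hull L) (h : baryCoord K c x ≠ 0) : c ∈ L := by
  by_contra hc
  exact h (baryCoord_zero_on_hull (Mesh.isSimplex hK) Set.inter_subset_left (fun h => hc h.2)
    (Mesh.mem_convexHull_inter hK hL hxK hxL))

/-- A point all of whose barycentric coordinates in `K` are positive lies in no other cell. -/
lemma Mesh.eq_of_mem_interior (hK : K ∈ T.cells) (hL : L ∈ T.cells) {x : Pt n}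
    (hxK : x ∈ interior (hull K)) (hxL : x ∈ hull L) : K = L := by
  refine Mesh.eq_of_subset hK hL fun c hc =>
    Mesh.mem_of_baryCoord_ne_zero hK hL (interior_subset hxK) hxL ?_
  rw [interior_hull_eq (Mesh.isSimplex hK)] at hxK
  exact (hxK c hc).ne'

lemma baryCoord_eq_on_hull (hK : IsSimplex K) (hL : IsSimplex L) {A : Set (Pt n)}
    (hAK : A ⊆ K) (hAL : A ⊆ L) (c : Pt n) {x : Pt n} (hx : x ∈ convexHull ℝ A) :
    baryCoord K c x = baryCoord L c x := by
  have := affineMap_zero_on_hull (f := baryCoord K c - baryCoord L c) (A := A) (fun b hb => by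
    simp [baryCoord_vertex hK (hAK hb), baryCoord_vertex hL (hAL hb)]) hx
  simpa [sub_eq_zero] using this

lemma baryCoord_barycentre_facet (hK : IsSimplex K) (hFK : F ⊆ K) (hF : F.Nonempty) {c : Pt n}
    (hc : c ∈ F) : 0 < baryCoord K c (barycentre F) := by
  rw [affineMap_barycentre hF,
    Finset.sum_congr rfl fun b hb => baryCoord_vertex hK (hFK hb), Finset.sum_ite_eq, if_pos hc]
  have := hF.card_pos
  positivity

/-- Two cells that share a facet lie on opposite sides of it. -/
lemma Mesh.baryCoord_opposite_neg (hn : 1 ≤ n) (hK : K ∈ T.cells) (hL : L ∈ T.cells) (hKL : K ≠ L)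
    {a b : Pt n} (ha : a ∈ K) (hb : b ∈ L) (h : K.erase a = L.erase b) :
    baryCoord L b a < 0 := by
  have sK := Mesh.isSimplex hK
  have sL := Mesh.isSimplex hL
  set F := K.erase a with hF
  have hFK : F ⊆ K := Finset.erase_subset _ _
  have hFL : F ⊆ L := h ▸ Finset.erase_subset _ _
  have hFc : F.card = n := by rw [hF, Finset.card_erase_of_mem ha, sK.1]; rfl
  have hFn : F.Nonempty := Finset.card_pos.1 (by omega)
  have hbF : b ∉ F := by rw [h]; simp
  have haL : a ∉ L := fun haL => hKL (Mesh.eq_of_subset hK hL fun c hc => by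
    by_cases e : c = a
    · rwa [e]
    · exact hFL (Finset.mem_erase.2 ⟨e, hc⟩))
  have hinter : (K : Set (Pt n)) ∩ L ⊆ F := fun c hc =>
    Finset.mem_erase.2 ⟨fun e => haL (e ▸ hc.2), hc.1⟩
  rw [← not_le]
  intro hs
  rcases hs.eq_or_lt with hs | hs
  -- If `a` were in the hyperplane of the facet, this coordinate would vanish at all vertices of
  -- `K`, hence identically, although it is 1 at `b`.
  · have hz : baryCoord L b = 0 := by
      refine affineMap_ext sK fun c hc => ?_
      by_cases e : c = a
      · rw [e, ← hs]; rfl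
      · have hcF : c ∈ F := Finset.mem_erase.2 ⟨e, hc⟩
        rw [baryCoord_vertex sL (hFL hcF), if_neg (by rintro rfl; exact hbF hcF)]; rfl
    have := baryCoord_vertex sL hb (c := b)
    rw [hz] at this
    simp at this
  -- If `a` were on the same side as `b`, a point slightly off the barycentre of the facet towards
  -- `a` would lie in both cells, but not in the hull of their common vertices.
  · have hbar : ∀ c, baryCoord L c (AffineMap.lineMap (barycentre F) a (0 : ℝ)) =
        baryCoord L c (barycentre F) := fun c => by simp
    have hev : ∀ᶠ ε in nhdsWithin (0 : ℝ) (Set.Ioi 0), ∀ c ∈ F,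
        0 < baryCoord L c (AffineMap.lineMap (barycentre F) a ε) := by
      refine nhdsWithin_le_nhds ?_
      refine (Filter.eventually_all_finset F).2 fun c hc => ?_
      have hcont : ContinuousAt
          (fun ε : ℝ => baryCoord L c (AffineMap.lineMap (barycentre F) a ε)) 0 :=
        ((continuous_baryCoord L c).comp AffineMap.lineMap_continuous).continuousAt
      refine hcont.eventually (lt_mem_nhds ?_)
      beta_reduce
      rw [hbar]
      exact baryCoord_barycentre_facet sL hFL hFn hc
    obtain ⟨ε, ⟨hεc, hε1⟩, hε0⟩ := ((hev.and (nhdsWithin_le_nhds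
      (Iio_mem_nhds (zero_lt_one (α := ℝ))))).and self_mem_nhdsWithin).exists
    have hε0' : (0 : ℝ) < ε := hε0
    have hε1' : ε < 1 := hε1
    set y : Pt n := AffineMap.lineMap (barycentre F) a ε
    have hyb : baryCoord L b y = ε * baryCoord L b a := by
      rw [show y = AffineMap.lineMap (barycentre F) a ε from rfl, AffineMap.apply_lineMap,
        AffineMap.lineMap_apply_module, baryCoord_zero_on_hull sL (A := F)
        (by exact_mod_cast hFL) (by exact_mod_cast hbF) (barycentre_mem_hull hFn)]
      simp
    have hyL : y ∈ hull L := by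
      rw [hull_eq sL]
      intro c hc
      by_cases e : c = b
      · rw [e, hyb]; positivity
      · exact (hεc c (h ▸ Finset.mem_erase.2 ⟨e, hc⟩)).le
    have hyK : y ∈ hull K := (convex_convexHull ℝ _).lineMap_mem
      (convexHull_mono (by exact_mod_cast hFK) (barycentre_mem_hull hFn))
      (subset_convexHull ℝ _ ha) ⟨hε0'.le, hε1'.le⟩
    have := Mesh.mem_convexHull_inter hK hL hyK hyL
    have h0 := baryCoord_zero_on_hull sL (by exact_mod_cast hFL) (by exact_mod_cast hbF)
      (convexHull_mono hinter this)
    rw [hyb] at h0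
    have := mul_pos hε0' hs
    linarith

lemma Mesh.baryCoord_opposite (hK : K ∈ T.cells) (hL : L ∈ T.cells)
    {a b : Pt n} (h : K.erase a = L.erase b) :
    baryCoord L b = baryCoord L b a • baryCoord K a :=
  affineMap_eq_smul_baryCoord (Mesh.isSimplex hK) fun c hc => by
    rw [h] at hc
    rw [baryCoord_vertex (Mesh.isSimplex hL) (Finset.mem_of_mem_erase hc),
      if_neg (Ne.symm (Finset.ne_of_mem_erase hc))]

/-- A facet lies in at most two cells. -/
lemma Mesh.eq_or_eq_of_facet (hn : 1 ≤ n) (hK : K ∈ T.cells) (hL : L ∈ T.cells) (hM : M ∈ T.cells)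
    (hKL : K ≠ L) (hF : F.card = n) (hFK : F ⊆ K) (hFL : F ⊆ L) (hFM : F ⊆ M) :
    M = K ∨ M = L := by
  by_contra! hne
  obtain ⟨a, ha, rfl⟩ := exists_eq_erase (Mesh.isSimplex hK) hFK hF
  obtain ⟨b, hb, hab⟩ := exists_eq_erase (Mesh.isSimplex hL) hFL hF
  obtain ⟨c, hc, hac⟩ := exists_eq_erase (Mesh.isSimplex hM) hFM hF
  -- Three cells would be pairwise on opposite sides of one hyperplane. At `c` the coordinate of `L`
  -- at `b` is negative, yet it equals the product of its negative value at `a` and the negative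
  -- coordinate of `K` at `a`.
  have h1 := Mesh.baryCoord_opposite_neg hn hK hL hKL ha hb hab
  have h2 := Mesh.baryCoord_opposite_neg hn hM hK hne.1 hc ha hac.symm
  have h3 := Mesh.baryCoord_opposite_neg hn hM hL hne.2 hc hb (hac.symm.trans hab)
  have h4 := congrArg (fun f : Pt n →ᵃ[ℝ] ℝ => f c) (Mesh.baryCoord_opposite hK hL hab)
  simp only [AffineMap.coe_smul, Pi.smul_apply, smul_eq_mul] at h4
  have := mul_pos_of_neg_of_neg h1 h2
  linarith

/-- The two coordinates opposite to the facet are negative multiples of each other, hence so are the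
normals; both have length one. -/
lemma Mesh.outwardNormal_neg (hn : 1 ≤ n) (hK : K ∈ T.cells) (hL : L ∈ T.cells) (hKL : K ≠ L)
    (hF : F.card = n) (hFK : F ⊆ K) (hFL : F ⊆ L) :
    outwardNormal L F = -outwardNormal K F := by
  obtain ⟨a, ha, rfl⟩ := exists_eq_erase (Mesh.isSimplex hK) hFK hF
  obtain ⟨b, hb, hab⟩ := exists_eq_erase (Mesh.isSimplex hL) hFL hF
  obtain ⟨nK, s, hs, hK'⟩ := outwardNormal_spec hn (Mesh.isSimplex hK) ha
  obtain ⟨nL, t, ht, hL'⟩ := outwardNormal_spec hn (Mesh.isSimplex hL) hb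
  have h1 := Mesh.baryCoord_opposite_neg hn hK hL hKL ha hb hab
  rw [← hab] at nL hL'
  set u := outwardNormal K (K.erase a)
  set v := outwardNormal L (K.erase a)
  set r := baryCoord L b a
  have hlin : ∀ x, (baryCoord L b).linear x = r * (baryCoord K a).linear x := fun x => by
    have := congrArg (fun f : Pt n →ᵃ[ℝ] ℝ => f.linear x) (Mesh.baryCoord_opposite hK hL hab)
    simpa using this
  have hv : v = (t * r / s) • u := by
    refine ext_inner_right ℝ fun x => ?_
    rw [real_inner_smul_left, hK', hL', hlin]
    field_simp [hs.ne]
  have hc : t * r / s < 0 := div_neg_of_pos_of_neg (mul_pos_of_neg_of_neg ht h1) hs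
  have : ‖v‖ = |t * r / s| * ‖u‖ := by rw [hv, norm_smul, Real.norm_eq_abs]
  rw [nK, nL, mul_one, abs_of_neg hc] at this
  rw [hv, show t * r / s = -1 by linarith, neg_one_smul]

lemma Mesh.hull_subset_closure (hK : K ∈ T.cells) : hull K ⊆ closure Ω := by
  rw [← T.covers]
  exact Set.subset_biUnion_of_mem (u := fun K => hull K) hK

lemma isClosed_biUnion_hull (s : Finset (Finset (Pt n))) : IsClosed (⋃ K ∈ s, hull K) :=
  isClosed_biUnion_finset fun K _ => (isCompact_hull K).isClosed

/-- At most `n` points span an affine subspace of dimension less than `n`. -/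
lemma volume_affineSpan_insert {A : Finset (Pt n)} (hA : A.card < n) (p : Pt n) :
    volume (affineSpan ℝ ((insert p A : Finset (Pt n)) : Set (Pt n)) : Set (Pt n)) = 0 := by
  refine Measure.addHaar_affineSubspace volume _ fun htop => ?_
  have h1 := finrank_vectorSpan_image_finset_le ℝ (id : Pt n → Pt n) (insert p A)
    (n := (insert p A).card - 1)
    (by have := Finset.card_pos.2 (Finset.insert_nonempty p A); omega)
  rw [Finset.image_id] at h1
  have h2 := Finset.card_insert_le p A
  rw [← direction_affineSpan, htop, AffineSubspace.direction_top, finrank_top,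
    finrank_euclideanSpace_fin] at h1
  omega

lemma exists_mem_interior_of_mem_hull (hK : IsSimplex K) {x : Pt n} (hx : x ∈ hull K)
    {U : Set (Pt n)} (hU : IsOpen U) (hxU : x ∈ U) : (U ∩ interior (hull K)).Nonempty := by
  have hc : Convex ℝ (hull K) := convex_convexHull ℝ _
  have h1 : x ∈ closure (interior (hull K)) := by
    rw [hc.closure_interior_eq_closure_of_nonempty_interior ⟨_, barycentre_mem_interior hK⟩]
    exact subset_closure hx
  exact mem_closure_iff.1 h1 U hU hxU

/-- The cells of a mesh of a connected domain are connected through facets. -/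
lemma Mesh.facet_induction (hΩ_open : IsOpen Ω) (hΩ_conn : IsConnected Ω)
    (hΩ_reg : interior (closure Ω) = Ω) (P : Finset (Pt n) → Prop)
    {K₀ : Finset (Pt n)} (hK₀ : K₀ ∈ T.cells) (h₀ : P K₀)
    (step : ∀ K ∈ T.cells, ∀ L ∈ T.cells, K ≠ L → ∀ F, F ⊆ K → F ⊆ L → F.card = n → P K → P L) :
    ∀ K ∈ T.cells, P K := by
  by_contra! hne
  obtain ⟨L₀, hL₀, hPL₀⟩ := hne
  set X := ⋃ K ∈ T.cells.filter P, hull K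
  set Y := ⋃ K ∈ T.cells.filter (fun K => ¬ P K), hull K
  have hX : IsClosed X := isClosed_biUnion_hull _
  have hY : IsClosed Y := isClosed_biUnion_hull _
  have hcov : closure Ω ⊆ X ∪ Y := by
    rw [← T.covers]
    refine Set.iUnion₂_subset fun K hK => ?_
    by_cases hP : P K
    · exact (Set.subset_biUnion_of_mem (u := fun K => hull K)
        (by simpa using ⟨hK, hP⟩)).trans Set.subset_union_left
    · exact (Set.subset_biUnion_of_mem (u := fun K => hull K)
        (by simpa using ⟨hK, hP⟩)).trans Set.subset_union_right
  have hmem : ∀ K ∈ T.cells, barycentre K ∈ Ω := fun K hK => by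
    rw [← hΩ_reg]
    exact interior_mono (Mesh.hull_subset_closure hK) (barycentre_mem_interior (Mesh.isSimplex hK))
  -- Both kinds of cells reach a common point `z` of the domain. The contradiction comes from a
  -- segment within a ball about `z`, running from one kind to the other and avoiding every common
  -- face with fewer than `n` vertices.
  obtain ⟨z, hzΩ, hzX, hzY⟩ := isPreconnected_closed_iff.1 hΩ_conn.isPreconnected X Y hX hY
    (subset_closure.trans hcov)
    ⟨_, hmem K₀ hK₀, Set.mem_biUnion (Finset.mem_filter.2 ⟨hK₀, h₀⟩)
      (interior_subset (barycentre_mem_interior (Mesh.isSimplex hK₀)))⟩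
    ⟨_, hmem L₀ hL₀, Set.mem_biUnion (Finset.mem_filter.2 ⟨hL₀, hPL₀⟩)
      (interior_subset (barycentre_mem_interior (Mesh.isSimplex hL₀)))⟩
  obtain ⟨ε, hε, hball⟩ := Metric.isOpen_iff.1 hΩ_open z hzΩ
  obtain ⟨K, hK, hzK⟩ := Set.mem_iUnion₂.1 hzX
  obtain ⟨L, hL, hzL⟩ := Set.mem_iUnion₂.1 hzY
  rw [Finset.mem_filter] at hK hL
  have hzB : z ∈ Metric.ball z ε := Metric.mem_ball_self hε
  obtain ⟨p, hpB, hpK⟩ := exists_mem_interior_of_mem_hull (Mesh.isSimplex hK.1) hzK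
    Metric.isOpen_ball hzB
  -- The endpoints to be avoided: those seen from `p` through the common vertices of two cells of
  -- different kind. By `step` such cells share fewer than `n` vertices, so this set is null.
  set bad : Set (Pt n) := ⋃ K' ∈ T.cells.filter P, ⋃ L' ∈ T.cells.filter (fun K => ¬ P K),
    (affineSpan ℝ ((insert p (K' ∩ L') : Finset (Pt n)) : Set (Pt n)) : Set (Pt n))
  have hbad : volume bad = 0 := by
    refine (measure_biUnion_null_iff (Finset.countable_toSet _)).2 fun K' hK' =>
      (measure_biUnion_null_iff (Finset.countable_toSet _)).2 fun L' hL' =>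
        volume_affineSpan_insert ?_ p
    rw [Finset.mem_coe, Finset.mem_filter] at hK' hL'
    by_contra! hcard
    obtain ⟨F, hF, hFc⟩ := Finset.exists_subset_card_eq hcard
    exact hL'.2 (step K' hK'.1 L' hL'.1 (by rintro rfl; exact hL'.2 hK'.2) F
      (hF.trans Finset.inter_subset_left) (hF.trans Finset.inter_subset_right) hFc hK'.2)
  have hO : IsOpen (Metric.ball z ε ∩ interior (hull L)) := Metric.isOpen_ball.inter isOpen_interior
  have hpos := hO.measure_pos volume
    (exists_mem_interior_of_mem_hull (Mesh.isSimplex hL.1) hzL Metric.isOpen_ball hzB)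
  obtain ⟨q, ⟨hqB, hqL⟩, hqbad⟩ : ∃ q ∈ Metric.ball z ε ∩ interior (hull L), q ∉ bad := by
    by_contra! hsub
    exact hpos.ne' (measure_mono_null hsub hbad)
  have hseg : segment ℝ p q ⊆ X ∪ Y :=
    ((convex_ball z ε).segment_subset hpB hqB).trans (hball.trans (subset_closure.trans hcov))
  obtain ⟨w, hws, hwX, hwY⟩ := isPreconnected_closed_iff.1 (convex_segment p q).isPreconnected
    X Y hX hY hseg ⟨p, left_mem_segment ℝ p q,
      Set.mem_biUnion (Finset.mem_filter.2 hK) (interior_subset hpK)⟩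
    ⟨q, right_mem_segment ℝ p q,
      Set.mem_biUnion (Finset.mem_filter.2 hL) (interior_subset hqL)⟩
  obtain ⟨K', hK', hwK'⟩ := Set.mem_iUnion₂.1 hwX
  obtain ⟨L', hL', hwL'⟩ := Set.mem_iUnion₂.1 hwY
  refine hqbad (Set.mem_biUnion hK' (Set.mem_biUnion hL' ?_))
  rw [Finset.mem_filter] at hK' hL'
  have hpw : p ≠ w := by
    rintro rfl
    have := Mesh.eq_of_mem_interior hK.1 hL'.1 hpK hwL'
    exact hL'.2 (this ▸ hK.2)
  set S := affineSpan ℝ ((insert p (K' ∩ L') : Finset (Pt n)) : Set (Pt n))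
  have hwS : w ∈ S := by
    have := convexHull_subset_affineSpan _ (Mesh.mem_convexHull_inter hK'.1 hL'.1 hwK' hwL')
    refine affineSpan_mono ℝ ?_ this
    rw [Finset.coe_insert, Finset.coe_inter]
    exact Set.subset_insert _ _
  have hpS : p ∈ S := subset_affineSpan ℝ _ (by simp)
  rw [segment_eq_image_lineMap] at hws
  obtain ⟨t, -, rfl⟩ := hws
  have ht : t ≠ 0 := by
    rintro rfl
    simp at hpw
  -- The endpoint lies on the line through `p` and the crossing point, hence in the span that it was
  -- chosen to avoid.
  have hq : q = AffineMap.lineMap p (AffineMap.lineMap p q t) t⁻¹ := by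
    rw [AffineMap.lineMap_lineMap_right]
    simp [ht]
  rw [hq]
  exact AffineMap.lineMap_mem _ hpS hwS

end MeshTopology

/-! ### Boundary facets and inner facets -/

section Boundary

variable {n : ℕ} {Ω : Set (Pt n)} {T : Mesh n Ω} {K L F : Finset (Pt n)}

/-- A facet that lies in only one cell is part of the boundary. -/
lemma Mesh.hull_subset_frontier (hn : 1 ≤ n) (hΩ_open : IsOpen Ω)
    (hK : K ∈ T.cells) (hFK : F ⊆ K) (hF : F.card = n)
    (h : ∀ L ∈ T.cells, F ⊆ L → L = K) : hull F ⊆ frontier Ω := by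
  have sK := Mesh.isSimplex hK
  have hFhull : hull F ⊆ hull K := convexHull_mono (by exact_mod_cast hFK)
  intro y hy
  rw [hΩ_open.frontier_eq]
  refine ⟨Mesh.hull_subset_closure hK (hFhull hy), fun hyΩ => ?_⟩
  obtain ⟨x, ⟨hxF, hxΩ⟩, hx⟩ := exists_pos_baryCoord_of_mem_facet hn sK hFK hF hy hΩ_open hyΩ
  obtain ⟨a, ha, rfl⟩ := exists_eq_erase sK hFK hF
  -- Any other cell containing `x` would contain the whole facet. Near `x` the domain is therefore
  -- covered by `K` alone, which makes `x` interior to `K`, although it lies on a facet.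
  set R := ⋃ L ∈ T.cells.erase K, hull L
  have hxR : x ∉ R := by
    intro hxR
    obtain ⟨L, hL, hxL⟩ := Set.mem_iUnion₂.1 hxR
    rw [Finset.mem_erase] at hL
    exact hL.1 (h L hL.2 fun c hc =>
      Mesh.mem_of_baryCoord_ne_zero hK hL.2 (hFhull hxF) hxL (hx c hc).ne')
  have hsub : Ω ∩ Rᶜ ⊆ hull K := by
    rintro w ⟨hwΩ, hwR⟩
    have := subset_closure hwΩ
    rw [← T.covers] at this
    obtain ⟨L, hL, hwL⟩ := Set.mem_iUnion₂.1 this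
    by_cases e : L = K
    · rwa [← e]
    · exact absurd (Set.mem_biUnion (Finset.mem_erase.2 ⟨e, hL⟩) hwL) hwR
  have hint : x ∈ interior (hull K) :=
    mem_interior.2 ⟨_, hsub, hΩ_open.inter (isClosed_biUnion_hull _).isOpen_compl, hxΩ, hxR⟩
  rw [interior_hull_eq sK] at hint
  have h0 := baryCoord_zero_on_hull sK (c := a) (A := (K.erase a : Finset (Pt n)))
    (by exact_mod_cast hFK) (by simp) hxF
  exact (hint a ha).ne' h0

/-- A point in the relative interior of a facet that lies in two cells is an inner point. -/
lemma Mesh.mem_of_two_cells (hn : 1 ≤ n) (hΩ_reg : interior (closure Ω) = Ω)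
    (hK : K ∈ T.cells) (hL : L ∈ T.cells) (hKL : K ≠ L) (hFK : F ⊆ K) (hFL : F ⊆ L)
    (hF : F.card = n) {x : Pt n} (hxF : x ∈ hull F) (hx : ∀ c ∈ F, 0 < baryCoord K c x) :
    x ∈ Ω := by
  have sK := Mesh.isSimplex hK
  have sL := Mesh.isSimplex hL
  obtain ⟨a, ha, rfl⟩ := exists_eq_erase sK hFK hF
  obtain ⟨b, hb, hab⟩ := exists_eq_erase sL hFL hF
  have hneg := Mesh.baryCoord_opposite_neg hn hK hL hKL ha hb hab
  have hopp := Mesh.baryCoord_opposite hK hL hab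
  set F := K.erase a with hFdef
  -- This neighbourhood is covered by the two cells: the sign of the coordinate at `a` tells which
  -- one contains a given point.
  have hO : IsOpen (⋂ c ∈ F, {y | 0 < baryCoord K c y} ∩ {y | 0 < baryCoord L c y}) :=
    isOpen_biInter_finset fun c _ => (isOpen_lt continuous_const (continuous_baryCoord K c)).inter
      (isOpen_lt continuous_const (continuous_baryCoord L c))
  rw [← hΩ_reg]
  refine mem_interior.2 ⟨_, fun y hy => ?_, hO, ?_⟩
  · rw [Set.mem_iInter₂] at hy
    rcases le_total 0 (baryCoord K a y) with h0 | h0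
    · refine Mesh.hull_subset_closure hK ?_
      rw [hull_eq sK]
      intro c hc
      by_cases e : c = a
      · rwa [e]
      · exact (hy c (Finset.mem_erase.2 ⟨e, hc⟩)).1.le
    · refine Mesh.hull_subset_closure hL ?_
      rw [hull_eq sL]
      intro c hc
      by_cases e : c = b
      · rw [e, hopp]
        exact mul_nonneg_of_nonpos_of_nonpos hneg.le h0
      · exact (hy c (hab ▸ Finset.mem_erase.2 ⟨e, hc⟩)).2.le
  · rw [Set.mem_iInter₂]
    refine fun c hc => ⟨hx c hc, ?_⟩
    have := baryCoord_eq_on_hull sK sL (A := F) (by exact_mod_cast hFK) (by exact_mod_cast hFL)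
      c hxF
    rw [Set.mem_ofPred_eq, ← this]
    exact hx c hc

/-- A part of the boundary of positive surface measure meets some boundary facet in a set of
positive surface measure. -/
lemma Mesh.exists_boundary_facet (T : Mesh n Ω) (hn : 1 ≤ n) (hΩ_open : IsOpen Ω)
    (hΩ_reg : interior (closure Ω) = Ω) {Γ : Set (Pt n)} (hΓ : Γ ⊆ frontier Ω)
    (hpos : 0 < surf n Γ) :
    ∃ F ∈ T.facets, hull F ⊆ frontier Ω ∧ 0 < surf n (hull F ∩ Γ) := by
  by_contra! hcon
  -- A boundary point has a zero coordinate in its cell. If exactly one vanishes it lies on a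
  -- boundary facet; otherwise on a face with fewer than `n` vertices, which is a null set.
  refine hpos.ne' (measure_mono_null (t := (⋃ F ∈ T.facets.filter (fun F => hull F ⊆ frontier Ω),
    hull F ∩ Γ) ∪ ⋃ K ∈ T.cells, ⋃ A ∈ K.powerset.filter (fun A => A.card < n), hull A) ?_ ?_)
  · intro x hxΓ
    have hx := hΓ hxΓ
    rw [hΩ_open.frontier_eq] at hx
    have hxc := hx.1
    rw [← T.covers] at hxc
    obtain ⟨K, hK, hxK⟩ := Set.mem_iUnion₂.1 hxc
    have sK := Mesh.isSimplex hK
    have hxi : x ∉ interior (hull K) := fun hi =>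
      hx.2 (hΩ_reg ▸ interior_mono (Mesh.hull_subset_closure hK) hi)
    have hxK' := hxK
    rw [interior_hull_eq sK] at hxi
    rw [hull_eq sK] at hxK'
    obtain ⟨a, ha, hax⟩ : ∃ a ∈ K, baryCoord K a x ≤ 0 := by
      by_contra! hall
      exact hxi hall
    have hax : baryCoord K a x = 0 := le_antisymm hax (hxK' a ha)
    have hFK : K.erase a ⊆ K := Finset.erase_subset _ _
    have hFc : (K.erase a).card = n := by rw [Finset.card_erase_of_mem ha, sK.1]; rfl
    have hxF : x ∈ hull (K.erase a) := mem_hull_of_baryCoord sK hFK hxK fun c hc hcF => by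
      have : c = a := by
        by_contra e
        exact hcF (Finset.mem_erase.2 ⟨e, hc⟩)
      rwa [this]
    by_cases hall : ∀ c ∈ K.erase a, 0 < baryCoord K c x
    · left
      refine Set.mem_biUnion (Finset.mem_filter.2 ⟨Mesh.mem_facets.2 ⟨K, hK, hFK, hFc⟩, ?_⟩)
        ⟨hxF, hxΓ⟩
      refine Mesh.hull_subset_frontier hn hΩ_open hK hFK hFc fun L hL hFL => ?_
      by_contra hne
      exact hx.2 (Mesh.mem_of_two_cells hn hΩ_reg hK hL (Ne.symm hne) hFK hFL hFc hxF hall)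
    · right
      push Not at hall
      obtain ⟨b, hb, hbx⟩ := hall
      have hbx : baryCoord K b x = 0 := le_antisymm hbx (hxK' b (hFK hb))
      refine Set.mem_biUnion hK (Set.mem_biUnion (x := (K.erase a).erase b)
        (Finset.mem_filter.2 ⟨Finset.mem_powerset.2 ((Finset.erase_subset _ _).trans hFK), ?_⟩) ?_)
      · rw [Finset.card_erase_of_mem hb, hFc]; omega
      · refine mem_hull_of_baryCoord sK ((Finset.erase_subset _ _).trans hFK) hxK fun c hc hcF => ?_
        by_cases e : c = a
        · rwa [e]
        · have : c = b := by
            by_contra e'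
            exact hcF (Finset.mem_erase.2 ⟨e', Finset.mem_erase.2 ⟨e, hc⟩⟩)
          rwa [this]
  · refine measure_union_null ((measure_biUnion_null_iff (Finset.countable_toSet _)).2
      fun F hF => ?_) ((measure_biUnion_null_iff (Finset.countable_toSet _)).2 fun K hK =>
      (measure_biUnion_null_iff (Finset.countable_toSet _)).2 fun A hA => ?_)
    · rw [Finset.mem_coe, Finset.mem_filter] at hF
      exact le_antisymm (hcon F hF.1 hF.2) zero_le
    · rw [Finset.mem_coe, Finset.mem_filter] at hA
      exact surf_hull_eq_zero hA.2

end Boundary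

/-! ### Combinatorics and edge derivatives on a barycentrically split simplex -/

section Macro

variable {n : ℕ} {Ω : Set (Pt n)} {T T₀ : Mesh n Ω} {S S' K L F : Finset (Pt n)}

/-- The mesh `T` is the barycentric split of `T₀`. -/
def IsSplitOf (T T₀ : Mesh n Ω) : Prop :=
  ∀ s : Finset (Pt n),
    s ∈ T.cells ↔ ∃ K ∈ T₀.cells, ∃ a ∈ K, s = insert (barycentre K) (K.erase a)

/-- The part of the split of `S` opposite to the vertex `a`. -/
def subcell (S : Finset (Pt n)) (a : Pt n) : Finset (Pt n) := insert (barycentre S) (S.erase a)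

lemma barycentre_notMem (hn : 1 ≤ n) (hS : IsSimplex S) : barycentre S ∉ S := by
  intro h
  have h1 := baryCoord_barycentre hS h
  rw [baryCoord_vertex hS h, if_pos rfl] at h1
  have : (0 : ℝ) < n := by exact_mod_cast hn
  have h2 : ((n : ℝ) + 1)⁻¹ < 1 := inv_lt_one_of_one_lt₀ (by linarith)
  linarith

lemma barycentre_ne (hn : 1 ≤ n) (hS : IsSimplex S) {d : Pt n} (hd : d ∈ S) :
    barycentre S ≠ d := fun e => barycentre_notMem hn hS (by rwa [e])

lemma subcell_mem (h : IsSplitOf T T₀) (hS : S ∈ T₀.cells) {a : Pt n} (ha : a ∈ S) :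
    subcell S a ∈ T.cells := (h _).2 ⟨S, hS, a, ha, rfl⟩

lemma barycentre_mem_subcell (S : Finset (Pt n)) (a : Pt n) : barycentre S ∈ subcell S a :=
  Finset.mem_insert_self _ _

lemma mem_subcell_iff (hn : 1 ≤ n) (hS : IsSimplex S) {a c : Pt n} (hc : c ∈ S) :
    c ∈ subcell S a ↔ c ≠ a := by
  rw [subcell, Finset.mem_insert, Finset.mem_erase]
  constructor
  · rintro (rfl | h)
    · exact absurd hc (barycentre_notMem hn hS)
    · exact h.1
  · exact fun h => Or.inr ⟨h, hc⟩

lemma subcell_injOn (hn : 1 ≤ n) (hS : IsSimplex S) {a b : Pt n} (hb : b ∈ S)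
    (h : subcell S a = subcell S b) : a = b := by
  by_contra hne
  have h1 := (mem_subcell_iff hn hS (a := a) hb).2 (Ne.symm hne)
  rw [h, mem_subcell_iff hn hS hb] at h1
  exact h1 rfl

/-- The cells of the split that contain the barycentre of `S` are the parts of `S`. -/
lemma exists_eq_subcell (h : IsSplitOf T T₀) (hS : S ∈ T₀.cells) (hK : K ∈ T.cells)
    (hz : barycentre S ∈ K) : ∃ a ∈ S, K = subcell S a := by
  obtain ⟨S', hS', a, ha, rfl⟩ := (h K).1 hK
  have sS := Mesh.isSimplex hS
  have sS' := Mesh.isSimplex hS'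
  have hmem : barycentre S ∈ hull S' := by
    rcases Finset.mem_insert.1 hz with e | e
    · rw [e]; exact interior_subset (barycentre_mem_interior sS')
    · exact subset_convexHull ℝ _ (Finset.mem_of_mem_erase e)
  have := Mesh.eq_of_mem_interior hS hS' (barycentre_mem_interior sS) hmem
  subst this
  exact ⟨a, ha, rfl⟩

/-- A facet of a part of `S` that contains the barycentre lies in two parts. -/
lemma exists_two_subcells (h : IsSplitOf T T₀) (hS : S ∈ T₀.cells)
    {a : Pt n} (ha : a ∈ S) (hF : F ⊆ subcell S a) (hFc : F.card = n) (hz : barycentre S ∈ F) :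
    ∃ b ∈ S, b ≠ a ∧ F ⊆ subcell S b := by
  obtain ⟨b, hb, rfl⟩ := exists_eq_erase (Mesh.isSimplex (subcell_mem h hS ha)) hF hFc
  have hbz : b ≠ barycentre S := fun e => by rw [e] at hz; simp at hz
  have hbS := (Finset.mem_insert.1 hb).resolve_left hbz
  rw [Finset.mem_erase] at hbS
  refine ⟨b, hbS.2, hbS.1, fun c hc => ?_⟩
  rw [Finset.mem_erase, subcell, Finset.mem_insert, Finset.mem_erase] at hc
  rw [subcell, Finset.mem_insert, Finset.mem_erase]
  tauto

lemma linear_sub_eq (hn : 1 ≤ n) (h : IsSplitOf T T₀) (hS : S ∈ T₀.cells) {a b i c : Pt n}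
    (hb : b ∈ S) (ha : a ∈ S) (hi : i ∈ S) (hia : i ≠ a) (hib : i ≠ b) :
    (baryCoord (subcell S i) c).linear (b - a) =
      (if c = b then 1 else 0) - if c = a then 1 else 0 :=
  baryCoord_linear (Mesh.isSimplex (subcell_mem h hS hi))
    ((mem_subcell_iff hn (Mesh.isSimplex hS) ha).2 hia.symm)
    ((mem_subcell_iff hn (Mesh.isSimplex hS) hb).2 hib.symm)

/-- The vectors from the barycentre to the vertices sum to zero. This expresses an edge at `a` by
edges of the part opposite to `a`, of which `a` is not a vertex. -/
lemma sub_eq_sum_sub_barycentre (hS : IsSimplex S) {a : Pt n} (ha : a ∈ S) (b : Pt n) :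
    b - a = ∑ c ∈ S.erase a, (c - barycentre S) + (b - barycentre S) := by
  have h1 : ∑ c ∈ S, c = ((n : ℝ) + 1) • barycentre S := by
    rw [barycentre, hS.1, smul_smul]
    push_cast
    rw [mul_inv_cancel₀ (by positivity), one_smul]
  rw [Finset.sum_sub_distrib, Finset.sum_const, Finset.card_erase_of_mem ha, hS.1,
    Nat.add_sub_cancel, ← Nat.cast_smul_eq_nsmul ℝ]
  rw [← Finset.add_sum_erase _ _ ha] at h1
  rw [eq_sub_of_add_eq' h1]
  module

/-- In the decomposition `sub_eq_sum_sub_barycentre` each vertex other than `a` occurs once, and `b`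
once more. -/
lemma linear_sub_eq_opposite (hn : 1 ≤ n) (h : IsSplitOf T T₀) (hS : S ∈ T₀.cells) {a b c : Pt n}
    (hb : b ∈ S) (ha : a ∈ S) (hba : b ≠ a) (hc : c ∈ S) (hca : c ≠ a) :
    (baryCoord (subcell S a) c).linear (b - a) = 1 + if c = b then 1 else 0 := by
  have sS := Mesh.isSimplex hS
  have sK := Mesh.isSimplex (subcell_mem h hS ha)
  have hz := barycentre_notMem hn sS
  have hmem : ∀ d ∈ S, d ≠ a → d ∈ subcell S a := fun d hd hda => (mem_subcell_iff hn sS hd).2 hda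
  have hcz : c ≠ barycentre S := fun e => hz (e ▸ hc)
  rw [sub_eq_sum_sub_barycentre sS ha b, map_add, map_sum,
    Finset.sum_congr rfl fun d hd => baryCoord_linear sK (barycentre_mem_subcell S a)
      (hmem d (Finset.mem_of_mem_erase hd) (Finset.ne_of_mem_erase hd)),
    baryCoord_linear sK (barycentre_mem_subcell S a) (hmem b hb hba)]
  simp [hcz, hca, hc]

/-- Each of the n + 1 vectors in the decomposition lowers this coordinate by one. The sign, opposite
to that in `linear_sub_eq_opposite`, is what keeps the recursion of `bern_pos_multiple` positive. -/
lemma linear_sub_eq_opposite_barycentre (hn : 1 ≤ n) (h : IsSplitOf T T₀) (hS : S ∈ T₀.cells)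
    {a b : Pt n} (hb : b ∈ S) (ha : a ∈ S) (hba : b ≠ a) :
    (baryCoord (subcell S a) (barycentre S)).linear (b - a) = -((n : ℝ) + 1) := by
  have sS := Mesh.isSimplex hS
  have sK := Mesh.isSimplex (subcell_mem h hS ha)
  have hmem : ∀ d ∈ S, d ≠ a → d ∈ subcell S a := fun d hd hda => (mem_subcell_iff hn sS hd).2 hda
  have hne : ∀ d ∈ S, barycentre S ≠ d := fun d hd => barycentre_ne hn sS hd
  rw [sub_eq_sum_sub_barycentre sS ha b, map_add, map_sum,
    Finset.sum_congr rfl fun d hd => (baryCoord_linear sK (barycentre_mem_subcell S a)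
      (hmem d (Finset.mem_of_mem_erase hd) (Finset.ne_of_mem_erase hd))).trans
      (by rw [if_neg (hne d (Finset.mem_of_mem_erase hd)), if_pos rfl]),
    baryCoord_linear sK (barycentre_mem_subcell S a) (hmem b hb hba), if_neg (hne b hb), if_pos rfl,
    Finset.sum_const, Finset.card_erase_of_mem ha, sS.1]
  simp
  ring

end Macro

/-! ### Divergence-free test stresses with controlled normal traces -/

section CurlTest

variable {n : ℕ} {Ω : Set (Pt n)} {T : Mesh n Ω} {K L F : Finset (Pt n)}

lemma dirD_neg (t : Pt n) (p : Poly n) : dirD (-t) p = -dirD t p := by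
  simp [dirD_apply]

/-- `p` and `q`, and their derivatives tangential to the facet of `K` opposite to `a`, agree on that
facet. -/
def AgreeOnFacet (K : Finset (Pt n)) (a : Pt n) (p q : Poly n) : Prop :=
  ∀ x ∈ hull (K.erase a), ev p x = ev q x ∧
    ∀ t, (baryCoord K a).linear t = 0 → ev (dirD t p) x = ev (dirD t q) x

lemma AgreeOnFacet.mul {a : Pt n} {p p' q q' : Poly n} (h : AgreeOnFacet K a p q)
    (h' : AgreeOnFacet K a p' q') : AgreeOnFacet K a (p * p') (q * q') := fun x hx => by
  refine ⟨by rw [ev_mul, ev_mul, (h x hx).1, (h' x hx).1], fun t ht => ?_⟩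
  simp only [Derivation.leibniz, smul_eq_mul, ev_add, ev_mul, (h x hx).1, (h' x hx).1,
    (h x hx).2 t ht, (h' x hx).2 t ht]

/-- The difference is a multiple of the coordinate at `a`, whose tangential derivatives vanish. -/
lemma agreeOnFacet_affinePoly (hK : IsSimplex K) {a : Pt n} {f g : Pt n →ᵃ[ℝ] ℝ}
    (h : ∀ c ∈ K.erase a, f c = g c) : AgreeOnFacet K a (affinePoly f) (affinePoly g) := by
  intro x hx
  refine ⟨?_, fun t ht => ?_⟩
  · have := affineMap_zero_on_hull (f := f - g) (A := (K.erase a : Finset (Pt n)))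
      (fun c hc => by simp [h c (Finset.mem_coe.1 hc)]) hx
    rw [ev_affinePoly, ev_affinePoly]
    simpa [sub_eq_zero] using this
  · have := affineMap_eq_smul_baryCoord hK (f := f - g) (a := a) (fun c hc => by simp [h c hc])
    have h2 := congrArg (fun f : Pt n →ᵃ[ℝ] ℝ => f.linear t) this
    rw [dirD_affinePoly, dirD_affinePoly, ev_C, ev_C]
    simpa [ht, sub_eq_zero] using h2

lemma agreeOnFacet_bern (hK : IsSimplex K) (hL : IsSimplex L) {a : Pt n} (h : K.erase a ⊆ L)
    (B : Multiset (Pt n)) : AgreeOnFacet K a (bern K B) (bern L B) := by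
  induction B using Multiset.induction with
  | empty => intro x _; simp
  | cons c B ih =>
    rw [bern_cons, bern_cons]
    refine AgreeOnFacet.mul (agreeOnFacet_affinePoly hK fun d hd => ?_) ih
    rw [baryCoord_vertex hK (Finset.mem_of_mem_erase hd), baryCoord_vertex hL (h hd)]

lemma agreeOnFacet_bern_zero (hK : IsSimplex K) {a c : Pt n} {B : Multiset (Pt n)} (hc : c ∈ B)
    (h : c ∉ K.erase a) : AgreeOnFacet K a (bern K B) 0 := by
  have h0 : affinePoly (0 : Pt n →ᵃ[ℝ] ℝ) = 0 := by simp [affinePoly]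
  rw [bern_eq_hat_mul hc, ← zero_mul (bern K (B.erase c)), ← h0]
  refine AgreeOnFacet.mul (agreeOnFacet_affinePoly hK fun d hd => ?_) fun x _ => ⟨rfl, fun _ _ => rfl⟩
  rw [baryCoord_vertex hK (Finset.mem_of_mem_erase hd), if_neg (by rintro rfl; exact h hd)]
  rfl

/-- The matrix field with rows `Σ_l C i j l ∂_l φ`. -/
def curlField (C : Fin n → Fin n → Fin n → ℝ) (φ : Poly n) : Matrix (Fin n) (Fin n) (Poly n) :=
  fun i j => ∑ l, C i j l • MvPolynomial.pderiv l φ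

lemma sum_antisymm_eq_zero {M : Type*} [AddCommGroup M] [Module ℝ M] {f : Fin n → Fin n → M}
    (h : ∀ i j, f i j = -f j i) : ∑ i, ∑ j, f i j = 0 := by
  have h1 : ∑ i, ∑ j, f i j = -∑ i, ∑ j, f i j := by
    conv_lhs => rw [Finset.sum_comm]
    rw [← Finset.sum_neg_distrib]
    refine Finset.sum_congr rfl fun i _ => ?_
    rw [← Finset.sum_neg_distrib]
    exact Finset.sum_congr rfl fun j _ => h j i
  have h2 : (2 : ℝ) • ∑ i, ∑ j, f i j = 0 := by
    rw [two_smul]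
    nth_rewrite 1 [h1]
    exact neg_add_cancel _
  simpa using h2

lemma pderiv_comm (i j : Fin n) (p : Poly n) :
    MvPolynomial.pderiv i (MvPolynomial.pderiv j p) =
      MvPolynomial.pderiv j (MvPolynomial.pderiv i p) := by
  have : ⁅(MvPolynomial.pderiv i : Derivation ℝ (Poly n) (Poly n)),
      (MvPolynomial.pderiv j : Derivation ℝ (Poly n) (Poly n))⁆ = 0 := by
    refine MvPolynomial.derivation_ext fun l => ?_
    simp [Derivation.commutator_apply, MvPolynomial.pderiv_X, Pi.single_apply, apply_ite]
  have h := congrArg (fun D : Derivation ℝ (Poly n) (Poly n) => D p) this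
  rw [← sub_eq_zero]
  simpa [Derivation.commutator_apply] using h

/-- Coefficients antisymmetric in the last two indices are contracted with symmetric second
derivatives. -/
lemma divRow_curlField {C : Fin n → Fin n → Fin n → ℝ} (hC : ∀ i j l, C i j l = -C i l j)
    (φ : Poly n) : divRow (curlField C φ) = 0 := by
  funext i
  simp only [divRow, curlField, map_sum]
  exact sum_antisymm_eq_zero fun j l => by
    rw [Derivation.map_smul, Derivation.map_smul, hC i j l, pderiv_comm, neg_smul]

lemma inner_eq_sum (x y : Pt n) : inner ℝ x y = ∑ j, x j * y j := by
  simp [PiLp.inner_apply, mul_comm]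

lemma curlField_mulVec (C : Fin n → Fin n → Fin n → ℝ) (φ : Poly n) (i : Fin n) (ν x : Pt n) :
    ∑ j, ev (curlField C φ i j) x * ν j =
      ev (dirD (WithLp.toLp 2 fun l => ∑ j, C i j l * ν j) φ) x := by
  simp only [curlField, dirD_apply, ev_sum, ev_smul, Finset.sum_mul]
  rw [Finset.sum_comm]
  exact Finset.sum_congr rfl fun l _ => Finset.sum_congr rfl fun j _ => by ring

/-- By antisymmetry the vector is orthogonal to the normal. Hence the normal trace of `curlField`
only involves tangential derivatives of the potential. -/
lemma curlField_tangential (hn : 1 ≤ n) (hK : IsSimplex K) {a : Pt n} (ha : a ∈ K)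
    {C : Fin n → Fin n → Fin n → ℝ} (hC : ∀ i j l, C i j l = -C i l j) (i : Fin n) :
    (baryCoord K a).linear
      (WithLp.toLp 2 fun l => ∑ j, C i j l * outwardNormal K (K.erase a) j) = 0 := by
  obtain ⟨-, s, hs, h⟩ := outwardNormal_spec hn hK ha
  have h1 := h (WithLp.toLp 2 fun l => ∑ j, C i j l * outwardNormal K (K.erase a) j)
  rw [inner_eq_sum] at h1
  simp only [Finset.mul_sum] at h1
  rw [sum_antisymm_eq_zero fun l j => by rw [hC]; ring] at h1
  exact (mul_eq_zero.1 h1.symm).resolve_left hs.ne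

lemma bdryInner_eq_sum_facet (μ : T.Facet → Pt n → Fin n → ℝ)
    (v : T.Cell → Matrix (Fin n) (Fin n) (Poly n)) :
    bdryInner T μ v = ∑ F : T.Facet, ∑ K : T.Cell with F.1 ⊆ K.1,
      ∫ x in hull F.1, ∑ i, μ F x i * ∑ j, ev (v K i j) x * outwardNormal K.1 F.1 j ∂(surf n) := by
  rw [bdryInner]
  exact Finset.sum_comm' (by simp)

/-- The multiset `B` of vertices defines a product of hat functions that vanishes on those boundary
facets which do not belong to `Γ₀`. -/
def Admissible (T : Mesh n Ω) (Γ₀ : Set (Pt n)) (B : Multiset (Pt n)) : Prop :=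
  ∀ F ∈ T.facets, LiesIn F Γ₀ ∨ (∃ c ∈ B, c ∉ F) ∨
    ∃ K ∈ T.cells, ∃ L ∈ T.cells, K ≠ L ∧ F ⊆ K ∧ F ⊆ L

/-- Facet by facet: the multiplier vanishes on Γ₀; on a facet missing a vertex of `B` the potential
and its tangential derivatives vanish; on a facet shared by two cells the tangential derivatives
agree while the normals are opposite, so the two contributions cancel. -/
lemma bdryInner_curlField (hn : 1 ≤ n) {Γ₀ : Set (Pt n)} {B : Multiset (Pt n)}
    (hB : Admissible T Γ₀ B) {μ : T.Facet → Pt n → Fin n → ℝ}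
    (hμ : ∀ F : T.Facet, LiesIn F.1 Γ₀ → μ F = 0)
    {C : Fin n → Fin n → Fin n → ℝ} (hC : ∀ i j l, C i j l = -C i l j) :
    bdryInner T μ (fun K => curlField C (bern K.1 B)) = 0 := by
  rw [bdryInner_eq_sum_facet]
  refine Finset.sum_eq_zero fun F _ => ?_
  obtain ⟨K₀, hK₀, hFK₀, hFc⟩ := Mesh.mem_facets.1 F.2
  have hmeas : MeasurableSet (hull F.1) := (isCompact_hull F.1).measurableSet
  rcases hB F.1 F.2 with h | ⟨c, hcB, hcF⟩ | ⟨K, hK, L, hL, hKL, hFK, hFL⟩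
  · simp [hμ F h]
  · refine Finset.sum_eq_zero fun K hK => ?_
    have hFK : F.1 ⊆ K.1 := (Finset.mem_filter.1 hK).2
    have sK := Mesh.isSimplex K.2
    obtain ⟨a, ha, hF⟩ := exists_eq_erase sK hFK hFc
    rw [setIntegral_congr_fun (g := 0) hmeas, Pi.zero_def, integral_zero]
    intro x hx
    refine Finset.sum_eq_zero fun i _ => ?_
    simp only [curlField_mulVec]
    rw [hF] at hx hcF ⊢
    rw [((agreeOnFacet_bern_zero sK hcB hcF) x hx).2 _ (curlField_tangential hn sK ha hC i)]
    simp
  · have hfilter : (Finset.univ.filter fun M : T.Cell => F.1 ⊆ M.1) =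
        {(⟨K, hK⟩ : T.Cell), ⟨L, hL⟩} := by
      ext M
      simp only [Finset.mem_filter, Finset.mem_univ, true_and, Finset.mem_insert,
        Finset.mem_singleton, Subtype.ext_iff]
      constructor
      · exact fun h => Mesh.eq_or_eq_of_facet hn hK hL M.2 hKL hFc hFK hFL h
      · rintro (h | h) <;> rw [h] <;> assumption
    rw [hfilter, Finset.sum_pair (by simpa [Subtype.ext_iff] using hKL), ← sub_neg_eq_add,
      sub_eq_zero, ← integral_neg]
    refine setIntegral_congr_fun hmeas fun x hx => ?_
    have sK := Mesh.isSimplex hK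
    have sL := Mesh.isSimplex hL
    obtain ⟨a, ha, hF⟩ := exists_eq_erase sK hFK hFc
    have hν := Mesh.outwardNormal_neg hn hK hL hKL hFc hFK hFL
    simp only
    rw [← Finset.sum_neg_distrib]
    refine Finset.sum_congr rfl fun i _ => ?_
    simp only [curlField_mulVec]
    rw [← mul_neg]
    congr 1
    have e : (WithLp.toLp 2 fun l => ∑ j, C i j l * outwardNormal L F.1 j : Pt n) =
        -WithLp.toLp 2 fun l => ∑ j, C i j l * outwardNormal K F.1 j := by
      ext l
      simp [hν]
    rw [e, dirD_neg, ev_neg, neg_neg]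
    rw [hF] at hx hFL ⊢
    exact ((agreeOnFacet_bern sK sL hFL B) x hx).2 _ (curlField_tangential hn sK ha hC i)

/-- The coefficients for which `curlField` tests the entry `(p, q)` of a skew-symmetric matrix
against the derivative in the direction `t`. -/
def skewCoeff (p q : Fin n) (t : Pt n) (i j l : Fin n) : ℝ :=
  let e : Fin n → Fin n → ℝ := fun i j =>
    (if i = p then 1 else 0) * (if j = q then 1 else 0) -
      (if i = q then 1 else 0) * (if j = p then 1 else 0)
  2⁻¹ * (e i j * t l - e j l * t i + e l i * t j)

lemma skewCoeff_antisymm (p q : Fin n) (t : Pt n) (i j l : Fin n) :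
    skewCoeff p q t i j l = -skewCoeff p q t i l j := by
  simp only [skewCoeff]
  ring

/-- As in Koszul's formula, a tensor antisymmetric in its first two indices is completed to one
antisymmetric in the last two by terms symmetric in the first two. A skew matrix does not see those
terms. This isolates single entries in every dimension at once. -/
lemma sum_skew_mul_skewCoeff {R : Fin n → Fin n → ℝ} (hR : ∀ i j, R i j + R j i = 0)
    (p q : Fin n) (t : Pt n) (l : Fin n) :
    ∑ i, ∑ j, R i j * skewCoeff p q t i j l = R p q * t l := by
  set e : Fin n → Fin n → ℝ := fun i j =>
    (if i = p then 1 else 0) * (if j = q then 1 else 0) -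
      (if i = q then 1 else 0) * (if j = p then 1 else 0) with he
  have hR' : ∀ i j, R j i = -R i j := fun i j => by linarith [hR i j]
  have h1 : ∑ i, ∑ j, R i j * e i j = 2 * R p q := by
    simp only [he, mul_sub, Finset.sum_sub_distrib]
    simp only [mul_ite, mul_one, mul_zero, Finset.sum_ite_eq', Finset.mem_univ, if_true]
    rw [hR' p q]
    ring
  have h2 : ∑ i, ∑ j, R i j * (e l i * t j - e j l * t i) = 0 :=
    sum_antisymm_eq_zero fun i j => by
      rw [hR' j i]
      simp only [he]
      ring
  have h3 : ∀ i j, R i j * skewCoeff p q t i j l =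
      2⁻¹ * t l * (R i j * e i j) + 2⁻¹ * (R i j * (e l i * t j - e j l * t i)) := fun i j => by
    simp only [skewCoeff, he]
    ring
  simp only [h3, Finset.sum_add_distrib, ← Finset.mul_sum, h1, h2]
  ring

lemma sum_skew_mul_curlField {ρ : Matrix (Fin n) (Fin n) (Poly n)}
    (hρ : ∀ i j, ρ i j + ρ j i = 0) (p q : Fin n) (t : Pt n) (φ : Poly n) (x : Pt n) :
    ∑ i, ∑ j, ev (ρ i j) x * ev (curlField (skewCoeff p q t) φ i j) x =
      ev (ρ p q) x * ev (dirD t φ) x := by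
  have hR : ∀ i j, ev (ρ i j) x + ev (ρ j i) x = 0 := fun i j => by rw [← ev_add, hρ, ev_zero]
  simp only [curlField, ev_sum, ev_smul, dirD_apply, Finset.mul_sum]
  rw [Finset.sum_congr rfl fun i _ => Finset.sum_comm, Finset.sum_comm]
  refine Finset.sum_congr rfl fun l _ => ?_
  rw [← mul_assoc, ← sum_skew_mul_skewCoeff hR p q t l, Finset.sum_mul]
  refine Finset.sum_congr rfl fun i _ => ?_
  rw [Finset.sum_mul]
  exact Finset.sum_congr rfl fun j _ => by ring

variable {k : ℕ} {Γ₀ : Set (Pt n)}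

/-- The functional on stresses given by a displacement, a rotation and a multiplier vanishes. -/
def InKernel (T : Mesh n Ω) (k : ℕ) (u : T.Cell → Fin n → Poly n)
    (ρ : T.Cell → Matrix (Fin n) (Fin n) (Poly n)) (γ : T.Facet → Pt n → Fin n → ℝ) : Prop :=
  ∀ v ∈ Vh T k, vecInner T u (divh T v) + matInner T ρ v + bdryInner T γ v = 0

/-- Stresses have degree k + 1, which leaves room for potentials of degree k + 2. -/
lemma curlField_mem {C : Fin n → Fin n → Fin n → ℝ} {B : Multiset (Pt n)} (hB : B.card = k + 2) :
    (fun K : T.Cell => curlField C (bern K.1 B)) ∈ Vh T k := fun K i j =>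
  Submodule.sum_mem _ fun l _ => Submodule.smul_mem _ _ (pderiv_mem_polyLE l (by
    rw [show k + 1 + 1 = B.card by rw [hB]]
    exact bern_mem _ _))

/-- The curl test removes displacement and multiplier, leaving a scalar relation for each entry of
the rotation. -/
lemma InKernel.sum_integral_eq_zero (hn : 1 ≤ n) {u : T.Cell → Fin n → Poly n}
    {ρ : T.Cell → Matrix (Fin n) (Fin n) (Poly n)} {γ : T.Facet → Pt n → Fin n → ℝ}
    (h : InKernel T k u ρ γ) (hρ : ρ ∈ Ah T k) (hγ : γ ∈ Mh T k Γ₀)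
    {B : Multiset (Pt n)} (hB : B.card = k + 2) (hBadm : Admissible T Γ₀ B) (p q : Fin n)
    (t : Pt n) :
    ∑ K : T.Cell, ∫ x in hull K.1, ev (ρ K p q) x * ev (dirD t (bern K.1 B)) x = 0 := by
  have h1 := h _ (curlField_mem (T := T) (C := skewCoeff p q t) hB)
  rw [bdryInner_curlField hn hBadm hγ.2 (skewCoeff_antisymm p q t), add_zero] at h1
  have h2 : divh T (fun K : T.Cell => curlField (skewCoeff p q t) (bern K.1 B)) = 0 := by
    funext K
    exact divRow_curlField (skewCoeff_antisymm p q t) _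
  rw [h2, show vecInner T u 0 = 0 by simp [vecInner], zero_add] at h1
  rw [← h1, matInner]
  exact Finset.sum_congr rfl fun K _ => by
    simp only [sum_skew_mul_curlField (hρ.2 K)]

end CurlTest

/-! ### The macroelement argument: moments on a split simplex and their propagation -/

section MacroArgument

variable {n : ℕ} {Ω : Set (Pt n)} {T T₀ : Mesh n Ω} {K S S' F : Finset (Pt n)} {Γ₀ : Set (Pt n)}

lemma sum_map_ite_smul_eq {V : Type*} [AddCommGroup V] [Module ℝ V] (b : Pt n)
    (f : Pt n → V) (B : Multiset (Pt n)) :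
    (B.map fun c => (if c = b then (1 : ℝ) else 0) • f c).sum = (B.count b : ℝ) • f b := by
  induction B using Multiset.induction with
  | empty => simp
  | cons c B ih =>
    rw [Multiset.map_cons, Multiset.sum_cons, ih, Multiset.count_cons]
    by_cases e : c = b
    · subst e; simp [add_smul, add_comm]
    · simp [e, Ne.symm e]

/-- The derivative of a product of barycentric coordinates along the edge from `a` to `b`. -/
lemma dirD_edge_bern (hK : IsSimplex K) {a b : Pt n} (ha : a ∈ K) (hb : b ∈ K)
    (B : Multiset (Pt n)) :
    dirD (b - a) (bern K B) =
      (B.count b : ℝ) • bern K (B.erase b) - (B.count a : ℝ) • bern K (B.erase a) := by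
  rw [dirD_bern, ← sum_map_ite_smul_eq b (fun c => bern K (B.erase c)),
    ← sum_map_ite_smul_eq a (fun c => bern K (B.erase c)), ← Multiset.sum_map_sub]
  exact congrArg _ (Multiset.map_congr rfl fun c _ => by rw [baryCoord_linear hK ha hb, sub_smul])

/-- The nonnegative multiples of `κ`. -/
def nonnegMul (κ : ℝ) : AddSubmonoid ℝ where
  carrier := {x | ∃ C : ℝ, 0 ≤ C ∧ x = C * κ}
  add_mem' := by
    rintro _ _ ⟨C, hC, rfl⟩ ⟨D, hD, rfl⟩
    exact ⟨C + D, add_nonneg hC hD, by ring⟩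
  zero_mem' := ⟨0, le_rfl, by ring⟩

lemma mul_mem_nonnegMul {κ x r : ℝ} (hr : 0 ≤ r) (h : x ∈ nonnegMul κ) : r * x ∈ nonnegMul κ := by
  obtain ⟨C, hC, rfl⟩ := h
  exact ⟨r * C, mul_nonneg hr hC, by ring⟩

/-- A family of functionals on the cells that annihilates the derivatives of the admissible
products of hat functions of degree `d`. -/
def AnnihilatesDerivatives (T : Mesh n Ω) (Γ₀ : Set (Pt n)) (d : ℕ)
    (ℓ : Finset (Pt n) → Poly n →ₗ[ℝ] ℝ) : Prop :=
  ∀ B : Multiset (Pt n), B.card = d → Admissible T Γ₀ B → ∀ t,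
    ∑ K ∈ T.cells, ℓ K (dirD t (bern K B)) = 0

variable {ℓ : Finset (Pt n) → Poly n →ₗ[ℝ] ℝ} {m : ℕ}

/-- A product containing the hat function at the barycentre is a bubble on the macro simplex: facets
through the barycentre are inner, and on all others it vanishes. -/
lemma admissible_of_barycentre_mem (hn : 1 ≤ n) (h : IsSplitOf T T₀) (hS : S ∈ T₀.cells)
    {B : Multiset (Pt n)} (hz : barycentre S ∈ B) : Admissible T Γ₀ B := by
  intro F hF
  obtain ⟨K, hK, hFK, hFc⟩ := Mesh.mem_facets.1 hF
  by_cases hzF : barycentre S ∈ F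
  · right; right
    obtain ⟨a, ha, rfl⟩ := exists_eq_subcell h hS hK (hFK hzF)
    obtain ⟨b, hb, hba, hFb⟩ := exists_two_subcells h hS ha hFK hFc hzF
    exact ⟨_, hK, _, subcell_mem h hS hb,
      fun e => hba (subcell_injOn hn (Mesh.isSimplex hS) hb e).symm, hFK, hFb⟩
  · exact Or.inr (Or.inl ⟨_, hz, hzF⟩)

lemma sum_subcell_eq_zero (hn : 1 ≤ n) (h : IsSplitOf T T₀) (hℓ : AnnihilatesDerivatives T Γ₀ m ℓ)
    (hS : S ∈ T₀.cells) {B : Multiset (Pt n)} (hB : B.card = m) (hz : barycentre S ∈ B) (t : Pt n) :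
    ∑ i ∈ S, ℓ (subcell S i) (dirD t (bern (subcell S i) B)) = 0 := by
  rw [← hℓ B hB (admissible_of_barycentre_mem hn h hS hz) t,
    ← Finset.sum_image (s := S) (g := subcell S) (f := fun K => ℓ K (dirD t (bern K B)))
      fun i _ j hj e => subcell_injOn hn (Mesh.isSimplex hS) hj e]
  refine Finset.sum_subset (fun K hK => ?_) fun K hK hKS => ?_
  · obtain ⟨i, hi, rfl⟩ := Finset.mem_image.1 hK
    exact subcell_mem h hS hi
  · rw [bern_of_notMem hz fun hzK => hKS ?_, map_zero, map_zero]
    obtain ⟨a, ha, rfl⟩ := exists_eq_subcell h hS hK hzK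
    exact Finset.mem_image_of_mem _ ha

/-- Along the edge from `a` to `b` the hat function at the barycentre changes only on the parts
opposite to `a` and to `b`, with opposite slopes. Differentiating its power of exponent m + 1
compares the two moments. -/
lemma baryPower_eq (hn : 1 ≤ n) (h : IsSplitOf T T₀)
    (hℓ : AnnihilatesDerivatives T Γ₀ (m + 1) ℓ) (hS : S ∈ T₀.cells) {a b : Pt n}
    (ha : a ∈ S) (hb : b ∈ S) :
    ℓ (subcell S a) (bern (subcell S a) (Multiset.replicate m (barycentre S))) =
      ℓ (subcell S b) (bern (subcell S b) (Multiset.replicate m (barycentre S))) := by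
  rcases eq_or_ne a b with rfl | hab
  · rfl
  have sS := Mesh.isSimplex hS
  set z := barycentre S
  have hzS : ∀ d ∈ S, z ≠ d := fun d hd => barycentre_ne hn sS hd
  have hsum := sum_subcell_eq_zero hn h hℓ hS (B := Multiset.replicate (m + 1) z) (by simp)
    (by simp [z]) (b - a)
  have hD : ∀ i, dirD (b - a) (bern (subcell S i) (Multiset.replicate (m + 1) z)) =
      ((m + 1 : ℝ) * (baryCoord (subcell S i) z).linear (b - a)) •
        bern (subcell S i) (Multiset.replicate m z) := fun i => by
    rw [dirD_bern, Multiset.map_replicate, Multiset.sum_replicate, Multiset.replicate_succ,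
      Multiset.erase_cons_head, ← Nat.cast_smul_eq_nsmul ℝ, smul_smul]
    push_cast
    rfl
  simp only [hD, map_smul, smul_eq_mul] at hsum
  rw [← Finset.add_sum_erase _ _ ha, ← Finset.add_sum_erase _ _
    (Finset.mem_erase.2 ⟨hab.symm, hb⟩), Finset.sum_eq_zero fun i hi => ?_,
    linear_sub_eq_opposite_barycentre hn h hS hb ha hab.symm,
    show b - a = -(a - b) by abel, map_neg,
    linear_sub_eq_opposite_barycentre hn h hS ha hb hab] at hsum
  · have h1 : ((m : ℝ) + 1) * ((n : ℝ) + 1) ≠ 0 := by positivity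
    refine mul_left_cancel₀ h1 ?_
    linear_combination -hsum
  · rw [Finset.mem_erase, Finset.mem_erase] at hi
    rw [linear_sub_eq hn h hS hb ha hi.2.2 hi.2.1 hi.1, if_neg (hzS b hb), if_neg (hzS a ha)]
    simp

/-- On a split simplex, the functional takes values at the products of `m` barycentric coordinates
that are positive multiples of one number. -/
lemma bern_pos_multiple (hn : 1 ≤ n) (h : IsSplitOf T T₀)
    (hℓ : AnnihilatesDerivatives T Γ₀ (m + 1) ℓ) (hS : S ∈ T₀.cells) {κ : ℝ}
    (hκ : ∀ a ∈ S, ℓ (subcell S a) (bern (subcell S a) (Multiset.replicate m (barycentre S))) = κ)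
    (s : ℕ) : ∀ a ∈ S, ∀ A : Multiset (Pt n), A.card = s → (∀ c ∈ A, c ∈ S ∧ c ≠ a) →
      ∀ j, j + s = m → ∃ C : ℝ, 0 < C ∧
        ℓ (subcell S a) (bern (subcell S a) (Multiset.replicate j (barycentre S) + A)) = C * κ := by
  have sS := Mesh.isSimplex hS
  set z := barycentre S
  have hzS : ∀ d ∈ S, z ≠ d := fun d hd => barycentre_ne hn sS hd
  induction s with
  | zero =>
    intro a ha A hA _ j hj
    rw [Multiset.card_eq_zero.1 hA, add_zero, show j = m by omega, hκ a ha]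
    exact ⟨1, one_pos, (one_mul κ).symm⟩
  | succ s ih =>
    intro a ha A hA hAS j hj
    obtain ⟨b, hbA⟩ := Multiset.card_pos_iff_exists_mem.1 (by omega : 0 < A.card)
    obtain ⟨hb, hba⟩ := hAS b hbA
    -- One extra barycentre factor compensates for the degree lost in differentiation. On the part
    -- opposite to `a`, the term in which this factor is differentiated is the wanted moment; every
    -- other term that survives on any part has one vertex factor fewer.
    have hsum := sum_subcell_eq_zero hn h hℓ hS
      (B := Multiset.replicate (j + 1) z + A) (by simp [hA]; omega) (by simp [z]) (b - a)
    have herase : ∀ c ∈ A, (Multiset.replicate (j + 1) z + A).erase c =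
        Multiset.replicate (j + 1) z + A.erase c := fun c hc =>
      Multiset.erase_add_right_pos _ hc
    have herase_z : (Multiset.replicate (j + 1) z + A).erase z = Multiset.replicate j z + A := by
      rw [Multiset.replicate_succ, Multiset.cons_add, Multiset.erase_cons_head]
    -- the smaller products are covered by the induction hypothesis
    have hval : ∀ i ∈ S, i ∉ A → ∀ c ∈ A, ∃ C : ℝ, 0 < C ∧
        ℓ (subcell S i) (bern (subcell S i) (Multiset.replicate (j + 1) z + A.erase c)) =
          C * κ := fun i hi hiA c hc =>
      ih i hi (A.erase c) (by rw [Multiset.card_erase_of_mem hc, hA]; rfl)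
        (fun d hd => ⟨(hAS d (Multiset.mem_of_mem_erase hd)).1,
          fun e => hiA (e ▸ Multiset.mem_of_mem_erase hd)⟩) (j + 1) (by omega)
    have haA : a ∉ A := fun hmem => (hAS a hmem).2 rfl
    -- On the part opposite to `i` the product vanishes if `i` occurs in it. Otherwise only the
    -- factors at `b` contribute, with positive slope, since `a` is not a factor.
    have hother : ∀ i ∈ S.erase a,
        ℓ (subcell S i) (dirD (b - a) (bern (subcell S i) (Multiset.replicate (j + 1) z + A))) ∈
          nonnegMul κ := by
      intro i hi
      rw [Finset.mem_erase, and_comm] at hi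
      by_cases hiA : i ∈ A
      · rw [bern_of_notMem (Multiset.mem_add.2 (Or.inr hiA)) fun hmem =>
          (mem_subcell_iff hn sS hi.1).1 hmem rfl, map_zero, map_zero]
        exact zero_mem _
      · have hib : i ≠ b := fun e => hiA (e ▸ hbA)
        rw [dirD_edge_bern (Mesh.isSimplex (subcell_mem h hS hi.1))
          ((mem_subcell_iff hn sS ha).2 (Ne.symm hi.2)) ((mem_subcell_iff hn sS hb).2 hib.symm),
          herase b hbA, Multiset.count_add, Multiset.count_add,
          Multiset.count_eq_zero.2 haA, Multiset.count_eq_zero.2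
          (fun hmem => hzS a ha (Multiset.eq_of_mem_replicate hmem).symm), map_sub, map_smul]
        obtain ⟨C, hC, e⟩ := hval i hi.1 hiA b hbA
        rw [e]
        simp only [Nat.cast_add, Nat.cast_zero, add_zero, zero_smul, map_zero, sub_zero,
          smul_eq_mul]
        exact mul_mem_nonnegMul (by positivity) ⟨C, hC.le, rfl⟩
    -- All vertex factors have positive slope here, and the barycentre factors have slope -(n + 1).
    -- The presence of `b` in `A` makes the constant strictly positive.
    have hself : ∃ C : ℝ, 0 < C ∧
        ℓ (subcell S a) (dirD (b - a) (bern (subcell S a) (Multiset.replicate (j + 1) z + A))) =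
          C * κ - ((j : ℝ) + 1) * ((n : ℝ) + 1) *
            ℓ (subcell S a) (bern (subcell S a) (Multiset.replicate j z + A)) := by
      have hrest : (A.map fun c => (1 + if c = b then (1 : ℝ) else 0) *
          ℓ (subcell S a) (bern (subcell S a) (Multiset.replicate (j + 1) z + A.erase c))).sum ∈
          {x | ∃ C : ℝ, 0 < C ∧ x = C * κ} := by
        obtain ⟨C, hC, e⟩ := hval a ha haA b hbA
        have hmem : ((A.erase b).map fun c => (1 + if c = b then (1 : ℝ) else 0) *
            ℓ (subcell S a) (bern (subcell S a)
              (Multiset.replicate (j + 1) z + A.erase c))).sum ∈ nonnegMul κ := by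
          refine AddSubmonoid.multiset_sum_mem _ _ fun x hx => ?_
          obtain ⟨c, hc, rfl⟩ := Multiset.mem_map.1 hx
          obtain ⟨C, hC, e⟩ := hval a ha haA c (Multiset.mem_of_mem_erase hc)
          rw [e]
          exact mul_mem_nonnegMul (by positivity) ⟨C, hC.le, rfl⟩
        obtain ⟨D, hD, e'⟩ := hmem
        refine ⟨2 * C + D, by positivity, ?_⟩
        rw [← Multiset.cons_erase hbA, Multiset.map_cons, Multiset.sum_cons,
          Multiset.cons_erase hbA, e', e, if_pos rfl]
        ring
      obtain ⟨C, hC, e⟩ := hrest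
      refine ⟨C, hC, ?_⟩
      rw [← e, dirD_bern, Multiset.map_add, Multiset.sum_add, map_add, Multiset.map_replicate,
        Multiset.sum_replicate, herase_z, linear_sub_eq_opposite_barycentre hn h hS hb ha hba,
        map_multiset_sum, Multiset.map_map, ← Nat.cast_smul_eq_nsmul ℝ, smul_smul, map_smul,
        smul_eq_mul, add_comm, sub_eq_add_neg (Multiset.sum _)]
      congr 1
      · refine congrArg _ (Multiset.map_congr rfl fun c hc => ?_)
        rw [Function.comp_apply, map_smul, smul_eq_mul, herase c hc,
          linear_sub_eq_opposite hn h hS hb ha hba (hAS c hc).1 (hAS c hc).2]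
      · push_cast
        ring
    rw [← Finset.add_sum_erase _ _ ha] at hsum
    obtain ⟨D, hD, e⟩ := AddSubmonoid.sum_mem _ hother
    obtain ⟨C, hC, e'⟩ := hself
    rw [e, e'] at hsum
    have hpos : 0 < ((j : ℝ) + 1) * ((n : ℝ) + 1) := by positivity
    refine ⟨(D + C) / (((j : ℝ) + 1) * ((n : ℝ) + 1)), by positivity, ?_⟩
    rw [div_mul_eq_mul_div, eq_div_iff hpos.ne']
    linear_combination -hsum

/-- If the derivatives of the products of the barycentric coordinates at the vertices of one facet
of `S` are annihilated on the part of `S` at this facet, then the functionals vanish on `S`. -/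
lemma vanishes_of_facet (hn : 1 ≤ n) (hm : n ≤ m + 1) (h : IsSplitOf T T₀)
    (hℓ : AnnihilatesDerivatives T Γ₀ (m + 1) ℓ) (hS : S ∈ T₀.cells) {a : Pt n} (ha : a ∈ S)
    (hfacet : ∀ B : Multiset (Pt n), B.card = m + 1 → (∀ c, c ∈ B ↔ c ∈ S.erase a) → ∀ t,
      ℓ (subcell S a) (dirD t (bern (subcell S a) B)) = 0) :
    ∀ i ∈ S, ∀ p ∈ PolyLE n m, ℓ (subcell S i) p = 0 := by
  have sS := Mesh.isSimplex hS
  set z := barycentre S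
  have hzS : ∀ d ∈ S, z ≠ d := fun d hd => barycentre_ne hn sS hd
  set κ := ℓ (subcell S a) (bern (subcell S a) (Multiset.replicate m z)) with hκdef
  have hκ : ∀ i ∈ S, ℓ (subcell S i) (bern (subcell S i) (Multiset.replicate m z)) = κ :=
    fun i hi => baryPower_eq hn h hℓ hS hi ha
  have hκ0 : κ = 0 := by
    have hFc : (S.erase a).card = n := by rw [Finset.card_erase_of_mem ha, sS.1]; rfl
    obtain ⟨b, hb⟩ : (S.erase a).Nonempty := Finset.card_pos.1 (by omega)
    have hbS := Finset.mem_erase.1 hb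
    -- Every vertex of the facet occurs, so the product lives only on cells containing the facet;
    -- the factor at `b` is repeated to reach degree m + 1. This is where `n ≤ m + 1` enters.
    set B := Multiset.replicate (m + 1 - n) b + (S.erase a).val with hBdef
    have hBmem : ∀ c, c ∈ B ↔ c ∈ S.erase a := fun c => by
      rw [hBdef, Multiset.mem_add, Finset.mem_val]
      refine ⟨?_, Or.inr⟩
      rintro (hc | hc)
      · rwa [Multiset.eq_of_mem_replicate hc]
      · exact hc
    have hBc : B.card = m + 1 := by
      rw [hBdef, Multiset.card_add, Multiset.card_replicate, Finset.card_val, hFc]; omega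
    -- Along this edge of the part only the factor at `b` has nonzero slope, so a single moment
    -- vanishes. It is a positive multiple of κ.
    have h0 := hfacet B hBc hBmem (b - z)
    have hzB : z ∉ B := fun hz => hzS z (Finset.mem_of_mem_erase ((hBmem z).1 hz)) rfl
    have hbB : b ∈ B := (hBmem b).2 hb
    rw [dirD_edge_bern (Mesh.isSimplex (subcell_mem h hS ha)) (barycentre_mem_subcell S a)
      ((mem_subcell_iff hn sS hbS.2).2 hbS.1), Multiset.count_eq_zero.2 hzB, Nat.cast_zero,
      zero_smul, sub_zero, map_smul, smul_eq_mul] at h0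
    have hcount : (B.count b : ℝ) ≠ 0 := by
      exact_mod_cast (Multiset.count_pos.2 hbB).ne'
    obtain ⟨C, hC, e⟩ := bern_pos_multiple hn h hℓ hS hκ m a ha (B.erase b)
      (by rw [Multiset.card_erase_of_mem hbB, hBc]; rfl)
      (fun c hc => (Finset.mem_erase.1 ((hBmem c).1 (Multiset.mem_of_mem_erase hc))).symm)
      0 (by omega)
    rw [Multiset.replicate_zero, zero_add, (mul_eq_zero.1 h0).resolve_left hcount] at e
    exact (mul_eq_zero.1 e.symm).resolve_left hC.ne'
  intro i hi p hp
  refine linearMap_eq_zero_of_bern (Mesh.isSimplex (subcell_mem h hS hi)) _ (fun B hBc hB => ?_) hp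
  set A := B.filter (fun c => ¬ c = z) with hA
  have hsplit : Multiset.replicate (B.count z) z + A = B := by
    rw [← Multiset.filter_eq', hA]
    exact Multiset.filter_add_not (p := fun c => c = z) B
  have hcard := congrArg Multiset.card hsplit
  rw [Multiset.card_add, Multiset.card_replicate] at hcard
  obtain ⟨C, -, e⟩ := bern_pos_multiple hn h hℓ hS hκ A.card i hi A rfl (fun c hc => by
    obtain ⟨hcB, hcz⟩ := Multiset.mem_filter.1 hc
    exact (Finset.mem_erase.1 ((Finset.mem_insert.1 (hB c hcB)).resolve_left hcz)).symm)
    (B.count z) (by omega)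
  rw [hsplit, hκ0, mul_zero] at e
  exact e

lemma sum_eq_of_facet {B : Multiset (Pt n)} (hB : ∀ c ∈ F, c ∈ B)
    {K : Finset (Pt n)} (hK : K ∈ T.cells) (t : Pt n)
    (hother : ∀ L ∈ T.cells, L ≠ K → F ⊆ L → ℓ L (dirD t (bern L B)) = 0) :
    ∑ L ∈ T.cells, ℓ L (dirD t (bern L B)) = ℓ K (dirD t (bern K B)) := by
  refine Finset.sum_eq_single_of_mem K hK fun L hL hLK => ?_
  by_cases hFL : F ⊆ L
  · exact hother L hL hLK hFL
  · obtain ⟨c, hc, hcL⟩ := Finset.not_subset.1 hFL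
    rw [bern_of_notMem (hB c hc) hcL, map_zero, map_zero]

lemma admissible_of_facet (hF : F.card = n) {B : Multiset (Pt n)} (hB : ∀ c ∈ F, c ∈ B)
    (h : LiesIn F Γ₀ ∨ ∃ K ∈ T.cells, ∃ L ∈ T.cells, K ≠ L ∧ F ⊆ K ∧ F ⊆ L) :
    Admissible T Γ₀ B := by
  intro F' hF'
  obtain ⟨-, -, -, hF'c⟩ := Mesh.mem_facets.1 hF'
  by_cases e : F ⊆ F'
  · rw [← Finset.eq_of_subset_of_card_le e (by omega)]
    exact h.imp id Or.inr
  · obtain ⟨c, hc, hcF⟩ := Finset.not_subset.1 e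
    exact Or.inr (Or.inl ⟨c, hB c hc, hcF⟩)

/-- Functionals on the cells of a barycentric split that annihilate the derivatives of the
admissible continuous functions of degree `m + 1` vanish on the polynomials of degree `m`. -/
lemma AnnihilatesDerivatives.eq_zero (hn : 1 ≤ n) (hm : n ≤ m + 1)
    (hΩ_open : IsOpen Ω) (hΩ_conn : IsConnected Ω) (hΩ_reg : interior (closure Ω) = Ω)
    (h : IsSplitOf T T₀) (hℓ : AnnihilatesDerivatives T Γ₀ (m + 1) ℓ)
    (hF₀ : F ∈ T₀.facets) (hF₀b : hull F ⊆ frontier Ω) (hF₀Γ : LiesIn F Γ₀) :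
    ∀ K ∈ T.cells, ∀ p ∈ PolyLE n m, ℓ K p = 0 := by
  have key : ∀ S ∈ T₀.cells, ∀ a ∈ S, ∀ p ∈ PolyLE n m, ℓ (subcell S a) p = 0 := by
    obtain ⟨S₀, hS₀, hFS₀, hFc⟩ := Mesh.mem_facets.1 hF₀
    refine Mesh.facet_induction hΩ_open hΩ_conn hΩ_reg
      (fun S => ∀ a ∈ S, ∀ p ∈ PolyLE n m, ℓ (subcell S a) p = 0) hS₀ ?_ ?_
    · obtain ⟨a, ha, rfl⟩ := exists_eq_erase (Mesh.isSimplex hS₀) hFS₀ hFc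
      refine vanishes_of_facet hn hm h hℓ hS₀ ha fun B hBc hB t => ?_
      rw [← hℓ B hBc (admissible_of_facet hFc (fun c hc => (hB c).2 hc) (Or.inl hF₀Γ)) t]
      -- No second cell contains this facet: its barycentre would be an inner point of the domain.
      refine (sum_eq_of_facet (fun c hc => (hB c).2 hc) (subcell_mem h hS₀ ha) t fun L hL hLK hFL => ?_).symm
      have hFn : (S₀.erase a).Nonempty := Finset.card_pos.1 (by omega)
      have hmem := Mesh.mem_of_two_cells hn hΩ_reg (subcell_mem h hS₀ ha) hL (Ne.symm hLK)
        (Finset.subset_insert _ _) hFL hFc (barycentre_mem_hull hFn)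
        fun c hc => baryCoord_barycentre_facet (Mesh.isSimplex (subcell_mem h hS₀ ha))
          (Finset.subset_insert _ _) hFn hc
      have := hF₀b (barycentre_mem_hull hFn)
      rw [hΩ_open.frontier_eq] at this
      exact absurd hmem this.2
    · intro S hS S' hS' hSS' F hFS hFS' hFc hP
      obtain ⟨a, ha, rfl⟩ := exists_eq_erase (Mesh.isSimplex hS) hFS hFc
      obtain ⟨b, hb, hab⟩ := exists_eq_erase (Mesh.isSimplex hS') hFS' hFc
      have hK := subcell_mem h hS ha
      have hL := subcell_mem h hS' hb
      have hFK : S.erase a ⊆ subcell S a := Finset.subset_insert _ _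
      have hFL : S.erase a ⊆ subcell S' b := hab ▸ Finset.subset_insert _ _
      have hKL : subcell S a ≠ subcell S' b := by
        intro e
        have hz : barycentre S ∈ hull S' := by
          have := barycentre_mem_subcell S a
          rw [e] at this
          rcases Finset.mem_insert.1 this with e' | e'
          · rw [e']; exact interior_subset (barycentre_mem_interior (Mesh.isSimplex hS'))
          · exact subset_convexHull ℝ _ (Finset.mem_of_mem_erase e')
        exact hSS' (Mesh.eq_of_mem_interior hS hS' (barycentre_mem_interior (Mesh.isSimplex hS)) hz)
      refine vanishes_of_facet hn hm h hℓ hS' hb fun B hBc hB t => ?_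
      rw [← hab] at hB
      have hB' : ∀ c ∈ S.erase a, c ∈ B := fun c hc => (hB c).2 hc
      rw [← hℓ B hBc (admissible_of_facet hFc hB'
        (Or.inr ⟨_, hK, _, hL, hKL, hFK, hFL⟩)) t]
      refine (sum_eq_of_facet hB' hL t fun M hM hML hFM => ?_).symm
      rw [(Mesh.eq_or_eq_of_facet hn hK hL hM hKL hFc hFK hFL hFM).resolve_right hML]
      -- The neighbouring part contributes nothing, because the functional already vanishes there on
      -- degree `m`.
      refine hP a ha _ (dirD_mem_polyLE t ?_)
      rw [← hBc]
      exact bern_mem _ _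
  intro K hK
  obtain ⟨S, hS, a, ha, rfl⟩ := (h K).1 hK
  exact key S hS a ha

end MacroArgument

/-! ### Vanishing of rotation, displacement and multiplier -/

section Kernel

variable {n k : ℕ} {Ω : Set (Pt n)} {T T₀ : Mesh n Ω} {F : Finset (Pt n)} {Γ₀ : Set (Pt n)}
  {u : T.Cell → Fin n → Poly n} {ρ : T.Cell → Matrix (Fin n) (Fin n) (Poly n)}
  {γ : T.Facet → Pt n → Fin n → ℝ}

lemma poly_eq_zero_of_integral_sq {K : Finset (Pt n)} (hK : IsSimplex K) {p : Poly n}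
    (h : ∫ x in hull K, ev p x * ev p x = 0) : p = 0 :=
  poly_eq_zero_of_hull hK fun x hx => mul_self_eq_zero.1 <|
    (fullSupport_volume hK).eq_zero (g := fun x => ev p x * ev p x) (by fun_prop)
      (fun y _ => mul_self_nonneg _) h x hx

/-- The rotation vanishes. -/
lemma InKernel.rotation_eq_zero (hn : 1 ≤ n) (hnk : n ≤ k + 2)
    (hΩ_open : IsOpen Ω) (hΩ_conn : IsConnected Ω) (hΩ_reg : interior (closure Ω) = Ω)
    (hT : IsSplitOf T T₀) (hF : F ∈ T₀.facets) (hFb : hull F ⊆ frontier Ω) (hFΓ : LiesIn F Γ₀)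
    (h : InKernel T k u ρ γ) (hρ : ρ ∈ Ah T k) (hγ : γ ∈ Mh T k Γ₀) : ρ = 0 := by
  funext K
  ext1 p q
  set ℓ : Finset (Pt n) → Poly n →ₗ[ℝ] ℝ := fun K =>
    if hK : K ∈ T.cells then polyInt (fullSupport_volume (Mesh.isSimplex hK))
      (continuous_ev (ρ ⟨K, hK⟩ p q)) else 0
  have hℓ : AnnihilatesDerivatives T Γ₀ (k + 1 + 1) ℓ := by
    intro B hB hBadm t
    rw [← h.sum_integral_eq_zero hn hρ hγ hB hBadm p q t, ← Finset.sum_coe_sort]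
    refine Finset.sum_congr rfl fun K _ => ?_
    simp only [ℓ, dif_pos K.2]
    rfl
  have h0 := hℓ.eq_zero hn hnk hΩ_open hΩ_conn hΩ_reg hT hF hFb hFΓ K.1 K.2 _ (hρ.1 K p q)
  simp only [ℓ, dif_pos K.2] at h0
  exact poly_eq_zero_of_integral_sq (Mesh.isSimplex K.2) h0

/-- The stress supported in the cell `K`, with the single nonzero row `φ t` at the index `i`. -/
def rowField (K : T.Cell) (i : Fin n) (φ : Poly n) (t : Pt n) :
    T.Cell → Matrix (Fin n) (Fin n) (Poly n) :=
  fun L i' j => if L = K ∧ i' = i then t j • φ else 0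

lemma rowField_mem {K : T.Cell} {i : Fin n} {φ : Poly n} {t : Pt n} (hφ : φ ∈ PolyLE n (k + 1)) :
    rowField K i φ t ∈ Vh T k := fun L i' j => by
  rw [rowField]
  split_ifs
  · exact Submodule.smul_mem _ _ hφ
  · exact zero_mem _

lemma vecInner_divh_rowField (K : T.Cell) (i : Fin n) (φ : Poly n) (t : Pt n) :
    vecInner T u (divh T (rowField K i φ t)) = ∫ x in hull K.1, ev (u K i) x * ev (dirD t φ) x := by
  have hdiv : ∀ L i', divh T (rowField K i φ t) L i' = if L = K ∧ i' = i then dirD t φ else 0 := by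
    intro L i'
    simp only [divh, divRow, rowField, dirD_apply]
    split_ifs <;> simp
  rw [vecInner, Finset.sum_eq_single_of_mem K (Finset.mem_univ _)]
  · simp only [hdiv, true_and]
    congr 1
    funext x
    rw [Finset.sum_eq_single_of_mem i (Finset.mem_univ _)]
    · simp
    · intro i' _ hi'
      simp [hi']
  · intro L _ hL
    simp [hdiv, hL]

lemma bdryInner_rowField (K : T.Cell) (i : Fin n) (φ : Poly n) (t : Pt n) :
    bdryInner T γ (rowField K i φ t) = ∑ F : T.Facet with F.1 ⊆ K.1,
      ∫ x in hull F.1, γ F x i * (ev φ x * inner ℝ (outwardNormal K.1 F.1) t) ∂(surf n) := by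
  rw [bdryInner, Finset.sum_eq_single_of_mem K (Finset.mem_univ _)]
  · refine Finset.sum_congr rfl fun F _ => ?_
    congr 1
    funext x
    rw [Finset.sum_eq_single_of_mem i (Finset.mem_univ _)]
    · simp only [rowField, true_and, if_true, ev_smul, inner_eq_sum, Finset.mul_sum]
      exact Finset.sum_congr rfl fun j _ => by ring
    · intro i' _ hi'
      simp [rowField, hi']
  · intro L _ hL
    refine Finset.sum_eq_zero fun F _ => ?_
    simp [rowField, hL]

lemma Mesh.erase_mem_facets (K : T.Cell) {a : Pt n} (ha : a ∈ K.1) : K.1.erase a ∈ T.facets :=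
  Mesh.mem_facets.2 ⟨K.1, K.2, Finset.erase_subset _ _, by
    rw [Finset.card_erase_of_mem ha, T.card_cell K.1 K.2]; rfl⟩

lemma bern_zero_on_facet {K : Finset (Pt n)} (hK : IsSimplex K) {c : Pt n} {B : Multiset (Pt n)}
    (hc : c ∈ B) {x : Pt n} (hx : x ∈ hull (K.erase c)) : ev (bern K B) x = 0 := by
  rw [((agreeOnFacet_bern_zero hK hc (by simp)) x hx).1, ev_zero]

/-- Testing with a stress along the edge from `a` to `b` in a single row only sees the facet
opposite to `a`. -/
lemma InKernel.edge_test (hn : 1 ≤ n) (h : InKernel T k u 0 γ) (K : T.Cell) {a b : Pt n}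
    (ha : a ∈ K.1) (hb : b ∈ K.1) (hab : a ≠ b) (i : Fin n) {B : Multiset (Pt n)}
    (hB : B.card = k + 1) (hbB : b ∈ B) :
    ∃ s : ℝ, s ≠ 0 ∧ ∫ x in hull K.1, ev (u K i) x * ev (dirD (b - a) (bern K.1 B)) x =
      s * ∫ x in hull (K.1.erase a),
        γ ⟨K.1.erase a, Mesh.erase_mem_facets K ha⟩ x i * ev (bern K.1 B) x ∂(surf n) := by
  have sK := Mesh.isSimplex K.2
  have hv := h (rowField K i (bern K.1 B) (b - a)) (rowField_mem (by rw [← hB]; exact bern_mem _ _))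
  rw [vecInner_divh_rowField, bdryInner_rowField, show matInner T 0 _ = 0 by simp [matInner],
    add_zero, Finset.sum_eq_single_of_mem (⟨K.1.erase a, Mesh.erase_mem_facets K ha⟩ : T.Facet)
    (Finset.mem_filter.2 ⟨Finset.mem_univ _, Finset.erase_subset _ _⟩)] at hv
  · obtain ⟨-, s, hs, hν⟩ := outwardNormal_spec hn sK ha
    refine ⟨s, hs.ne, ?_⟩
    rw [hν, baryCoord_linear sK ha hb, if_neg hab, if_pos rfl] at hv
    rw [← integral_const_mul, ← sub_eq_zero, ← hv, sub_eq_add_neg, ← integral_neg]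
    congr 2
    funext x
    ring
  · intro F hF hFa
    have hFK : F.1 ⊆ K.1 := (Finset.mem_filter.1 hF).2
    obtain ⟨-, -, -, hFc⟩ := Mesh.mem_facets.1 F.2
    obtain ⟨c, hc, hFe⟩ := exists_eq_erase sK hFK hFc
    have hca : c ≠ a := fun e => hFa (Subtype.ext (by rw [hFe, e]))
    by_cases hcb : c = b
    · subst hcb
      rw [setIntegral_congr_fun (g := 0) (isCompact_hull F.1).measurableSet, Pi.zero_def,
        integral_zero]
      intro x hx
      rw [hFe] at hx
      simp [bern_zero_on_facet sK hbB hx]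
    · obtain ⟨-, s, hs, hν⟩ := outwardNormal_spec hn sK hc
      rw [hFe, hν, baryCoord_linear sK ha hb, if_neg hcb, if_neg hca]
      simp

/-- With no multiplier on the facet opposite to `a`, `InKernel.edge_test` makes each component
orthogonal to the derivatives along an edge from `a` to `b` of products containing `b`. These
derivatives generate all products of degree `k`, by induction on the multiplicity of `a`. -/
lemma InKernel.displacement_eq_zero (hn : 1 ≤ n) (h : InKernel T k u 0 γ) (hu : u ∈ Wh T k)
    (K : T.Cell) {a : Pt n} (ha : a ∈ K.1)
    (hγ : γ ⟨K.1.erase a, Mesh.erase_mem_facets K ha⟩ = 0) : u K = 0 := by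
  have sK := Mesh.isSimplex K.2
  obtain ⟨b, hb⟩ : (K.1.erase a).Nonempty := Finset.card_pos.1 (by
    rw [Finset.card_erase_of_mem ha, sK.1]; omega)
  rw [Finset.mem_erase] at hb
  funext i
  set ℓ := polyInt (fullSupport_volume sK) (continuous_ev (u K i))
  have hcount : ∀ s, ∀ B : Multiset (Pt n), B.count a = s → B.card = k →
      ℓ (bern K.1 B) = 0 := by
    intro s
    induction s with
    | zero =>
      intro B hBa hBk
      obtain ⟨s, -, e⟩ := h.edge_test hn K ha hb.2 hb.1.symm i (B := b ::ₘ B) (by simp [hBk])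
        (by simp)
      rw [hγ] at e
      have e' : ℓ (dirD (b - a) (bern K.1 (b ::ₘ B))) = 0 :=
        e.trans (by simp)
      rw [dirD_edge_bern sK ha hb.2, Multiset.count_cons_of_ne hb.1.symm, hBa,
        Multiset.erase_cons_head, Nat.cast_zero, zero_smul, sub_zero, map_smul,
        Multiset.count_cons_self, smul_eq_mul] at e'
      exact (mul_eq_zero.1 e').resolve_left (by positivity)
    | succ s ih =>
      intro B hBa hBk
      obtain ⟨s, -, e⟩ := h.edge_test hn K ha hb.2 hb.1.symm i (B := b ::ₘ B) (by simp [hBk])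
        (by simp)
      rw [hγ] at e
      have e' : ℓ (dirD (b - a) (bern K.1 (b ::ₘ B))) = 0 :=
        e.trans (by simp)
      have haB : a ∈ B := Multiset.count_pos.1 (by omega)
      rw [dirD_edge_bern sK ha hb.2, Multiset.erase_cons_head, map_sub, map_smul, map_smul,
        Multiset.erase_cons_tail _ hb.1, ih (b ::ₘ B.erase a)
          (by rw [Multiset.count_cons_of_ne hb.1.symm, Multiset.count_erase_self, hBa]; rfl)
          (by
            have := Multiset.card_pos_iff_exists_mem.2 ⟨a, haB⟩
            rw [Multiset.card_cons, Multiset.card_erase_of_mem haB]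
            have h1 := Nat.succ_pred_eq_of_pos this
            omega),
        smul_zero, sub_zero, Multiset.count_cons_self, smul_eq_mul] at e'
      exact (mul_eq_zero.1 e').resolve_left (by positivity)
  have hzero := linearMap_eq_zero_of_bern sK ℓ (fun B hB _ => hcount _ B rfl hB) (hu K i)
  exact poly_eq_zero_of_integral_sq sK hzero

/-- With zero displacement the edge test makes the multiplier orthogonal on the facet to all
products of degree k + 1 in the coordinates of the facet; products containing the opposite vertex
vanish there anyway. The multiplier is then orthogonal to its own polynomial representative. -/
lemma InKernel.multiplier_eq_zero (hn : 1 ≤ n) (h : InKernel T k u 0 γ) (hγ : γ ∈ Mh T k Γ₀)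
    (K : T.Cell) (huK : u K = 0) (F : T.Facet) (hFK : F.1 ⊆ K.1) : γ F = 0 := by
  have sK := Mesh.isSimplex K.2
  obtain ⟨-, -, -, hFc⟩ := Mesh.mem_facets.1 F.2
  obtain ⟨a, ha, hFe⟩ := exists_eq_erase sK hFK hFc
  obtain rfl : F = ⟨K.1.erase a, Mesh.erase_mem_facets K ha⟩ := Subtype.ext hFe
  obtain ⟨p, hp, ep⟩ := hγ.1 ⟨K.1.erase a, Mesh.erase_mem_facets K ha⟩
  have hval : ∀ x ∈ hull (K.1.erase a), ∀ i,
      γ ⟨K.1.erase a, Mesh.erase_mem_facets K ha⟩ x i = ev (p i) x := fun x hx i => by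
    rw [ep, Set.indicator_of_mem hx]
  have hfull := fullSupport_surf hn sK ha
  have hmeas : MeasurableSet (hull (K.1.erase a)) := (isCompact_hull _).measurableSet
  have hzero : ∀ i, ∀ x ∈ hull (K.1.erase a), ev (p i) x = 0 := by
    intro i
    have h0 : polyInt hfull (continuous_ev (p i)) (p i) = 0 := by
      refine linearMap_eq_zero_of_bern sK _ (fun B hB hBK => ?_) (hp i)
      by_cases haB : a ∈ B
      · refine (setIntegral_congr_fun (g := 0) hmeas fun x hx => ?_).trans (by simp)
        simp [bern_zero_on_facet sK haB hx]
      · obtain ⟨b, hbB⟩ := Multiset.card_pos_iff_exists_mem.1 (by omega : 0 < B.card)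
        obtain ⟨s, hs, e⟩ := h.edge_test hn K ha (hBK b hbB) (by rintro rfl; exact haB hbB) i hB hbB
        rw [huK] at e
        have e' := (mul_eq_zero.1 (e.symm.trans (by simp))).resolve_left hs
        rw [← e']
        exact setIntegral_congr_fun hmeas fun x hx => by simp only [hval x hx]
    intro x hx
    exact mul_self_eq_zero.1 (hfull.eq_zero (g := fun x => ev (p i) x * ev (p i) x) (by fun_prop)
      (fun y _ => mul_self_nonneg _) h0 x hx)
  rw [ep]
  funext x i
  by_cases hx : x ∈ hull (K.1.erase a)
  · rw [Set.indicator_of_mem hx, hzero i x hx]; rfl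
  · rw [Set.indicator_of_notMem hx]; rfl

/-- On a barycentric split the functional given by a displacement, a rotation and a multiplier
vanishes on all stresses only if all three vanish. -/
theorem InKernel.eq_zero (hn : 1 ≤ n) (hnk : n ≤ k + 2)
    (hΩ_open : IsOpen Ω) (hΩ_conn : IsConnected Ω) (hΩ_reg : interior (closure Ω) = Ω)
    (hT : IsSplitOf T T₀) (hF : F ∈ T₀.facets) (hFb : hull F ⊆ frontier Ω) (hFΓ : LiesIn F Γ₀)
    (h : InKernel T k u ρ γ) (hu : u ∈ Wh T k) (hρ : ρ ∈ Ah T k) (hγ : γ ∈ Mh T k Γ₀) :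
    u = 0 ∧ ρ = 0 ∧ γ = 0 := by
  obtain rfl := h.rotation_eq_zero hn hnk hΩ_open hΩ_conn hΩ_reg hT hF hFb hFΓ hρ hγ
  obtain ⟨S, hS, hFS, hFc⟩ := Mesh.mem_facets.1 hF
  obtain ⟨a, ha, rfl⟩ := exists_eq_erase (Mesh.isSimplex hS) hFS hFc
  have step : ∀ K : T.Cell, ∀ F : T.Facet, F.1 ⊆ K.1 → γ F = 0 → u K = 0 := by
    intro K F hFK hF0
    obtain ⟨-, -, -, hFc⟩ := Mesh.mem_facets.1 F.2
    obtain ⟨a, ha, hFe⟩ := exists_eq_erase (Mesh.isSimplex K.2) hFK hFc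
    obtain rfl : F = ⟨K.1.erase a, Mesh.erase_mem_facets K ha⟩ := Subtype.ext hFe
    exact h.displacement_eq_zero hn hu K ha hF0
  have hK₀ := subcell_mem hT hS ha
  have hF₀ : S.erase a ∈ T.facets := Mesh.mem_facets.2 ⟨_, hK₀, Finset.subset_insert _ _, hFc⟩
  have key : ∀ K ∈ T.cells, ∀ hK : K ∈ T.cells, u ⟨K, hK⟩ = 0 := by
    refine Mesh.facet_induction hΩ_open hΩ_conn hΩ_reg
      (fun K => ∀ hK : K ∈ T.cells, u ⟨K, hK⟩ = 0) hK₀ (fun hK => ?_) ?_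
    · exact step ⟨_, hK⟩ ⟨_, hF₀⟩ (Finset.subset_insert _ _) (hγ.2 ⟨_, hF₀⟩ hFΓ)
    · intro K hK L hL _ F hFK hFL hFc hP _
      have hFm : F ∈ T.facets := Mesh.mem_facets.2 ⟨K, hK, hFK, hFc⟩
      exact step ⟨L, hL⟩ ⟨F, hFm⟩ hFL
        (h.multiplier_eq_zero hn hγ ⟨K, hK⟩ (hP hK) ⟨F, hFm⟩ hFK)
  refine ⟨funext fun K => key K.1 K.2 K.2, rfl, funext fun F => ?_⟩
  obtain ⟨K, hK, hFK, -⟩ := Mesh.mem_facets.1 F.2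
  exact h.multiplier_eq_zero hn hγ ⟨K, hK⟩ (key K hK hK) F hFK

end Kernel

/-! ### Bilinear forms, positivity of the compliance, and prescribing the divergence -/

section Forms

variable {n k : ℕ} {Ω : Set (Pt n)} {T : Mesh n Ω} {Γ₀ : Set (Pt n)}

/-- The `L²` product of piecewise polynomial matrix fields as a bilinear form. -/
def matForm (T : Mesh n Ω) : (T.Cell → Matrix (Fin n) (Fin n) (Poly n)) →ₗ[ℝ]
    (T.Cell → Matrix (Fin n) (Fin n) (Poly n)) →ₗ[ℝ] ℝ :=
  ∑ K : T.Cell, ∑ i, ∑ j, LinearMap.mk₂ ℝ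
    (fun σ τ => ∫ x in hull K.1, ev (σ K i j) x * ev (τ K i j) x)
    (fun σ σ' τ => by
      rw [← integral_add (integrableOn_hull (Mesh.isSimplex K.2) (by fun_prop))
        (integrableOn_hull (Mesh.isSimplex K.2) (by fun_prop))]
      simp [add_mul])
    (fun c σ τ => by
      rw [smul_eq_mul, ← integral_const_mul]
      simp [mul_assoc])
    (fun σ τ τ' => by
      rw [← integral_add (integrableOn_hull (Mesh.isSimplex K.2) (by fun_prop))
        (integrableOn_hull (Mesh.isSimplex K.2) (by fun_prop))]
      simp [mul_add])
    (fun c σ τ => by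
      rw [smul_eq_mul, ← integral_const_mul]
      simp [mul_left_comm])

lemma matForm_apply (σ τ : T.Cell → Matrix (Fin n) (Fin n) (Poly n)) :
    matForm T σ τ = matInner T σ τ := by
  simp only [matForm, LinearMap.sum_apply, LinearMap.mk₂_apply, matInner]
  refine Finset.sum_congr rfl fun K _ => ?_
  have hint : ∀ i j, IntegrableOn (fun x => ev (σ K i j) x * ev (τ K i j) x) (hull K.1) :=
    fun i j => integrableOn_hull (Mesh.isSimplex K.2) (by fun_prop)
  rw [integral_finsetSum _ fun i _ => integrable_finsetSum _ fun j _ => hint i j]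
  exact Finset.sum_congr rfl fun i _ => (integral_finsetSum _ fun j _ => hint i j).symm

/-- The `L²` product of piecewise polynomial vector fields as a bilinear form. -/
def vecForm (T : Mesh n Ω) : (T.Cell → Fin n → Poly n) →ₗ[ℝ]
    (T.Cell → Fin n → Poly n) →ₗ[ℝ] ℝ :=
  ∑ K : T.Cell, ∑ i, LinearMap.mk₂ ℝ
    (fun u w => ∫ x in hull K.1, ev (u K i) x * ev (w K i) x)
    (fun σ σ' τ => by
      rw [← integral_add (integrableOn_hull (Mesh.isSimplex K.2) (by fun_prop))
        (integrableOn_hull (Mesh.isSimplex K.2) (by fun_prop))]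
      simp [add_mul])
    (fun c σ τ => by
      rw [smul_eq_mul, ← integral_const_mul]
      simp [mul_assoc])
    (fun σ τ τ' => by
      rw [← integral_add (integrableOn_hull (Mesh.isSimplex K.2) (by fun_prop))
        (integrableOn_hull (Mesh.isSimplex K.2) (by fun_prop))]
      simp [mul_add])
    (fun c σ τ => by
      rw [smul_eq_mul, ← integral_const_mul]
      simp [mul_left_comm])

lemma vecForm_apply (u w : T.Cell → Fin n → Poly n) : vecForm T u w = vecInner T u w := by
  simp only [vecForm, LinearMap.sum_apply, LinearMap.mk₂_apply, vecInner]
  refine Finset.sum_congr rfl fun K _ => ?_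
  exact (integral_finsetSum _ fun i _ =>
    integrableOn_hull (Mesh.isSimplex K.2) (by fun_prop)).symm

lemma matInner_comm (σ τ : T.Cell → Matrix (Fin n) (Fin n) (Poly n)) :
    matInner T σ τ = matInner T τ σ := by
  simp only [matInner, mul_comm]

lemma vecInner_comm (u w : T.Cell → Fin n → Poly n) : vecInner T u w = vecInner T w u := by
  simp only [vecInner, mul_comm]

lemma matInner_self_nonneg (σ : T.Cell → Matrix (Fin n) (Fin n) (Poly n)) :
    0 ≤ matInner T σ σ :=
  Finset.sum_nonneg fun _ _ => integral_nonneg fun _ =>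
    Finset.sum_nonneg fun _ _ => Finset.sum_nonneg fun _ _ => mul_self_nonneg _

lemma vecInner_self_nonneg (u : T.Cell → Fin n → Poly n) : 0 ≤ vecInner T u u :=
  Finset.sum_nonneg fun _ _ => integral_nonneg fun _ =>
    Finset.sum_nonneg fun _ _ => mul_self_nonneg _

lemma eq_zero_of_matInner_self {σ : T.Cell → Matrix (Fin n) (Fin n) (Poly n)}
    (h : matInner T σ σ = 0) : σ = 0 := by
  funext K
  ext1 i j
  have h1 := (Finset.sum_eq_zero_iff_of_nonneg fun _ _ => integral_nonneg fun _ =>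
    Finset.sum_nonneg fun _ _ => Finset.sum_nonneg fun _ _ => mul_self_nonneg _).1 h K
      (Finset.mem_univ _)
  refine poly_eq_zero_of_hull (Mesh.isSimplex K.2) fun x hx => ?_
  have h2 := (fullSupport_volume (Mesh.isSimplex K.2)).eq_zero (by fun_prop)
    (fun _ _ => Finset.sum_nonneg fun _ _ => Finset.sum_nonneg fun _ _ => mul_self_nonneg _) h1 x hx
  have h3 := (Finset.sum_eq_zero_iff_of_nonneg fun _ _ =>
    Finset.sum_nonneg fun _ _ => mul_self_nonneg _).1 h2 i (Finset.mem_univ _)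
  exact mul_self_eq_zero.1 ((Finset.sum_eq_zero_iff_of_nonneg fun _ _ => mul_self_nonneg _).1 h3 j
    (Finset.mem_univ _))

lemma eq_zero_of_vecInner_self {u : T.Cell → Fin n → Poly n}
    (h : vecInner T u u = 0) : u = 0 := by
  funext K i
  have h1 := (Finset.sum_eq_zero_iff_of_nonneg fun _ _ => integral_nonneg fun _ =>
    Finset.sum_nonneg fun _ _ => mul_self_nonneg _).1 h K (Finset.mem_univ _)
  refine poly_eq_zero_of_hull (Mesh.isSimplex K.2) fun x hx => ?_
  have h2 := (fullSupport_volume (Mesh.isSimplex K.2)).eq_zero (by fun_prop)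
    (fun _ _ => Finset.sum_nonneg fun _ _ => mul_self_nonneg _) h1 x hx
  exact mul_self_eq_zero.1 ((Finset.sum_eq_zero_iff_of_nonneg fun _ _ => mul_self_nonneg _).1 h2 i
    (Finset.mem_univ _))

/-- Cellwise divergence as a linear map. -/
def divLin (T : Mesh n Ω) : (T.Cell → Matrix (Fin n) (Fin n) (Poly n)) →ₗ[ℝ]
    (T.Cell → Fin n → Poly n) where
  toFun := divh T
  map_add' σ τ := by
    funext K i
    simp [divh, divRow, Finset.sum_add_distrib]
  map_smul' c σ := by
    funext K i
    simp [divh, divRow, Finset.smul_sum]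

/-- The compliance tensor as a linear map. -/
def cplLin (T : Mesh n Ω) (lam mu : T.Cell → ℝ) :
    (T.Cell → Matrix (Fin n) (Fin n) (Poly n)) →ₗ[ℝ]
      (T.Cell → Matrix (Fin n) (Fin n) (Poly n)) where
  toFun := cplFun T lam mu
  map_add' σ τ := by
    funext K
    simp only [cplFun, compliance, dev, Pi.add_apply, Matrix.trace_add, add_smul]
    module
  map_smul' c σ := by
    funext K
    simp only [cplFun, compliance, dev, Pi.smul_apply, Matrix.trace_smul, RingHom.id_apply,
      smul_assoc]
    module

lemma sum_compliance_mul (lam mu : ℝ) (σ τ : Matrix (Fin n) (Fin n) (Poly n)) (x : Pt n) :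
    ∑ i, ∑ j, ev (compliance lam mu σ i j) x * ev (τ i j) x =
      1 / (2 * mu) * ((∑ i, ∑ j, ev (σ i j) x * ev (τ i j) x) -
        1 / n * ((∑ i, ev (σ i i) x) * ∑ i, ev (τ i i) x)) +
      1 / (n * (n * lam + 2 * mu)) * ((∑ i, ev (σ i i) x) * ∑ i, ev (τ i i) x) := by
  have h : ∀ i j, ev (compliance lam mu σ i j) x =
      1 / (2 * mu) * ev (σ i j) x +
        if i = j then (1 / (n * (n * lam + 2 * mu)) - 1 / (2 * mu) * (1 / n)) *
          ∑ l, ev (σ l l) x else 0 := by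
    intro i j
    simp only [compliance, dev, Matrix.trace, Matrix.diag, Matrix.add_apply, Matrix.sub_apply,
      Matrix.smul_apply, Matrix.one_apply, ev_add, ev_sub, ev_smul, smul_eq_mul, ev_mul, ev_sum]
    split_ifs
    · rw [ev_one]; ring
    · rw [ev_zero]; ring
  simp only [h, add_mul, Finset.sum_add_distrib, ite_mul, zero_mul, Finset.sum_ite_eq,
    Finset.mem_univ, if_true, mul_assoc, ← Finset.mul_sum]
  ring

lemma sum_compliance_mul_comm (lam mu : ℝ) (σ τ : Matrix (Fin n) (Fin n) (Poly n)) (x : Pt n) :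
    ∑ i, ∑ j, ev (compliance lam mu σ i j) x * ev (τ i j) x =
      ∑ i, ∑ j, ev (compliance lam mu τ i j) x * ev (σ i j) x := by
  rw [sum_compliance_mul, sum_compliance_mul, mul_comm (∑ i, ev (σ i i) x),
    Finset.sum_congr rfl fun i _ => Finset.sum_congr rfl fun j _ =>
      mul_comm (ev (σ i j) x) (ev (τ i j) x)]

lemma matInner_cplFun_comm (lam mu : T.Cell → ℝ)
    (σ τ : T.Cell → Matrix (Fin n) (Fin n) (Poly n)) :
    matInner T (cplFun T lam mu σ) τ = matInner T (cplFun T lam mu τ) σ := by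
  unfold matInner
  refine Finset.sum_congr rfl fun K _ => integral_congr_ae (Filter.Eventually.of_forall fun x => ?_)
  exact sum_compliance_mul_comm (lam K) (mu K) (σ K) (τ K) x

/-- Deviator and trace part are orthogonal, so the quadratic form splits into two squares; the
assumptions on the Lamé coefficients make the weights positive. -/
lemma sum_compliance_mul_self (hn : 1 ≤ n) (lam mu : ℝ)
    (σ : Matrix (Fin n) (Fin n) (Poly n)) (x : Pt n) :
    ∑ i, ∑ j, ev (compliance lam mu σ i j) x * ev (σ i j) x =
      1 / (2 * mu) * (∑ i, ∑ j,
        (ev (σ i j) x - if i = j then 1 / n * ∑ l, ev (σ l l) x else 0) ^ 2) +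
      1 / (n * (n * lam + 2 * mu)) * (∑ i, ev (σ i i) x) ^ 2 := by
  have hn0 : (n : ℝ) ≠ 0 := by positivity
  rw [sum_compliance_mul]
  set t := ∑ l, ev (σ l l) x
  have h1 : ∀ i j, (ev (σ i j) x - if i = j then 1 / n * t else 0) ^ 2 =
      ev (σ i j) x * ev (σ i j) x +
        if i = j then (1 / n * t) ^ 2 - 2 * (1 / n * t) * ev (σ i j) x else 0 := by
    intro i j
    split_ifs <;> ring
  simp only [h1, Finset.sum_add_distrib, Finset.sum_ite_eq, Finset.mem_univ, if_true,
    Finset.sum_sub_distrib, Finset.sum_const, Finset.card_univ, Fintype.card_fin, nsmul_eq_mul,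
    ← Finset.mul_sum]
  change _ = 1 / (2 * mu) * (_ + (n * (1 / n * t) ^ 2 - 2 * (1 / n * t) * t)) + _
  field_simp
  ring

/-- The compliance tensor is positive definite. -/
lemma eq_zero_of_matInner_cplFun (hn : 1 ≤ n) {lam mu : T.Cell → ℝ} (hmu : ∀ K, 0 < mu K)
    (hlam : ∀ K, 0 < n * lam K + 2 * mu K) {σ : T.Cell → Matrix (Fin n) (Fin n) (Poly n)}
    (h : matInner T (cplFun T lam mu σ) σ = 0) : σ = 0 := by
  have hn0 : (0 : ℝ) < n := by positivity
  have hnonneg : ∀ (K : T.Cell) (x : Pt n),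
      0 ≤ ∑ i, ∑ j, ev (cplFun T lam mu σ K i j) x * ev (σ K i j) x := by
    intro K x
    have := hmu K
    have := hlam K
    rw [cplFun, sum_compliance_mul_self hn]
    positivity
  funext K
  ext1 i j
  refine poly_eq_zero_of_hull (Mesh.isSimplex K.2) fun x hx => ?_
  have h1 := (Finset.sum_eq_zero_iff_of_nonneg fun K _ => integral_nonneg (hnonneg K)).1 h K
      (Finset.mem_univ _)
  have h2 := (fullSupport_volume (Mesh.isSimplex K.2)).eq_zero (by fun_prop)
    (fun y _ => hnonneg K y) h1 x hx
  simp only [cplFun] at h2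
  rw [sum_compliance_mul_self hn] at h2
  have hm := hmu K
  have hl := hlam K
  obtain ⟨h3, h4⟩ := (add_eq_zero_iff_of_nonneg (by positivity) (by positivity)).1 h2
  have h5 := (mul_eq_zero.1 h3).resolve_left (by positivity)
  have h6 := pow_eq_zero_iff two_ne_zero |>.1 ((mul_eq_zero.1 h4).resolve_left (by positivity))
  have h7 := (Finset.sum_eq_zero_iff_of_nonneg fun _ _ => Finset.sum_nonneg fun _ _ =>
    sq_nonneg _).1 h5 i (Finset.mem_univ _)
  have h8 := (Finset.sum_eq_zero_iff_of_nonneg fun _ _ => sq_nonneg _).1 h7 j (Finset.mem_univ _)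
  rw [h6, mul_zero, ite_self, sub_zero] at h8
  exact pow_eq_zero_iff two_ne_zero |>.1 h8

lemma exists_pderiv_eq (i : Fin n) {p : Poly n} (hp : p ∈ PolyLE n k) :
    ∃ q ∈ PolyLE n (k + 1), MvPolynomial.pderiv i q = p := by
  refine ⟨∑ s ∈ p.support, MvPolynomial.monomial (s + Finsupp.single i 1)
    (p.coeff s / ((s i : ℝ) + 1)), Submodule.sum_mem _ fun s hs => ?_, ?_⟩
  · rw [MvPolynomial.mem_restrictTotalDegree] at *
    refine (MvPolynomial.totalDegree_monomial_le _ _).trans ?_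
    change (s + Finsupp.single i 1).degree ≤ k + 1
    rw [map_add, Finsupp.degree_single]
    exact Nat.add_le_add_right ((MvPolynomial.le_totalDegree hs).trans hp) 1
  · conv_rhs => rw [p.as_sum]
    rw [map_sum]
    refine Finset.sum_congr rfl fun s _ => ?_
    rw [MvPolynomial.pderiv_monomial, add_tsub_cancel_right]
    congr 1
    have : ((s i : ℝ) + 1) ≠ 0 := by positivity
    simp [this]

lemma divh_mem {v : T.Cell → Matrix (Fin n) (Fin n) (Poly n)} (hv : v ∈ Vh T k) :
    divh T v ∈ Wh T k := fun K i =>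
  Submodule.sum_mem _ fun j _ => pderiv_mem_polyLE j (hv K i j)

/-- The divergence and the skew-symmetric part of a stress can be prescribed. -/
lemma exists_div_eq {u : T.Cell → Fin n → Poly n} (hu : u ∈ Wh T k)
    {ρ : T.Cell → Matrix (Fin n) (Fin n) (Poly n)} (hρ : ρ ∈ Ah T k) :
    ∃ v ∈ Vh T k, divh T v = u ∧ matInner T ρ v = matInner T ρ ρ := by
  have hρV : ρ ∈ Vh T k := hρ.1
  have hd : u - divh T ρ ∈ Wh T k := Submodule.sub_mem _ hu (divh_mem hρV)
  choose q hq hq' using fun K i => exists_pderiv_eq i (hd K i)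
  -- The divergence is corrected by a diagonal field of antiderivatives, the i-th in direction i.
  -- Diagonal matrices are orthogonal to skew ones, so the pairing with ρ is unaffected.
  refine ⟨ρ + fun K => Matrix.diagonal (q K), Submodule.add_mem _ hρV fun K i j => ?_, ?_, ?_⟩
  · rw [Matrix.diagonal_apply]
    split_ifs
    · exact hq K i
    · exact zero_mem _
  · have : divh T (fun K => Matrix.diagonal (q K)) = u - divh T ρ := by
      funext K i
      rw [← hq' K i]
      simp [divh, divRow, Matrix.diagonal_apply, apply_ite]
    change divLin T _ = u
    rw [map_add]
    change divh T ρ + divh T _ = u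
    rw [this]
    abel
  · have hdiag : ∀ K i, ρ K i i = 0 := fun K i => by
      have := hρ.2 K i i
      rw [← two_nsmul] at this
      exact (smul_eq_zero.1 this).resolve_left two_ne_zero
    have : matInner T ρ (fun K => Matrix.diagonal (q K)) = 0 := by
      refine Finset.sum_eq_zero fun K _ => ?_
      rw [← integral_zero (Pt n) ℝ (μ := volume.restrict (hull K.1))]
      congr 1
      funext x
      refine Finset.sum_eq_zero fun i _ => Finset.sum_eq_zero fun j _ => ?_
      by_cases e : i = j
      · subst e; simp [hdiag]
      · simp [e]
    rw [← matForm_apply, map_add, matForm_apply, matForm_apply, this, add_zero]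

end Forms

/-! ### Finite dimensionality and unique solvability of the local systems -/

section Systems

variable {n k : ℕ} {Ω : Set (Pt n)} {T : Mesh n Ω} {Γ₀ : Set (Pt n)}

instance finiteDimensional_Vh : FiniteDimensional ℝ (Vh T k) :=
  FiniteDimensional.of_injective
    ({ toFun := fun v K i j => ⟨v.1 K i j, v.2 K i j⟩
       map_add' := fun _ _ => rfl
       map_smul' := fun _ _ => rfl } :
      Vh T k →ₗ[ℝ] (T.Cell → Fin n → Fin n → PolyLE n (k + 1)))
    fun _ _ h => Subtype.ext <| funext fun K => Matrix.ext fun i j =>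
      congrArg Subtype.val (congrFun (congrFun (congrFun h K) i) j)

instance finiteDimensional_Wh : FiniteDimensional ℝ (Wh T k) :=
  FiniteDimensional.of_injective
    ({ toFun := fun v K i => ⟨v.1 K i, v.2 K i⟩
       map_add' := fun _ _ => rfl
       map_smul' := fun _ _ => rfl } : Wh T k →ₗ[ℝ] (T.Cell → Fin n → PolyLE n k))
    fun _ _ h => Subtype.ext <| funext fun K => funext fun i =>
      congrArg Subtype.val (congrFun (congrFun h K) i)

instance finiteDimensional_Ah : FiniteDimensional ℝ (Ah T k) :=
  FiniteDimensional.of_injective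
    ({ toFun := fun v K i j => ⟨v.1 K i j, v.2.1 K i j⟩
       map_add' := fun _ _ => rfl
       map_smul' := fun _ _ => rfl } :
      Ah T k →ₗ[ℝ] (T.Cell → Fin n → Fin n → PolyLE n (k + 1)))
    fun _ _ h => Subtype.ext <| funext fun K => Matrix.ext fun i j =>
      congrArg Subtype.val (congrFun (congrFun (congrFun h K) i) j)

/-- Polynomials on the facets, extended by zero. -/
def facetPoly (T : Mesh n Ω) (k : ℕ) :
    (T.Facet → Fin n → PolyLE n (k + 1)) →ₗ[ℝ] (T.Facet → Pt n → Fin n → ℝ) where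
  toFun p F := (hull F.1).indicator fun x i => ev (p F i) x
  map_add' p q := by
    funext F x
    by_cases hx : x ∈ hull F.1
    · funext i; simp [hx]
    · simp [hx]
  map_smul' c p := by
    funext F x
    by_cases hx : x ∈ hull F.1
    · funext i; simp [hx]
    · simp [hx]

instance finiteDimensional_Mh : FiniteDimensional ℝ (Mh T k Γ₀) := by
  refine Submodule.finiteDimensional_of_le (S₂ := LinearMap.range (facetPoly T k)) fun μ hμ => ?_
  choose p hp ep using hμ.1
  exact ⟨fun F i => ⟨p F i, hp F i⟩, funext fun F => (ep F).symm⟩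

lemma integrableOn_multiplier (hn : 1 ≤ n) (μ : Mh T k Γ₀) (F : T.Facet) (i : Fin n)
    {g : Pt n → ℝ} (hg : Continuous g) :
    IntegrableOn (fun x => μ.1 F x i * g x) (hull F.1) (surf n) := by
  obtain ⟨K, hK, hFK, hFc⟩ := Mesh.mem_facets.1 F.2
  obtain ⟨a, ha, hF⟩ := exists_eq_erase (Mesh.isSimplex hK) hFK hFc
  obtain ⟨p, -, ep⟩ := μ.2.1 F
  have hfull : FullSupport (surf n) (hull F.1) := by
    rw [hF]; exact fullSupport_surf hn (Mesh.isSimplex hK) ha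
  refine (hfull.integrableOn (g := fun x => ev (p i) x * g x) (by fun_prop)).congr_fun
    (fun x hx => ?_) (isCompact_hull _).measurableSet
  simp only [ep, Set.indicator_of_mem hx]

/-- The boundary pairing as a bilinear form. -/
def bdryForm (hn : 1 ≤ n) (T : Mesh n Ω) (k : ℕ) (Γ₀ : Set (Pt n)) :
    Mh T k Γ₀ →ₗ[ℝ] (T.Cell → Matrix (Fin n) (Fin n) (Poly n)) →ₗ[ℝ] ℝ :=
  ∑ K : T.Cell, ∑ F : T.Facet with F.1 ⊆ K.1, ∑ i, LinearMap.mk₂ ℝ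
    (fun μ v => ∫ x in hull F.1,
      μ.1 F x i * ∑ j, ev (v K i j) x * outwardNormal K.1 F.1 j ∂(surf n))
    (fun μ μ' v => by
      rw [← integral_add (integrableOn_multiplier hn μ F i (by fun_prop))
        (integrableOn_multiplier hn μ' F i (by fun_prop))]
      simp [add_mul])
    (fun c μ v => by
      rw [smul_eq_mul, ← integral_const_mul]
      simp [mul_assoc])
    (fun μ v v' => by
      rw [← integral_add (integrableOn_multiplier hn μ F i (by fun_prop))
        (integrableOn_multiplier hn μ F i (by fun_prop))]
      simp [add_mul, mul_add, Finset.sum_add_distrib])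
    (fun c μ v => by
      rw [smul_eq_mul, ← integral_const_mul]
      simp [mul_left_comm, Finset.mul_sum, mul_assoc])

lemma bdryForm_apply (hn : 1 ≤ n) (μ : Mh T k Γ₀)
    (v : T.Cell → Matrix (Fin n) (Fin n) (Poly n)) :
    bdryForm hn T k Γ₀ μ v = bdryInner T μ v := by
  simp only [bdryForm, LinearMap.sum_apply, LinearMap.mk₂_apply, bdryInner]
  refine Finset.sum_congr rfl fun K _ => Finset.sum_congr rfl fun F _ => ?_
  exact (integral_finsetSum _ fun i _ => integrableOn_multiplier hn μ F i (by fun_prop)).symm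

/-- The load is controlled only on Ω. A cell lies in Ω up to its frontier, which is null by
convexity. -/
lemma integrableOn_load (hΩ_reg : interior (closure Ω) = Ω) {f : Pt n → Pt n}
    (hf : MemLp f 2 (volume.restrict Ω)) (K : T.Cell) (i : Fin n) {g : Pt n → ℝ}
    (hg : Continuous g) : IntegrableOn (fun x => f x i * g x) (hull K.1) := by
  have hsub : interior (hull K.1) ⊆ Ω :=
    (interior_mono (Mesh.hull_subset_closure K.2)).trans hΩ_reg.le
  have hae : (hull K.1 : Set (Pt n)) =ᵐ[volume] interior (hull K.1) :=
    (interior_ae_eq_of_null_frontier ((convex_convexHull ℝ _).addHaar_frontier volume)).symm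
  have hle : volume.restrict (hull K.1) ≤ volume.restrict Ω := by
    rw [Measure.restrict_congr_set hae]
    exact Measure.restrict_mono hsub le_rfl
  have : IsFiniteMeasure (volume.restrict (hull K.1)) :=
    ⟨by rw [Measure.restrict_apply_univ]; exact (isCompact_hull K.1).measure_lt_top⟩
  have h1 : IntegrableOn f (hull K.1) := (hf.mono_measure hle).integrable one_le_two
  have h2 : IntegrableOn (fun x => f x i) (hull K.1) :=
    (EuclideanSpace.proj (𝕜 := ℝ) i).integrable_comp h1
  exact h2.mul_continuousOn hg.continuousOn (isCompact_hull K.1)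

/-- The load as a linear functional. -/
def loadForm (T : Mesh n Ω) (hΩ_reg : interior (closure Ω) = Ω) {f : Pt n → Pt n}
    (hf : MemLp f 2 (volume.restrict Ω)) : (T.Cell → Fin n → Poly n) →ₗ[ℝ] ℝ where
  toFun w := loadInner T f w
  map_add' w w' := by
    have hint : ∀ (w : T.Cell → Fin n → Poly n) (K : T.Cell),
        IntegrableOn (fun x => ∑ i, f x i * ev (w K i) x) (hull K.1) := fun w K =>
      integrable_finsetSum _ fun i _ => integrableOn_load hΩ_reg hf K i (by fun_prop)
    simp only [loadInner]
    rw [← Finset.sum_add_distrib]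
    refine Finset.sum_congr rfl fun K _ => ?_
    rw [← integral_add (hint w K) (hint w' K)]
    simp [mul_add, Finset.sum_add_distrib]
  map_smul' c w := by
    simp only [loadInner, RingHom.id_apply, smul_eq_mul, Finset.mul_sum]
    refine Finset.sum_congr rfl fun K _ => ?_
    rw [← integral_const_mul]
    simp [mul_left_comm, Finset.mul_sum]

variable {lam mu : T.Cell → ℝ} {ρS : ℝ}

/-- The operator of the local systems. -/
def localOp (T : Mesh n Ω) (k : ℕ) (lam mu : T.Cell → ℝ) (ρS : ℝ) :
    (Vh T k × Wh T k × Ah T k) →ₗ[ℝ]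
      Module.Dual ℝ (Vh T k) × Module.Dual ℝ (Wh T k) × Module.Dual ℝ (Ah T k) where
  toFun s :=
    ((matForm T (cplLin T lam mu s.1)).domRestrict _ +
        (vecForm T s.2.1 ∘ₗ divLin T).domRestrict _ + (matForm T s.2.2).domRestrict _,
      ρS⁻¹ • (vecForm T (divLin T s.1)).domRestrict _, (matForm T s.1).domRestrict _)
  map_add' s s' := by
    refine Prod.ext ?_ (Prod.ext ?_ ?_)
    · ext v
      simp only [Prod.fst_add, Prod.snd_add, Submodule.coe_add, map_add, LinearMap.add_apply,
        LinearMap.domRestrict_apply, LinearMap.comp_apply]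
      ring
    · ext v
      simp
      ring
    · ext v
      simp
  map_smul' c s := by
    refine Prod.ext ?_ (Prod.ext ?_ ?_)
    · ext v
      simp only [Prod.smul_fst, Prod.smul_snd, Submodule.coe_smul, map_smul, LinearMap.add_apply,
        LinearMap.domRestrict_apply, LinearMap.comp_apply, LinearMap.smul_apply, RingHom.id_apply,
        smul_eq_mul]
      ring
    · ext v
      simp
      ring
    · ext v
      simp

lemma isLocalSolution_iff (ℓ : Module.Dual ℝ (Vh T k)) (g : Module.Dual ℝ (Wh T k))
    (s : Vh T k × Wh T k × Ah T k) :
    IsLocalSolution T k lam mu ρS ℓ g s ↔ localOp T k lam mu ρS s = (ℓ, g, 0) := by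
  simp only [IsLocalSolution, ← matForm_apply, ← vecForm_apply, Prod.ext_iff, LinearMap.ext_iff]
  rfl

/-- Testing with the stress itself kills it, by the other two equations and positivity of the
compliance. Testing with the stress of `exists_div_eq` then leaves the sum of the squared norms of
displacement and rotation. -/
lemma localOp_injective (hn : 1 ≤ n) (hmu : ∀ K, 0 < mu K)
    (hlam : ∀ K, 0 < n * lam K + 2 * mu K) (hρS : 0 < ρS) :
    Function.Injective (localOp T k lam mu ρS) := by
  rw [← LinearMap.ker_eq_bot, LinearMap.ker_eq_bot']
  rintro ⟨s, u, r⟩ h0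
  obtain ⟨h1, h2, h3⟩ := (isLocalSolution_iff 0 0 (s, u, r)).2 h0
  simp only [LinearMap.zero_apply] at h1 h2 h3
  have hdiv : ∀ w : Wh T k, vecInner T (divh T s) w = 0 := fun w =>
    (mul_eq_zero.1 (h2 w)).resolve_left (inv_pos.2 hρS).ne'
  have hs : (s : T.Cell → Matrix (Fin n) (Fin n) (Poly n)) = 0 := by
    refine eq_zero_of_matInner_cplFun hn hmu hlam ?_
    have := h1 s
    rwa [vecInner_comm, hdiv,
      matInner_comm (r : T.Cell → Matrix (Fin n) (Fin n) (Poly n)), h3, add_zero, add_zero] at this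
  obtain ⟨v, hv, hvd, hvs⟩ := exists_div_eq u.2 r.2
  have h4 := h1 ⟨v, hv⟩
  have hcpl : matInner T (cplFun T lam mu s) v = 0 := by
    rw [hs, matInner_cplFun_comm, ← matForm_apply, map_zero]
  change matInner T (cplFun T lam mu s) v + vecInner T u (divh T v) + matInner T r v = 0 at h4
  rw [hcpl, hvd, hvs, zero_add] at h4
  obtain ⟨h5, h6⟩ := (add_eq_zero_iff_of_nonneg (vecInner_self_nonneg _)
    (matInner_self_nonneg _)).1 h4
  exact Prod.ext (Subtype.ext hs) (Prod.ext (Subtype.ext (eq_zero_of_vecInner_self h5))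
    (Subtype.ext (eq_zero_of_matInner_self h6)))

lemma localOp_bijective (hn : 1 ≤ n) (hmu : ∀ K, 0 < mu K)
    (hlam : ∀ K, 0 < n * lam K + 2 * mu K) (hρS : 0 < ρS) :
    Function.Bijective (localOp T k lam mu ρS) := by
  have hinj := localOp_injective (T := T) (k := k) hn hmu hlam hρS
  have : Module.Finite ℝ (Module.Dual ℝ (Vh T k)) := Subspace.instModuleDualFiniteDimensional
  have : Module.Finite ℝ (Module.Dual ℝ (Wh T k)) := Subspace.instModuleDualFiniteDimensional
  have : Module.Finite ℝ (Module.Dual ℝ (Ah T k)) := Subspace.instModuleDualFiniteDimensional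
  refine ⟨hinj, (LinearMap.injective_iff_surjective_of_finrank_eq_finrank ?_).1 hinj⟩
  rw [Module.finrank_prod, Module.finrank_prod, Module.finrank_prod, Module.finrank_prod,
    Subspace.dual_finrank_eq, Subspace.dual_finrank_eq, Subspace.dual_finrank_eq]

end Systems

/-! ### Static condensation -/

section Condensation

variable {n k : ℕ} {Ω : Set (Pt n)} {T : Mesh n Ω} {Γ₀ : Set (Pt n)}
  {lam mu : T.Cell → ℝ} {ρS : ℝ} {f : Pt n → Pt n}

lemma isLocalSolution_iff_eq_localSolve (hn : 1 ≤ n) (hmu : ∀ K, 0 < mu K)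
    (hlam : ∀ K, 0 < n * lam K + 2 * mu K) (hρS : 0 < ρS)
    (ℓ : Module.Dual ℝ (Vh T k)) (g : Module.Dual ℝ (Wh T k)) (s : Vh T k × Wh T k × Ah T k) :
    IsLocalSolution T k lam mu ρS ℓ g s ↔ s = localSolve T k lam mu ρS ℓ g := by
  have hbij := localOp_bijective (T := T) (k := k) hn hmu hlam hρS
  obtain ⟨s₀, hs₀⟩ := hbij.2 (ℓ, g, 0)
  have hspec : IsLocalSolution T k lam mu ρS ℓ g (localSolve T k lam mu ρS ℓ g) :=
    Classical.epsilon_spec ⟨s₀, (isLocalSolution_iff ℓ g s₀).2 hs₀⟩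
  refine ⟨fun h => hbij.1 ?_, fun h => h ▸ hspec⟩
  rw [(isLocalSolution_iff ℓ g _).1 h, (isLocalSolution_iff ℓ g _).1 hspec]

lemma isLocalSolution_iff_eq_Q (hn : 1 ≤ n) (hmu : ∀ K, 0 < mu K)
    (hlam : ∀ K, 0 < n * lam K + 2 * mu K) (hρS : 0 < ρS) (μ : Mh T k Γ₀)
    (s : Vh T k × Wh T k × Ah T k) :
    IsLocalSolution T k lam mu ρS (fun v => -bdryInner T μ v) (fun _ => 0) s ↔
      s = Q T k Γ₀ lam mu ρS μ := by
  have hℓ : (fun v : Vh T k => -bdryInner T μ v) =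
      ⇑(-(bdryForm hn T k Γ₀ μ).domRestrict (Vh T k)) := by
    funext v
    rw [← bdryForm_apply hn]
    rfl
  unfold Q
  rw [hℓ]
  exact isLocalSolution_iff_eq_localSolve hn hmu hlam hρS _ 0 s

lemma isLocalSolution_iff_eq_QL (hn : 1 ≤ n) (hmu : ∀ K, 0 < mu K)
    (hlam : ∀ K, 0 < n * lam K + 2 * mu K) (hρS : 0 < ρS)
    (hΩ_reg : interior (closure Ω) = Ω) (hf : MemLp f 2 (volume.restrict Ω))
    (s : Vh T k × Wh T k × Ah T k) :
    IsLocalSolution T k lam mu ρS (fun _ => 0) (fun w => -loadInner T f w) s ↔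
      s = QL T k lam mu ρS f :=
  isLocalSolution_iff_eq_localSolve hn hmu hlam hρS 0
    (-(loadForm T hΩ_reg hf).domRestrict (Wh T k)) s

lemma isLocalSolution_Q (hn : 1 ≤ n) (hmu : ∀ K, 0 < mu K)
    (hlam : ∀ K, 0 < n * lam K + 2 * mu K) (hρS : 0 < ρS) (μ : Mh T k Γ₀) :
    IsLocalSolution T k lam mu ρS (fun v => -bdryInner T μ v) (fun _ => 0)
      (Q₁ T k Γ₀ lam mu ρS μ, Q₂ T k Γ₀ lam mu ρS μ, Q₃ T k Γ₀ lam mu ρS μ) :=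
  (isLocalSolution_iff_eq_Q hn hmu hlam hρS μ _).2 rfl

lemma isLocalSolution_QL (hn : 1 ≤ n) (hmu : ∀ K, 0 < mu K)
    (hlam : ∀ K, 0 < n * lam K + 2 * mu K) (hρS : 0 < ρS)
    (hΩ_reg : interior (closure Ω) = Ω) (hf : MemLp f 2 (volume.restrict Ω)) :
    IsLocalSolution T k lam mu ρS (fun _ => 0) (fun w => -loadInner T f w)
      (QL₁ T k lam mu ρS f, QL₂ T k lam mu ρS f, QL₃ T k lam mu ρS f) :=
  (isLocalSolution_iff_eq_QL hn hmu hlam hρS hΩ_reg hf _).2 rfl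

/-- Local solutions superpose. -/
lemma IsLocalSolution.add {ℓ ℓ' : Vh T k → ℝ} {g g' : Wh T k → ℝ}
    {s s' : Vh T k × Wh T k × Ah T k} (h : IsLocalSolution T k lam mu ρS ℓ g s)
    (h' : IsLocalSolution T k lam mu ρS ℓ' g' s') :
    IsLocalSolution T k lam mu ρS (ℓ + ℓ') (g + g') (s + s') := by
  refine ⟨fun v => ?_, fun w => ?_, fun η => ?_⟩
  · rw [Pi.add_apply, ← h.1, ← h'.1]
    simp only [← matForm_apply, ← vecForm_apply]
    change matForm T (cplLin T lam mu (s.1 + s'.1)) v + vecForm T (s.2.1 + s'.2.1) (divh T v) +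
      matForm T (s.2.2 + s'.2.2) v = _
    simp only [map_add, LinearMap.add_apply]
    change matForm T (cplFun T lam mu s.1) v + matForm T (cplFun T lam mu s'.1) v + _ + _ = _
    ring
  · rw [Pi.add_apply, ← h.2.1, ← h'.2.1]
    simp only [← vecForm_apply]
    change ρS⁻¹ * vecForm T (divLin T (s.1 + s'.1)) w = _
    simp only [map_add, LinearMap.add_apply, mul_add]
    rfl
  · have e := h.2.2 η
    have e' := h'.2.2 η
    rw [← matForm_apply] at e e' ⊢
    change matForm T (s.1 + s'.1) η = 0
    rw [map_add, LinearMap.add_apply, e, e', add_zero]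

/-- The local solution operator for multipliers, as a linear map. -/
def multiplierSolve (T : Mesh n Ω) (k : ℕ) (Γ₀ : Set (Pt n)) (lam mu : T.Cell → ℝ) (ρS : ℝ)
    (hn : 1 ≤ n) (hbij : Function.Bijective (localOp T k lam mu ρS)) :
    Mh T k Γ₀ →ₗ[ℝ] Vh T k × Wh T k × Ah T k :=
  (LinearEquiv.ofBijective _ hbij).symm.toLinearMap ∘ₗ LinearMap.inl ℝ _ _ ∘ₗ
    (-((Vh T k).subtype.dualMap ∘ₗ bdryForm hn T k Γ₀))

lemma multiplierSolve_apply (hn : 1 ≤ n) (hmu : ∀ K, 0 < mu K)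
    (hlam : ∀ K, 0 < n * lam K + 2 * mu K) (hρS : 0 < ρS) (μ : Mh T k Γ₀) :
    multiplierSolve T k Γ₀ lam mu ρS hn (localOp_bijective hn hmu hlam hρS) μ =
      Q T k Γ₀ lam mu ρS μ := by
  refine (isLocalSolution_iff_eq_Q hn hmu hlam hρS μ _).1 ?_
  have hℓ : (fun v : Vh T k => -bdryInner T μ v) =
      ⇑(-(bdryForm hn T k Γ₀ μ).domRestrict (Vh T k)) := by
    funext v
    rw [← bdryForm_apply hn]
    rfl
  rw [hℓ]
  refine (isLocalSolution_iff _ 0 _).2 ?_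
  exact (LinearEquiv.ofBijective _ (localOp_bijective hn hmu hlam hρS)).apply_symm_apply _

/-- The first local equation for the second multiplier is tested with the local stress of the first
one, which is divergence free and orthogonal to the rotations in the weak sense. -/
lemma ah_eq (hn : 1 ≤ n) (hmu : ∀ K, 0 < mu K)
    (hlam : ∀ K, 0 < n * lam K + 2 * mu K) (hρS : 0 < ρS) (μ₁ μ₂ : Mh T k Γ₀) :
    ah T k Γ₀ lam mu ρS μ₁ μ₂ = -bdryInner T μ₂ (Q₁ T k Γ₀ lam mu ρS μ₁) := by
  obtain ⟨-, g2, g3⟩ := isLocalSolution_Q hn hmu hlam hρS μ₁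
  have e := (isLocalSolution_Q hn hmu hlam hρS μ₂).1 (Q₁ T k Γ₀ lam mu ρS μ₁)
  have e1 := (mul_eq_zero.1 (g2 (Q₂ T k Γ₀ lam mu ρS μ₂))).resolve_left (inv_pos.2 hρS).ne'
  have e2 := g3 (Q₃ T k Γ₀ lam mu ρS μ₂)
  dsimp only at e e1 e2
  rw [vecInner_comm] at e1
  rw [matInner_comm] at e2
  rw [e1, e2, add_zero, add_zero] at e
  rw [← e, ah, matInner_cplFun_comm]

/-- Each of the two local problems is tested with the solution of the other; by symmetry only the
load and the boundary term survive. -/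
lemma bh_eq (hn : 1 ≤ n) (hmu : ∀ K, 0 < mu K)
    (hlam : ∀ K, 0 < n * lam K + 2 * mu K) (hρS : 0 < ρS)
    (hΩ_reg : interior (closure Ω) = Ω) (hf : MemLp f 2 (volume.restrict Ω)) (μ : Mh T k Γ₀) :
    bh T k Γ₀ lam mu ρS f μ = bdryInner T μ (QL₁ T k lam mu ρS f) := by
  obtain ⟨h1, h2, h3⟩ := isLocalSolution_Q hn hmu hlam hρS μ
  obtain ⟨g1, g2, g3⟩ := isLocalSolution_QL (k := k) hn hmu hlam hρS hΩ_reg hf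
  have e := h1 (QL₁ T k lam mu ρS f)
  have e1 := g2 (Q₂ T k Γ₀ lam mu ρS μ)
  have e2 := g3 (Q₃ T k Γ₀ lam mu ρS μ)
  have e3 := g1 (Q₁ T k Γ₀ lam mu ρS μ)
  have e4 := (mul_eq_zero.1 (h2 (QL₂ T k lam mu ρS f))).resolve_left (inv_pos.2 hρS).ne'
  have e5 := h3 (QL₃ T k lam mu ρS f)
  dsimp only at e e1 e2 e3 e4 e5
  rw [matInner_comm] at e2 e5
  rw [vecInner_comm] at e1 e4
  rw [matInner_cplFun_comm] at e3
  rw [e4, e5, add_zero, add_zero] at e3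
  rw [e3, e2, zero_add, add_zero] at e
  rw [e] at e1
  rw [bh, ← neg_inj, ← mul_neg, ← e1]
  field_simp

/-- The condensed operator. -/
def condensedOp (T : Mesh n Ω) (k : ℕ) (Γ₀ : Set (Pt n)) (lam mu : T.Cell → ℝ) (ρS : ℝ)
    (hn : 1 ≤ n) (hbij : Function.Bijective (localOp T k lam mu ρS)) :
    Mh T k Γ₀ →ₗ[ℝ] Module.Dual ℝ (Mh T k Γ₀) :=
  -((bdryForm hn T k Γ₀).flip ∘ₗ (Vh T k).subtype ∘ₗ LinearMap.fst ℝ _ _ ∘ₗ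
    multiplierSolve T k Γ₀ lam mu ρS hn hbij)

lemma condensedOp_apply (hn : 1 ≤ n) (hmu : ∀ K, 0 < mu K)
    (hlam : ∀ K, 0 < n * lam K + 2 * mu K) (hρS : 0 < ρS) (γ μ : Mh T k Γ₀) :
    condensedOp T k Γ₀ lam mu ρS hn (localOp_bijective hn hmu hlam hρS) γ μ =
      ah T k Γ₀ lam mu ρS γ μ := by
  rw [ah_eq hn hmu hlam hρS, ← bdryForm_apply hn, Q₁, ← multiplierSolve_apply hn hmu hlam hρS]
  rfl

/-- The condensed problem is uniquely solvable as soon as no nonzero multiplier is invisible to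
the local problems. -/
lemma existsUnique_solvesCondensed (hn : 1 ≤ n) (hmu : ∀ K, 0 < mu K)
    (hlam : ∀ K, 0 < n * lam K + 2 * mu K) (hρS : 0 < ρS)
    (hΩ_reg : interior (closure Ω) = Ω) (hf : MemLp f 2 (volume.restrict Ω))
    (hker : ∀ (u : Wh T k) (ρ : Ah T k) (γ : Mh T k Γ₀), InKernel T k u ρ γ → γ = 0) :
    ∃! γ : Mh T k Γ₀, SolvesCondensed T k Γ₀ lam mu ρS f γ := by
  set A := condensedOp T k Γ₀ lam mu ρS hn (localOp_bijective hn hmu hlam hρS)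
  have hA : ∀ γ μ, A γ μ = ah T k Γ₀ lam mu ρS γ μ := condensedOp_apply hn hmu hlam hρS
  have hinj : Function.Injective A := by
    rw [← LinearMap.ker_eq_bot, LinearMap.ker_eq_bot']
    intro γ h0
    have h1 : ah T k Γ₀ lam mu ρS γ γ = 0 := by rw [← hA, h0, LinearMap.zero_apply]
    -- The form at (γ, γ) is the compliance energy of the local stress, so this stress vanishes. The
    -- first local equation then reduces to membership in the kernel.
    have h2 := eq_zero_of_matInner_cplFun hn hmu hlam h1
    refine hker (Q₂ T k Γ₀ lam mu ρS γ) (Q₃ T k Γ₀ lam mu ρS γ) γ fun v hv => ?_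
    have h3 := (isLocalSolution_Q hn hmu hlam hρS γ).1 ⟨v, hv⟩
    dsimp only at h3
    rw [h2, matInner_cplFun_comm, ← matForm_apply, map_zero, zero_add] at h3
    rw [h3]
    exact neg_add_cancel _
  have : Module.Finite ℝ (Module.Dual ℝ (Mh T k Γ₀)) := Subspace.instModuleDualFiniteDimensional
  have hsurj : Function.Surjective A :=
    (LinearMap.injective_iff_surjective_of_finrank_eq_finrank
      Subspace.dual_finrank_eq.symm).1 hinj
  have hb : ∀ γ, SolvesCondensed T k Γ₀ lam mu ρS f γ ↔
      A γ = (bdryForm hn T k Γ₀).flip (QL₁ T k lam mu ρS f) := by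
    intro γ
    rw [LinearMap.ext_iff]
    refine forall_congr' fun μ => ?_
    rw [hA, bh_eq hn hmu hlam hρS hΩ_reg hf, LinearMap.flip_apply, bdryForm_apply]
  obtain ⟨γ, hγ⟩ := hsurj ((bdryForm hn T k Γ₀).flip (QL₁ T k lam mu ρS f))
  exact ⟨γ, (hb γ).2 hγ, fun γ' h' => hinj (((hb γ').1 h').trans hγ.symm)⟩

/-- Static condensation. -/
lemma isHybridSolution_iff (hn : 1 ≤ n) (hmu : ∀ K, 0 < mu K)
    (hlam : ∀ K, 0 < n * lam K + 2 * mu K) (hρS : 0 < ρS)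
    (hΩ_reg : interior (closure Ω) = Ω) (hf : MemLp f 2 (volume.restrict Ω))
    (σ : Vh T k) (u : Wh T k) (ρ : Ah T k) (γ : Mh T k Γ₀) :
    IsHybridSolution T k Γ₀ lam mu ρS f σ u ρ γ ↔
      SolvesCondensed T k Γ₀ lam mu ρS f γ ∧
        (σ, u, ρ) = Q T k Γ₀ lam mu ρS γ + QL T k lam mu ρS f := by
  have hlocal : IsLocalSolution T k lam mu ρS (fun v => -bdryInner T γ v)
      (fun w => -loadInner T f w) (σ, u, ρ) ↔
        (σ, u, ρ) = Q T k Γ₀ lam mu ρS γ + QL T k lam mu ρS f := by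
    have hsol := (isLocalSolution_Q hn hmu hlam hρS γ).add
      (isLocalSolution_QL (k := k) hn hmu hlam hρS hΩ_reg hf)
    have hℓ : ((fun v : Vh T k => -bdryInner T γ v) + fun _ => 0) =
        ⇑(-(bdryForm hn T k Γ₀ γ).domRestrict (Vh T k)) := by
      funext v
      rw [Pi.add_apply, add_zero, ← bdryForm_apply hn]
      rfl
    have hℓ' : (fun v : Vh T k => -bdryInner T γ v) =
        ⇑(-(bdryForm hn T k Γ₀ γ).domRestrict (Vh T k)) := by
      rw [← hℓ]
      simp [Pi.add_def]
    have hg : ((fun _ : Wh T k => (0 : ℝ)) + fun w : Wh T k => -loadInner T f w) =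
        ⇑(-(loadForm T hΩ_reg hf).domRestrict (Wh T k)) := by
      funext w
      rw [Pi.add_apply, zero_add]
      rfl
    rw [hℓ, hg] at hsol
    change _ ↔ (σ, u, ρ) =
      (Q₁ T k Γ₀ lam mu ρS γ, Q₂ T k Γ₀ lam mu ρS γ, Q₃ T k Γ₀ lam mu ρS γ) +
        (QL₁ T k lam mu ρS f, QL₂ T k lam mu ρS f, QL₃ T k lam mu ρS f)
    rw [hℓ', (isLocalSolution_iff_eq_localSolve hn hmu hlam hρS _ _ _).1 hsol]
    exact isLocalSolution_iff_eq_localSolve hn hmu hlam hρS _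
      (-(loadForm T hΩ_reg hf).domRestrict (Wh T k)) _
  rw [← hlocal]
  have hcond : ∀ h : (σ, u, ρ) = Q T k Γ₀ lam mu ρS γ + QL T k lam mu ρS f,
      SolvesCondensed T k Γ₀ lam mu ρS f γ ↔ ∀ μ : Mh T k Γ₀, bdryInner T μ σ = 0 := by
    intro h
    refine forall_congr' fun μ => ?_
    have hσ : (σ : T.Cell → Matrix (Fin n) (Fin n) (Poly n)) =
        Q₁ T k Γ₀ lam mu ρS γ + QL₁ T k lam mu ρS f :=
      congrArg (fun s : Vh T k × Wh T k × Ah T k =>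
        (s.1 : T.Cell → Matrix (Fin n) (Fin n) (Poly n))) h
    rw [ah_eq hn hmu hlam hρS, bh_eq hn hmu hlam hρS hΩ_reg hf, hσ, ← bdryForm_apply hn,
      ← bdryForm_apply hn, ← bdryForm_apply hn, map_add, neg_eq_iff_add_eq_zero]
  constructor
  · rintro ⟨h1, h2, h3, h4⟩
    have h : IsLocalSolution T k lam mu ρS (fun v => -bdryInner T γ v)
        (fun w => -loadInner T f w) (σ, u, ρ) :=
      ⟨fun v => eq_neg_of_add_eq_zero_left (h1 v), fun w => neg_eq_iff_eq_neg.1 (h2 w), h3⟩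
    exact ⟨(hcond (hlocal.1 h)).2 h4, h⟩
  · rintro ⟨h4, h⟩
    exact ⟨fun v => add_eq_zero_iff_eq_neg.2 (h.1 v), fun w => neg_eq_iff_eq_neg.2 (h.2.1 w),
      h.2.2, (hcond (hlocal.1 h)).1 h4⟩

end Condensation

/-! ### Facets of the unsplit mesh, and the theorem -/

section Split

variable {n : ℕ} {Ω : Set (Pt n)} {T T₀ : Mesh n Ω} {F : Finset (Pt n)}

/-- The facets of the original mesh are facets of its split. -/
lemma mem_facets_of_isSplitOf (h : IsSplitOf T T₀) (hF : F ∈ T₀.facets) : F ∈ T.facets := by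
  obtain ⟨S, hS, hFS, hFc⟩ := Mesh.mem_facets.1 hF
  obtain ⟨a, ha, rfl⟩ := exists_eq_erase (Mesh.isSimplex hS) hFS hFc
  exact Mesh.mem_facets.2 ⟨_, subcell_mem h hS ha, Finset.subset_insert _ _, hFc⟩

end Split

end HybridElasticity

end

theorem mainTheorem11 (n k : ℕ) (hn : n = 2 ∨ n = 3) (hk : 1 ≤ k)
    (Ω : Set (Pt n)) (hΩ_open : IsOpen Ω) (hΩ_conn : IsConnected Ω)
    (hΩ_reg : interior (closure Ω) = Ω)
    (Γ₀ Γ₁ : Set (Pt n)) (hΓ_union : Γ₀ ∪ Γ₁ = frontier Ω) (hΓ_disj : Disjoint Γ₀ Γ₁)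
    (hΓ₀_pos : 0 < surf n Γ₀)
    (T : Mesh n Ω) (hT : T.IsBarycentricSplit)
    (hTΓ : ∀ F ∈ T.facets, hull F ⊆ frontier Ω → LiesIn F Γ₀ ∨ LiesIn F Γ₁)
    (lam mu : T.Cell → ℝ) (hmu : ∀ K, 0 < mu K) (hlam : ∀ K, 0 < n * lam K + 2 * mu K)
    (ρS : ℝ) (hρS : 0 < ρS)
    (f : Pt n → Pt n) (hf : MemLp f 2 (volume.restrict Ω)) :
    -- the local solution operators are well defined
    (∀ μ : Mh T k Γ₀, ∀ s : Vh T k × Wh T k × Ah T k,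
      IsLocalSolution T k lam mu ρS (fun v => -bdryInner T μ v) (fun _ => 0) s ↔
        s = (Q₁ T k Γ₀ lam mu ρS μ, Q₂ T k Γ₀ lam mu ρS μ, Q₃ T k Γ₀ lam mu ρS μ)) ∧
    (∀ s : Vh T k × Wh T k × Ah T k,
      IsLocalSolution T k lam mu ρS (fun _ => 0) (fun w => -loadInner T f w) s ↔
        s = (QL₁ T k lam mu ρS f, QL₂ T k lam mu ρS f, QL₃ T k lam mu ρS f)) ∧
    -- the condensed problem is uniquely solvable
    (∃! γ : Mh T k Γ₀, SolvesCondensed T k Γ₀ lam mu ρS f γ) ∧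
    -- equivalence with the hybridized system, and recovery of the other unknowns
    (∀ (σ : Vh T k) (u : Wh T k) (ρ : Ah T k) (γ : Mh T k Γ₀),
      IsHybridSolution T k Γ₀ lam mu ρS f σ u ρ γ ↔
        ((SolvesCondensed T k Γ₀ lam mu ρS f γ ∧
            ∀ γ' : Mh T k Γ₀, SolvesCondensed T k Γ₀ lam mu ρS f γ' → γ' = γ) ∧
          σ = Q₁ T k Γ₀ lam mu ρS γ + QL₁ T k lam mu ρS f ∧
          u = Q₂ T k Γ₀ lam mu ρS γ + QL₂ T k lam mu ρS f ∧
          ρ = Q₃ T k Γ₀ lam mu ρS γ + QL₃ T k lam mu ρS f)) := by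
  have hn1 : 1 ≤ n := by omega
  obtain ⟨T₀, hT₀⟩ := hT
  -- The facet is taken from the unsplit mesh, since the macroelement argument starts at a macro
  -- facet.
  obtain ⟨F, hF, hFb, hFpos⟩ := T₀.exists_boundary_facet hn1 hΩ_open hΩ_reg
    (hΓ_union ▸ Set.subset_union_left) hΓ₀_pos
  have hFΓ : LiesIn F Γ₀ := by
    -- A facet lying in Γ₁ up to a null set cannot meet the disjoint Γ₀ in positive measure.
    refine (hTΓ F (mem_facets_of_isSplitOf hT₀ hF) hFb).resolve_right fun h => hFpos.ne' ?_
    exact measure_mono_null (Set.sdiff_eq (hull F) Γ₁ ▸ Set.inter_subset_inter_right _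
      hΓ_disj.subset_compl_right) h
  have hker : ∀ (u : Wh T k) (ρ : Ah T k) (γ : Mh T k Γ₀), InKernel T k u ρ γ → γ = 0 :=
    -- The dimension and the degree enter through `n ≤ k + 2`: potentials of degree k + 2 must
    -- accommodate one factor for each of the `n` vertices of a facet.
    fun u ρ γ h => Subtype.ext (h.eq_zero hn1 (by omega) hΩ_open hΩ_conn hΩ_reg hT₀ hF hFb hFΓ
      u.2 ρ.2 γ.2).2.2
  have huniq := existsUnique_solvesCondensed hn1 hmu hlam hρS hΩ_reg hf hker
  refine ⟨isLocalSolution_iff_eq_Q hn1 hmu hlam hρS,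
    isLocalSolution_iff_eq_QL hn1 hmu hlam hρS hΩ_reg hf, huniq, fun σ u ρ γ => ?_⟩
  rw [isHybridSolution_iff hn1 hmu hlam hρS hΩ_reg hf, Prod.ext_iff, Prod.ext_iff]
  exact and_congr_left fun _ => ⟨fun h => ⟨h, fun γ' h' => huniq.unique h' h⟩, And.left⟩
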